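/- **Setting.** Let $n\ge 1$, let $\{\emptyset,\Omega\}=\mathcal F_0\subseteq\mathcal F_1\subseteq\dots\subseteq\mathcal F_n$ be $\sigma$-fields on a probability space, and let $Y=\{Y_i\}_{i=1}^n$ be a square integrable martingale difference sequence: $Y_i$ is $\mathcal F_i$-measurable, $E[Y_i^2]<\infty$ and $E[Y_i\mid\mathcal F_{i-1}]=0$. Put $$s_n^2=\sum_{i=1}^nE[Y_i^2],\qquad \sigma_i^2=E[Y_i^2\mid\mathcal F_{i-1}],\qquad V_n^2=\frac1{s_n^2}\sum_{i=1}^n\sigma_i^2,\qquad X_n=\frac1{s_n}\sum_{i=1}^nY_i .$$ Let $\mathcal N$ be a standard normal random variable and let $\mathcal W_r(X_n,\mathcal N)=\inf\|U-V\|_r$, the infimum over all couplings $(U,V)$ of the law of $X_n$ and the law of $\mathcal N$, where $\|U\|_r=E[|U|^r]^{1/r}$. An *N-function* is a convex $\psi:[0,\infty)\to[0,\infty)$ with $\psi(x)>0$ for $x>0$, $\lim_{x\downarrow0}\psi(x)/x=0$ and $\lim_{x\to\infty}\psi(x)/x=\infty$. Its inverse is $\psi^{-1}(y)=\sup\{x\ge0:\psi(x)\le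 y\}$. Write $\psi_1\preccurlyeq\psi_2$ if $\psi_2(x)/\psi_1(x)$ is non-decreasing on $(0,\infty)$. Let $$\|Y\|_\psi=\inf\Big\{c>0:\frac1n\sum_{i=1}^nE[\psi(|Y_i|/c)]\le1\Big\}\in[0,\infty],\qquad L_\psi=\frac1{s_n}\|Y\|_\psi\,\psi^{-1}(n),\qquad M_\psi=\max_{1\le i\le n}E[\psi(|Y_i|)]\in[0,\infty].$$ **Statement.** There are a universal constant $C$ and, for each $\theta>0$, a constant $K_\theta$ depending only on $\theta$, such that the following holds whenever $V_n^2=1$ almost surely (in particular $s_n>0$) and $\psi$ is an N-function with $\psi\preccurlyeq x^3$ for which $x\mapsto\psi(\sqrt x)$ is convex. (i) $\mathcal W_r(X_n,\mathcal N)\le C\,L_\psi$ for $r\in\{1,2\}$. (ii) Suppose that for some constant $\sigma>0$, almost surely $\sigma_i\ge\sigma$ for all $1\le i\le n$. Then - if $\psi(x)=x^3$ and $n\ge2$, then $\mathcal W_1(X_n,\mathcal N)\le C\,\dfrac{M_\psi}{\sigma^2s_n}\log n$; - if $\psi\preccurlyeq x^p$ for some $p\in(2,3)$, then $\mathcal W_1(X_n,\mathcal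 N)\le \dfrac{C}{3-p}\,\dfrac{M_\psi\,s_n^2}{\sigma^2\psi(s_n)}$; - $\mathcal W_2(X_n,\mathcal N)\le C\,\dfrac{M_\psi^{1/2}s_n}{\sigma\,\psi(s_n)^{1/2}}$. (iii) Suppose that for some constant $\theta>0$, almost surely $E[\psi(|Y_i|)\mid\mathcal F_{i-1}]\le\theta\sigma_i^2$ for all $1\le i\le n$. Then - if $\psi(x)=x^3$, then $\mathcal W_1(X_n,\mathcal N)\le K_\theta\,\dfrac1{s_n}\log(e+s_n)$; - if $\psi\preccurlyeq x^p$ for some $p\in(2,3)$, then $\mathcal W_1(X_n,\mathcal N)\le \dfrac{K_\theta}{3-p}\,\dfrac{s_n^2}{\psi(s_n)}$; - $\mathcal W_2(X_n,\mathcal N)\le K_\theta\,\dfrac{s_n}{\psi(s_n)^{1/2}}$. Finally, if $\theta=\max_{1\le i\le n}\|Y_i\|_\infty<\infty$, then $$\mathcal W_1(X_n,\mathcal N)\le C\,\frac{\theta}{s_n}\log\Big(e+\frac{s_n}{\theta}\Big),\qquad \mathcal W_1(X_n,\mathcal N)\le K_\theta\,\frac{\theta}{s_n}\log(e+s_n),\qquad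 \mathcal W_2(X_n,\mathcal N)\le C\Big(\frac{\theta}{s_n}\Big)^{1/2},$$ and if moreover $\theta\ge1$, then $\mathcal W_1(X_n,\mathcal N)\le C\,\dfrac{\theta}{s_n}\log(e+s_n)$. -/

import Mathlib

open MeasureTheory ProbabilityTheory Filter Topology Set
open scoped ENNReal

namespace MartingaleCLT

noncomputable section

/-- The relation `f₁ ≼ f₂`: the quotient `f₂ / f₁` is non-decreasing on `(0, ∞)`. -/
def Prec (f₁ f₂ : ℝ → ℝ) : Prop :=
  MonotoneOn (fun x => f₂ x / f₁ x) (Ioi 0)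

/-- `ψ`, restricted to `[0, ∞)`, is an N-function; its values at negative arguments
are irrelevant. -/
structure IsNFunction (ψ : ℝ → ℝ) : Prop where
  convexOn : ConvexOn ℝ (Ici 0) ψ
  nonneg : ∀ x, 0 ≤ x → 0 ≤ ψ x
  pos : ∀ x, 0 < x → 0 < ψ x
  tendsto_zero : Tendsto (fun x => ψ x / x) (𝓝[>] 0) (𝓝 0)
  tendsto_atTop : Tendsto (fun x => ψ x / x) atTop atTop

/-- The inverse `ψ⁻¹` of an N-function `ψ : [0, ∞) → [0, ∞)`. An N-function is continuous and
strictly increasing on `(0, ∞)` and unbounded, so for `y > 0` the supremum is the solution of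
`ψ x = y`. -/
def inverse (ψ : ℝ → ℝ) (y : ℝ) : ℝ :=
  sSup {x : ℝ | 0 ≤ x ∧ ψ x ≤ y}

/-- The Wasserstein distance of order `r` between two measures on `ℝ`, with values in `[0, ∞]`:
the infimum of `‖U - V‖_r` over all couplings `(U, V)`, a coupling being given by its law `π`. -/
def wasserstein (r : ℝ≥0∞) (μ ν : Measure ℝ) : ℝ≥0∞ :=
  ⨅ (π : Measure (ℝ × ℝ)) (_ : π.map Prod.fst = μ) (_ : π.map Prod.snd = ν),
    eLpNorm (fun z : ℝ × ℝ => z.1 - z.2) r π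

variable {Ω : Type*} [mΩ : MeasurableSpace Ω]

/-- `Y 1, …, Y n` is a square integrable martingale difference sequence with respect to the
σ-fields `ℱ 0 ⊆ ℱ 1 ⊆ … ⊆ ℱ n`, where `ℱ 0` is trivial. Only these indices matter. -/
structure IsMDS (μ : Measure Ω) (ℱ : Filtration ℕ mΩ) (Y : ℕ → Ω → ℝ) (n : ℕ) : Prop where
  trivial_zero : ℱ 0 = ⊥
  measurable : ∀ i ∈ Finset.Icc 1 n, Measurable[ℱ i] (Y i)
  memLp : ∀ i ∈ Finset.Icc 1 n, MemLp (Y i) 2 μ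
  condExp_eq_zero : ∀ i ∈ Finset.Icc 1 n, μ[Y i | ℱ (i - 1)] =ᵐ[μ] 0

/-- `s_n = (∑_{i=1}^n E[Y_i²])^{1/2}`. -/
def stdDev (μ : Measure Ω) (Y : ℕ → Ω → ℝ) (n : ℕ) : ℝ :=
  √(∑ i ∈ Finset.Icc 1 n, ∫ ω, Y i ω ^ 2 ∂μ)

/-- The conditional variance `σ_i² = E[Y_i² | ℱ_{i-1}]`. -/
def condVariance (μ : Measure Ω) (ℱ : Filtration ℕ mΩ) (Y : ℕ → Ω → ℝ) (i : ℕ) : Ω → ℝ :=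
  μ[fun ω => Y i ω ^ 2 | ℱ (i - 1)]

/-- `V_n² = s_n⁻² ∑_{i=1}^n σ_i²`. -/
def normalizedVariance (μ : Measure Ω) (ℱ : Filtration ℕ mΩ) (Y : ℕ → Ω → ℝ) (n : ℕ) (ω : Ω) :
    ℝ :=
  (∑ i ∈ Finset.Icc 1 n, condVariance μ ℱ Y i ω) / stdDev μ Y n ^ 2

/-- `X_n = s_n⁻¹ ∑_{i=1}^n Y_i`. -/
def normalizedSum (μ : Measure Ω) (Y : ℕ → Ω → ℝ) (n : ℕ) (ω : Ω) : ℝ :=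
  (∑ i ∈ Finset.Icc 1 n, Y i ω) / stdDev μ Y n

/-- `W_r(X_n, N)`: the Wasserstein distance between the law of `X_n` and the standard normal
distribution. -/
def distNormal (r : ℝ≥0∞) (μ : Measure Ω) (Y : ℕ → Ω → ℝ) (n : ℕ) : ℝ≥0∞ :=
  wasserstein r (μ.map (normalizedSum μ Y n)) (gaussianReal 0 1)

/-- `E[ψ(|U|)]`, with values in `[0, ∞]`. -/
def orliczMoment (μ : Measure Ω) (ψ : ℝ → ℝ) (U : Ω → ℝ) : ℝ≥0∞ :=
  ∫⁻ ω, ENNReal.ofReal (ψ |U ω|) ∂μ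

/-- The Orlicz norm `‖Y‖_ψ = inf {c > 0 : n⁻¹ ∑_{i=1}^n E[ψ(|Y_i| / c)] ≤ 1}` of the sequence
`Y 1, …, Y n`, with values in `[0, ∞]` (and `inf ∅ = ∞`). -/
def orliczNorm (μ : Measure Ω) (ψ : ℝ → ℝ) (Y : ℕ → Ω → ℝ) (n : ℕ) : ℝ≥0∞ :=
  ⨅ (c : ℝ) (_ : 0 < c)
    (_ : (∑ i ∈ Finset.Icc 1 n, orliczMoment μ ψ (fun ω => Y i ω / c)) / (n : ℝ≥0∞) ≤ 1),
    ENNReal.ofReal c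

/-- `L_ψ = s_n⁻¹ ‖Y‖_ψ ψ⁻¹(n)`. -/
def lyapunov (μ : Measure Ω) (ψ : ℝ → ℝ) (Y : ℕ → Ω → ℝ) (n : ℕ) : ℝ≥0∞ :=
  ENNReal.ofReal (inverse ψ n / stdDev μ Y n) * orliczNorm μ ψ Y n

/-- `M_ψ = max_{1 ≤ i ≤ n} E[ψ(|Y_i|)]`. -/
def maxMoment (μ : Measure Ω) (ψ : ℝ → ℝ) (Y : ℕ → Ω → ℝ) (n : ℕ) : ℝ≥0∞ :=
  (Finset.Icc 1 n).sup fun i => orliczMoment μ ψ (Y i)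

/-- `max_{1 ≤ i ≤ n} ‖Y_i‖_∞`. -/
def maxNorm (μ : Measure Ω) (Y : ℕ → Ω → ℝ) (n : ℕ) : ℝ≥0∞ :=
  (Finset.Icc 1 n).sup fun i => eLpNorm (Y i) ∞ μ

/-- Almost surely `E[ψ(|Y_i|) | ℱ_{i-1}] ≤ θ σ_i²` for `i = 1, …, n`. Taking expectations, such a
bound forces `E[ψ(|Y_i|)] ≤ θ E[Y_i²] < ∞`; this integrability is recorded because `condExp` of a
non-integrable function is `0` by convention. -/
def CondMomentBound (μ : Measure Ω) (ℱ : Filtration ℕ mΩ) (ψ : ℝ → ℝ) (Y : ℕ → Ω → ℝ) (n : ℕ)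
    (θ : ℝ) : Prop :=
  ∀ i ∈ Finset.Icc 1 n, Integrable (fun ω => ψ |Y i ω|) μ ∧
    ∀ᵐ ω ∂μ, (μ[fun ω => ψ |Y i ω| | ℱ (i - 1)]) ω ≤ θ * condVariance μ ℱ Y i ω

end

end MartingaleCLT

open MartingaleCLT

namespace MartingaleCLT

/-! ### Gaussian integrals -/

local notation "γ₀" => gaussianReal 0 1

/-! The proof is Lindeberg's replacement method with heat-kernel smoothing, joined to an explicit
form of duality along the monotone coupling.

Duality. For two laws on the line, couple by quantile functions. Along this monotone coupling `(p,
q)` one can write down a function `f` with `|p - q| ^ k ≤ 2 * (f p - f q)`, where `f` is Lipschitz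
for `k = 1` and has Lipschitz derivative for `k = 2` (`exists_potential_one`,
`exists_potential_two`). Hence `W_k ^ k` is at most twice the largest difference of expectations
over such test functions (`wasserstein_le_of_test`), and both distances can be treated by the same
argument.

Replacement. Let `S_i` be the partial sums and `v_i` the variance still to come after step `i`, plus
`ε²`. Since the conditional variances sum to the constant `s_n²`, `v_{i+1}` is known at time `i`.
The quantity `E[heat f v_i (S_i)]` interpolates between a Gaussian expectation (`i = 0`) and that of
the martingale (`i = n`), up to smoothing errors of order `ε ^ k`. In one step, expand both the
added increment and the added Gaussian variance around `heat f v_{i+1} (S_i)`: the first order term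
vanishes by the martingale property, the second order terms cancel by definition of the conditional
variance, and with `v = v_{i+1}` the remainder is at most a constant times `√v ^ k * min(a², |a|³)`
with `a = Y_{i+1} / √v` (`lindeberg_step`). No derivative of `f` is taken: the expansion comes from
shifting the Gaussian density, and the coefficients are integrals against Hermite polynomials. The
sum of these remainders is `lindebergSum`.

Moments. The hypotheses on `ψ` say that it lies between `x²` and `x³` in the order `≼`, so `min(a²,
|a|³) ≤ ψ(|Y|) / ψ(√v)`, and `x ^ k / ψ x` is non-increasing for `k ≤ 2`. It remains to choose `ε`
and to bound `v` from below. For (i), use `v ≥ ε²` with `ε` proportional to `c ψ⁻¹(n)`. For (ii),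
`v_i ≥ ε² + (n - i) σ²` gives a Riemann sum of a power. For (iii), each conditional moment is at
most `θ` times the decrement `v_i - v_{i+1}`, so the sum is compared with the integral of a power of
`v`; this requires `ε ≥ σ_i` for all `i`, so that consecutive `v_i` are comparable. -/

theorem integrable_exp_mul_abs (c : ℝ) : Integrable (fun z : ℝ => Real.exp (c * |z|)) γ₀ := by
  refine ((integrable_exp_mul_gaussianReal (μ := 0) (v := 1) c).add
    (integrable_exp_mul_gaussianReal (μ := 0) (v := 1) (-c))).mono'
    (by fun_prop) (Eventually.of_forall fun z => ?_)
  rw [Real.norm_eq_abs, Real.abs_exp]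
  simp only [Pi.add_apply]
  rcases abs_cases z with ⟨h, _⟩ | ⟨h, _⟩ <;> rw [h]
  · linarith [Real.exp_pos (-c * z)]
  · have : c * -z = -c * z := by ring
    rw [this]; linarith [Real.exp_pos (c * z)]

theorem one_add_abs_pow_le_exp (m : ℕ) (z : ℝ) : (1 + |z|) ^ m ≤ Real.exp (m * |z|) := by
  rw [Real.exp_nat_mul]
  exact pow_le_pow_left₀ (by positivity) (by linarith [Real.add_one_le_exp |z|]) m

theorem integrable_of_growth {h : ℝ → ℝ} (hm : Measurable h) {A : ℝ} {m : ℕ}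
    (hA : ∀ z, |h z| ≤ A * (1 + |z|) ^ m) : Integrable h γ₀ := by
  have hA0 : 0 ≤ A := by simpa using (abs_nonneg _).trans (hA 0)
  refine ((integrable_exp_mul_abs m).const_mul A).mono' hm.aestronglyMeasurable
    (Eventually.of_forall fun z => (hA z).trans ?_)
  gcongr
  exact one_add_abs_pow_le_exp m z

theorem integrable_id_gaussian : Integrable (fun z : ℝ => z) γ₀ :=
  integrable_of_growth (A := 1) (m := 1) measurable_id fun z => by simp

theorem integrable_sq_gaussian : Integrable (fun z : ℝ => z ^ 2) γ₀ :=
  integrable_of_growth (A := 1) (m := 2) (by fun_prop) fun z => by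
    rw [abs_pow, one_mul]; gcongr; linarith

theorem integral_id_gaussian : ∫ z : ℝ, z ∂γ₀ = 0 := integral_id_gaussianReal

theorem integral_sq_gaussian : ∫ z : ℝ, z ^ 2 ∂γ₀ = 1 := by
  have h := variance_fun_id_gaussianReal (μ := 0) (v := 1)
  rw [variance_eq_integral (by fun_prop), integral_id_gaussianReal] at h
  simpa using h

/-- A universal constant bounding all Gaussian moments that occur below. -/
noncomputable def gaussConst : ℝ := 4 * ∫ z, Real.exp (6 * |z|) ∂γ₀

theorem abs_integral_gaussian_le {h : ℝ → ℝ} {B : ℝ}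
    (hB : ∀ z, |h z| ≤ B * (4 * Real.exp (6 * |z|))) :
    |∫ z, h z ∂γ₀| ≤ gaussConst * B := by
  have := norm_integral_le_of_norm_le
    (((integrable_exp_mul_abs 6).const_mul 4).const_mul B)
    (Eventually.of_forall hB : ∀ᵐ z ∂γ₀, ‖h z‖ ≤ _)
  rw [integral_const_mul, integral_const_mul] at this
  simpa [gaussConst, mul_comm] using this

theorem one_le_gaussConst : 1 ≤ gaussConst := by
  have := abs_integral_gaussian_le (h := fun _ => 1) (B := 1) fun z => by
    have := Real.one_le_exp (x := 6 * |z|) (by positivity)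
    rw [abs_one]; linarith
  simpa using this

theorem abs_integral_gaussian_le_of_growth {h : ℝ → ℝ} {B : ℝ} {m : ℕ} (hm : m ≤ 6)
    (hB : ∀ z, |h z| ≤ B * (4 * (1 + |z|) ^ m)) :
    |∫ z, h z ∂γ₀| ≤ gaussConst * B := by
  have hB0 : 0 ≤ B := by have := (abs_nonneg _).trans (hB 0); simp at this; linarith
  refine abs_integral_gaussian_le fun z => (hB z).trans ?_
  gcongr
  refine (one_add_abs_pow_le_exp m z).trans (Real.exp_le_exp.2 ?_)
  have : (m : ℝ) ≤ 6 := by exact_mod_cast hm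
  gcongr

/-- The Cameron–Martin formula. It moves a translation from the possibly rough integrand to a smooth
exponential weight, which can then be expanded in `a`. -/
theorem integral_gaussian_shift (h : ℝ → ℝ) (a : ℝ) :
    ∫ z, h (a + z) ∂γ₀ = ∫ z, h z * Real.exp (a * z - a ^ 2 / 2) ∂γ₀ := by
  rw [integral_gaussianReal_eq_integral_smul one_ne_zero,
    integral_gaussianReal_eq_integral_smul one_ne_zero,
    ← integral_add_left_eq_self _ (-a)]
  congr 1 with z
  simp only [gaussianPDFReal_def, smul_eq_mul, NNReal.coe_one]
  rw [show a + (-a + z) = z by ring, show -(-a + z - 0) ^ 2 / (2 * (1 : ℝ))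
    = -(z - 0) ^ 2 / (2 * 1) + (a * z - a ^ 2 / 2) by ring, Real.exp_add]
  ring

theorem abs_exp_sub_quadratic_le (w : ℝ) :
    |Real.exp w - 1 - w - w ^ 2 / 2| ≤ |w| ^ 3 * Real.exp |w| := by
  have h := Complex.norm_exp_sub_sum_le_norm_mul_exp (w : ℂ) 3
  have e : Complex.exp w - ∑ m ∈ Finset.range 3, (w : ℂ) ^ m / (m.factorial : ℂ)
      = ((Real.exp w - 1 - w - w ^ 2 / 2 : ℝ) : ℂ) := by
    simp [Finset.sum_range_succ, Nat.factorial]; ring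
  rw [e, Complex.norm_real, Complex.norm_real] at h
  simpa using h

/-- The exponential is the generating function of the Hermite polynomials; those of degree at most
two are subtracted, which leaves an error cubic in `a` with a weight that is integrable for the
Gaussian. -/
theorem abs_exp_hermite_le {a z : ℝ} (ha : |a| ≤ 1) :
    |Real.exp (a * z - a ^ 2 / 2) - 1 - a * z - a ^ 2 / 2 * (z ^ 2 - 1)|
      ≤ |a| ^ 3 * (4 * Real.exp (4 * |z|)) := by
  set w := a * z - a ^ 2 / 2 with hw
  have ha0 := abs_nonneg a
  have hz0 := abs_nonneg z
  have hww : |w| ≤ |a| * (|z| + 1 / 2) := by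
    calc |w| ≤ |a * z| + |a ^ 2 / 2| := abs_sub _ _
      _ = |a| * |z| + |a| * |a| / 2 := by rw [abs_mul, abs_div, abs_pow, abs_two]; ring
      _ ≤ _ := by nlinarith
  have h1 : |w| ≤ |z| + 1 := hww.trans (by nlinarith)
  have h2 : |w| ≤ |a| * (1 + |z|) := hww.trans (by nlinarith)
  have h3 := abs_exp_sub_quadratic_le w
  have e : Real.exp w - 1 - a * z - a ^ 2 / 2 * (z ^ 2 - 1)
      = (Real.exp w - 1 - w - w ^ 2 / 2) + (-(a ^ 3 * z / 2) + a ^ 4 / 8) := by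
    rw [hw]; ring
  have h4 : |(-(a ^ 3 * z / 2) + a ^ 4 / 8)| ≤ |a| ^ 3 * (1 + |z|) := by
    calc _ ≤ |(-(a ^ 3 * z / 2))| + |a ^ 4 / 8| := abs_add_le _ _
      _ = |a| ^ 3 * (|z| / 2 + |a| / 8) := by
        rw [abs_neg, abs_div, abs_mul, abs_pow, abs_div, abs_pow, abs_two,
          abs_of_pos (by norm_num : (0 : ℝ) < 8)]; ring
      _ ≤ _ := by gcongr ?_ * ?_; linarith
  have h5 : |w| ^ 3 * Real.exp |w| ≤ |a| ^ 3 * (3 * Real.exp (4 * |z|)) := by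
    calc |w| ^ 3 * Real.exp |w| ≤ (|a| * (1 + |z|)) ^ 3 * Real.exp (|z| + 1) := by gcongr
      _ = |a| ^ 3 * ((1 + |z|) ^ 3 * (Real.exp |z| * Real.exp 1)) := by
        rw [mul_pow, Real.exp_add]; ring
      _ ≤ |a| ^ 3 * (Real.exp ((3 : ℕ) * |z|) * (Real.exp |z| * 3)) := by
        gcongr
        · exact one_add_abs_pow_le_exp 3 z
        · linarith [Real.exp_one_lt_d9]
      _ = _ := by
        rw [show 4 * |z| = (3 : ℕ) * |z| + |z| by push_cast; ring, Real.exp_add]; ring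
  have h6 : 1 + |z| ≤ Real.exp (4 * |z|) := by
    linarith [Real.add_one_le_exp (4 * |z|)]
  rw [e]
  calc _ ≤ _ := abs_add_le _ _
    _ ≤ |a| ^ 3 * (3 * Real.exp (4 * |z|)) + |a| ^ 3 * Real.exp (4 * |z|) := by
      refine add_le_add (h3.trans h5) (h4.trans ?_)
      gcongr
    _ = _ := by ring

theorem integral_comb {p q r s : ℝ → ℝ} {a b : ℝ} (hp : Integrable p γ₀) (hq : Integrable q γ₀)
    (hr : Integrable r γ₀) (hs : Integrable s γ₀) :
    ∫ z, (p z - q z - a * r z - b * s z) ∂γ₀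
      = ∫ z, p z ∂γ₀ - ∫ z, q z ∂γ₀ - a * ∫ z, r z ∂γ₀ - b * ∫ z, s z ∂γ₀ := by
  have h1 : Integrable (fun z => p z - q z) γ₀ := hp.sub hq
  have h2 : Integrable (fun z => p z - q z - a * r z) γ₀ := h1.sub (hr.const_mul a)
  rw [integral_sub h2 (hs.const_mul b), integral_sub h1 (hr.const_mul a), integral_sub hp hq,
    integral_const_mul, integral_const_mul]

/-! ### Test functions and their Gaussian smoothing -/

/-- The remainder of the first order expansion of `f` at `x` with slope `d x`. -/
def taylorRem (f d : ℝ → ℝ) (x y : ℝ) : ℝ := f (x + y) - f x - d x * y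

/-- Functions `f` that are approximated at each point by an affine function, with slope `d`, up to
an error `L |y| ^ k`. For `k = 1` and `d = 0` these are the Lipschitz functions, for `k = 2` the
functions with Lipschitz derivative `d`. -/
structure IsTest (k : ℕ) (L : ℝ) (f d : ℝ → ℝ) : Prop where
  measurable : Measurable f
  measurable_slope : Measurable d
  bound : ∀ x y, |taylorRem f d x y| ≤ L * |y| ^ k
  growth : ∃ A, ∀ x, |d x| ≤ A * (1 + |x|)

/-- The heat semigroup. -/
noncomputable def heat (f : ℝ → ℝ) (v x : ℝ) : ℝ := ∫ z, f (x + √v * z) ∂γ₀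

/-- The first derivative of `heat f v`. -/
noncomputable def heatGrad (f d : ℝ → ℝ) (v x : ℝ) : ℝ :=
  d x + (∫ z, taylorRem f d x (√v * z) * z ∂γ₀) / √v

/-- The second derivative of `heat f v`. -/
noncomputable def heatHess (f d : ℝ → ℝ) (v x : ℝ) : ℝ :=
  (∫ z, taylorRem f d x (√v * z) * (z ^ 2 - 1) ∂γ₀) / v

/-- `min (a²) (|a|³)`. -/
noncomputable def quadCubic (a : ℝ) : ℝ := min (a ^ 2) (|a| ^ 3)

theorem quadCubic_nonneg (a : ℝ) : 0 ≤ quadCubic a := le_min (by positivity) (by positivity)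

theorem quadCubic_le_sq (a : ℝ) : quadCubic a ≤ a ^ 2 := min_le_left _ _

theorem measurable_quadCubic : Measurable quadCubic := by unfold quadCubic; fun_prop

theorem quadCubic_of_abs_le_one {a : ℝ} (h : |a| ≤ 1) : quadCubic a = |a| ^ 3 := by
  refine min_eq_right ?_
  rw [← sq_abs]; exact pow_le_pow_of_le_one (abs_nonneg a) h (by norm_num)

theorem quadCubic_of_one_le_abs {a : ℝ} (h : 1 ≤ |a|) : quadCubic a = a ^ 2 := by
  refine min_eq_left ?_
  rw [← sq_abs]; exact pow_le_pow_right₀ h (by norm_num)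

theorem quadCubic_mul_le (a z : ℝ) : quadCubic (a * z) ≤ quadCubic a * (1 + |z|) ^ 3 := by
  have hz := abs_nonneg z
  rw [quadCubic, quadCubic, min_mul_of_nonneg _ _ (by positivity)]
  refine min_le_min ?_ ?_
  · rw [mul_pow]
    gcongr
    rw [← sq_abs z]
    calc |z| ^ 2 ≤ (1 + |z|) ^ 2 := by gcongr; linarith
      _ ≤ (1 + |z|) ^ 3 := pow_le_pow_right₀ (by linarith) (by norm_num)
  · rw [abs_mul, mul_pow]; gcongr; linarith

theorem pow_le_one_add_sq {k : ℕ} (hk : k ≤ 2) {t : ℝ} (ht : 0 ≤ t) : t ^ k ≤ (1 + t) ^ 2 :=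
  (pow_le_pow_left₀ ht (by linarith) k).trans (pow_le_pow_right₀ (by linarith) hk)

namespace IsTest

variable {k : ℕ} {L : ℝ} {f d : ℝ → ℝ}

theorem nonneg (hf : IsTest k L f d) : 0 ≤ L := by
  simpa using (abs_nonneg _).trans (hf.bound 0 1)

@[fun_prop]
theorem measurable_taylorRem (hf : IsTest k L f d) :
    Measurable fun p : ℝ × ℝ => taylorRem f d p.1 p.2 := by
  have := hf.measurable; have := hf.measurable_slope
  unfold taylorRem; fun_prop

theorem measurable_taylorRem_right (hf : IsTest k L f d) (x : ℝ) :
    Measurable (taylorRem f d x) := by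
  have := hf.measurable
  unfold taylorRem; fun_prop

theorem measurable_heat (hf : IsTest k L f d) :
    Measurable fun p : ℝ × ℝ => heat f p.1 p.2 := by
  have := hf.measurable
  have h : Measurable fun q : (ℝ × ℝ) × ℝ => f (q.1.2 + √q.1.1 * q.2) := by fun_prop
  exact (h.stronglyMeasurable.integral_prod_right (ν := γ₀)).measurable

theorem measurable_heatGrad (hf : IsTest k L f d) :
    Measurable fun p : ℝ × ℝ => heatGrad f d p.1 p.2 := by
  have := hf.measurable_slope
  have h : Measurable fun q : (ℝ × ℝ) × ℝ => taylorRem f d q.1.2 (√q.1.1 * q.2) * q.2 :=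
    (hf.measurable_taylorRem.comp (by fun_prop :
      Measurable fun q : (ℝ × ℝ) × ℝ => (q.1.2, √q.1.1 * q.2))).mul (by fun_prop)
  have h' := (StronglyMeasurable.integral_prod_right (ν := γ₀)
    (f := fun (p : ℝ × ℝ) z => taylorRem f d p.2 (√p.1 * z) * z) h.stronglyMeasurable).measurable
  unfold heatGrad
  fun_prop

theorem measurable_heatHess (hf : IsTest k L f d) :
    Measurable fun p : ℝ × ℝ => heatHess f d p.1 p.2 := by
  have h : Measurable fun q : (ℝ × ℝ) × ℝ =>
      taylorRem f d q.1.2 (√q.1.1 * q.2) * (q.2 ^ 2 - 1) :=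
    (hf.measurable_taylorRem.comp (by fun_prop :
      Measurable fun q : (ℝ × ℝ) × ℝ => (q.1.2, √q.1.1 * q.2))).mul (by fun_prop)
  have h' := (StronglyMeasurable.integral_prod_right (ν := γ₀)
    (f := fun (p : ℝ × ℝ) z => taylorRem f d p.2 (√p.1 * z) * (z ^ 2 - 1))
    h.stronglyMeasurable).measurable
  unfold heatHess
  fun_prop

theorem abs_taylorRem_mul_le (hf : IsTest k L f d) (x : ℝ) {r : ℝ} (hr : 0 ≤ r) (z : ℝ) :
    |taylorRem f d x (r * z)| ≤ L * r ^ k * |z| ^ k := by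
  have := hf.bound x (r * z)
  rwa [abs_mul, abs_of_nonneg hr, mul_pow, ← mul_assoc] at this

theorem abs_taylorRem_mul_le_growth (hf : IsTest k L f d) (hk : k ≤ 2) (x : ℝ) {r : ℝ}
    (hr : 0 ≤ r) (z : ℝ) : |taylorRem f d x (r * z)| ≤ L * r ^ k * (1 + |z|) ^ 2 :=
  (hf.abs_taylorRem_mul_le x hr z).trans <| by
    have := hf.nonneg
    gcongr; exact pow_le_one_add_sq hk (abs_nonneg z)

theorem integrable_taylorRem_mul (hf : IsTest k L f d) (hk : k ≤ 2) (x : ℝ) {r : ℝ} (hr : 0 ≤ r)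
    {h : ℝ → ℝ} (hm : Measurable h) {A : ℝ} {m : ℕ} (hA : ∀ z, |h z| ≤ A * (1 + |z|) ^ m) :
    Integrable (fun z => taylorRem f d x (r * z) * h z) γ₀ := by
  have := hf.measurable_taylorRem_right x
  have := hf.nonneg
  refine integrable_of_growth (A := L * r ^ k * A) (m := 2 + m) (by fun_prop) fun z => ?_
  rw [abs_mul, pow_add]
  calc _ ≤ (L * r ^ k * (1 + |z|) ^ 2) * (A * (1 + |z|) ^ m) := by
        gcongr
        · exact hf.abs_taylorRem_mul_le_growth hk x hr z
        · exact hA z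
    _ = _ := by ring

theorem integrable_taylorRem (hf : IsTest k L f d) (hk : k ≤ 2) (x : ℝ) {r : ℝ} (hr : 0 ≤ r) :
    Integrable (fun z => taylorRem f d x (r * z)) γ₀ := by
  simpa using hf.integrable_taylorRem_mul hk x hr (h := fun _ => 1) (by fun_prop) (A := 1) (m := 0)
    (by simp)

theorem abs_taylorRem_add_le (hf : IsTest k L f d) (hk : k ≤ 2) (x : ℝ) {r : ℝ}
    (hr : 0 ≤ r) {b : ℝ} (hb : 1 ≤ b) {a : ℝ} (hab : |a| ≤ b) (z : ℝ) :
    |taylorRem f d x (r * (a + z))| ≤ L * r ^ k * (b ^ 2 * (1 + |z|) ^ 2) := by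
  have := hf.nonneg
  refine (hf.abs_taylorRem_mul_le x hr _).trans ?_
  have hz := abs_nonneg z
  have h1 : |a + z| ≤ b * (1 + |z|) := (abs_add_le a z).trans (by nlinarith)
  gcongr
  calc |a + z| ^ k ≤ (b * (1 + |z|)) ^ k := by gcongr
    _ ≤ (b * (1 + |z|)) ^ 2 := pow_le_pow_right₀ (by nlinarith) hk
    _ = _ := by ring

theorem integrable_taylorRem_add (hf : IsTest k L f d) (hk : k ≤ 2) (x : ℝ) {r : ℝ}
    (hr : 0 ≤ r) (a : ℝ) : Integrable (fun z => taylorRem f d x (r * (a + z))) γ₀ := by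
  have := hf.measurable_taylorRem_right x
  refine integrable_of_growth (A := L * r ^ k * (1 + |a|) ^ 2) (m := 2) (by fun_prop) fun z => ?_
  exact (hf.abs_taylorRem_add_le hk x hr (b := 1 + |a|) (by linarith [abs_nonneg a])
    (by linarith) z).trans_eq (by ring)

/-- The affine part of `f` at `x` is reproduced exactly because the Gaussian is centred, so the
displacement `a` acts on the Taylor remainder only. -/
theorem heat_add_eq (hf : IsTest k L f d) (hk : k ≤ 2) {v : ℝ} (x a : ℝ) :
    heat f v (x + √v * a) = f x + d x * (√v * a) + ∫ z, taylorRem f d x (√v * (a + z)) ∂γ₀ := by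
  have h1 : ∀ z, f (x + √v * a + √v * z)
      = f x + d x * (√v * a) + d x * √v * z + taylorRem f d x (√v * (a + z)) := by
    intro z; rw [taylorRem, mul_add, ← add_assoc]; ring
  rw [heat, integral_congr_ae (Eventually.of_forall h1), integral_add,
    integral_add (integrable_const _) (integrable_id_gaussian.const_mul _), integral_const_mul,
    integral_id_gaussian]
  · simp
  · exact (integrable_const _).add (integrable_id_gaussian.const_mul _)
  · exact hf.integrable_taylorRem_add hk x (Real.sqrt_nonneg v) a

theorem heat_eq (hf : IsTest k L f d) (hk : k ≤ 2) (v x : ℝ) :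
    heat f v x = f x + ∫ z, taylorRem f d x (√v * z) ∂γ₀ := by
  simpa using hf.heat_add_eq hk (v := v) x 0

theorem abs_heat_sub_le (hf : IsTest k L f d) (hk : k ≤ 2) (v x : ℝ) :
    |heat f v x - f x| ≤ gaussConst * (L * √v ^ k) := by
  rw [hf.heat_eq hk, add_sub_cancel_left]
  refine abs_integral_gaussian_le_of_growth (m := 2) (by norm_num) fun z => ?_
  refine (hf.abs_taylorRem_mul_le_growth hk x (Real.sqrt_nonneg v) z).trans ?_
  have := hf.nonneg
  gcongr
  nlinarith [sq_nonneg (1 + |z|)]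

theorem abs_heatHess_le (hf : IsTest k L f d) (hk : k ≤ 2) {v : ℝ} (hv : 0 < v) (x : ℝ) :
    |heatHess f d v x| ≤ gaussConst * (L * √v ^ k / v) := by
  rw [heatHess, abs_div, abs_of_pos hv, ← mul_div_assoc]
  gcongr
  refine abs_integral_gaussian_le_of_growth (m := 4) (by norm_num) fun z => ?_
  rw [abs_mul]
  have := hf.nonneg
  have h2 : |z ^ 2 - 1| ≤ 4 * (1 + |z|) ^ 2 := by
    rw [abs_le]; constructor <;> nlinarith [abs_nonneg z, sq_abs z]
  calc _ ≤ (L * √v ^ k * (1 + |z|) ^ 2) * (4 * (1 + |z|) ^ 2) := by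
        gcongr; exact hf.abs_taylorRem_mul_le_growth hk x (Real.sqrt_nonneg v) z
    _ = _ := by ring

theorem abs_heatGrad_sub_le (hf : IsTest k L f d) (hk : k ≤ 2) (v x : ℝ) :
    |heatGrad f d v x - d x| ≤ gaussConst * (L * √v ^ k / √v) := by
  rw [heatGrad, add_sub_cancel_left, abs_div, abs_of_nonneg (Real.sqrt_nonneg v), ← mul_div_assoc]
  gcongr
  refine abs_integral_gaussian_le_of_growth (m := 3) (by norm_num) fun z => ?_
  rw [abs_mul]
  have := hf.nonneg
  calc _ ≤ (L * √v ^ k * (1 + |z|) ^ 2) * (4 * (1 + |z|)) := by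
        gcongr
        · exact hf.abs_taylorRem_mul_le_growth hk x (Real.sqrt_nonneg v) z
        · linarith [abs_nonneg z]
    _ = _ := by ring

/-- The second order Taylor expansion of `heat f v`. -/
theorem abs_heat_taylor_le (hf : IsTest k L f d) (hk : k ≤ 2) {v : ℝ} (hv : 0 < v) (x y : ℝ) :
    |heat f v (x + y) - heat f v x - y * heatGrad f d v x - y ^ 2 / 2 * heatHess f d v x|
      ≤ gaussConst * (L * √v ^ k * quadCubic (y / √v)) := by
  have hr : 0 < √v := Real.sqrt_pos.2 hv
  have hL := hf.nonneg
  set a := y / √v with ha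
  have hy : y = √v * a := by rw [ha]; field_simp
  have hv2 : v = √v ^ 2 := (Real.sq_sqrt hv.le).symm
  have i0 := hf.integrable_taylorRem_add hk x hr.le a
  have i1 := hf.integrable_taylorRem hk x hr.le
  have i2 := hf.integrable_taylorRem_mul hk x hr.le (h := fun z => z) measurable_id (A := 1) (m := 1)
    fun z => by simp
  have i3 := hf.integrable_taylorRem_mul hk x hr.le (h := fun z => z ^ 2 - 1) (by fun_prop)
    (A := 1) (m := 2) fun z => by
      rw [abs_le]; constructor <;> nlinarith [abs_nonneg z, sq_abs z]
  have e : heat f v (x + y) - heat f v x - y * heatGrad f d v x - y ^ 2 / 2 * heatHess f d v x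
      = ∫ z, (taylorRem f d x (√v * (a + z)) - taylorRem f d x (√v * z)
          - a * (taylorRem f d x (√v * z) * z)
          - a ^ 2 / 2 * (taylorRem f d x (√v * z) * (z ^ 2 - 1))) ∂γ₀ := by
    rw [integral_comb i0 i1 i2 i3, heatGrad, heatHess, hy, hf.heat_add_eq hk, hf.heat_eq hk]
    generalize (∫ z, taylorRem f d x (√v * z) * z ∂γ₀) = I
    generalize (∫ z, taylorRem f d x (√v * z) * (z ^ 2 - 1) ∂γ₀) = J
    rw [mul_pow, Real.sq_sqrt hv.le]
    field_simp
    ring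
  rw [e]
  -- For `|a| ≤ 1`, the shift formula turns the integrand into the remainder times the third order
  -- Hermite error, which gives `|a|³`. For `|a| ≥ 1` no cancellation is needed, since each of the
  -- four terms is of order at most `a²`.
  rcases le_total |a| 1 with h1 | h1
  · have e2 : ∫ z, (taylorRem f d x (√v * (a + z)) - taylorRem f d x (√v * z)
          - a * (taylorRem f d x (√v * z) * z)
          - a ^ 2 / 2 * (taylorRem f d x (√v * z) * (z ^ 2 - 1))) ∂γ₀
        = ∫ z, taylorRem f d x (√v * z) * (Real.exp (a * z - a ^ 2 / 2) - 1 - a * z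
          - a ^ 2 / 2 * (z ^ 2 - 1)) ∂γ₀ := by
      have i4 : Integrable (fun z => taylorRem f d x (√v * z) * Real.exp (a * z - a ^ 2 / 2)) γ₀ := by
        have hm := hf.measurable_taylorRem_right x
        refine ((integrable_exp_mul_abs 3).const_mul (L * √v ^ k)).mono'
          (Measurable.aestronglyMeasurable (by fun_prop)) (Eventually.of_forall fun z => ?_)
        rw [norm_mul, Real.norm_eq_abs, Real.norm_eq_abs, Real.abs_exp]
        calc _ ≤ (L * √v ^ k * Real.exp ((2 : ℕ) * |z|)) * Real.exp |z| := by
              gcongr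
              · exact (hf.abs_taylorRem_mul_le_growth hk x hr.le z).trans
                  (by gcongr; exact one_add_abs_pow_le_exp 2 z)
              · have := le_abs_self (a * z)
                rw [abs_mul] at this
                nlinarith [sq_nonneg a, abs_nonneg z]
          _ = _ := by
              rw [mul_assoc, ← Real.exp_add]; congr 2; push_cast; ring
      have e3 := integral_gaussian_shift (fun z => taylorRem f d x (√v * z)) a
      rw [integral_comb i0 i1 i2 i3, e3, ← integral_comb i4 i1 i2 i3]
      exact integral_congr_ae (Eventually.of_forall fun z => by ring)
    rw [e2, quadCubic_of_abs_le_one h1]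
    refine abs_integral_gaussian_le fun z => ?_
    rw [abs_mul]
    calc _ ≤ (L * √v ^ k * Real.exp ((2 : ℕ) * |z|)) * (|a| ^ 3 * (4 * Real.exp (4 * |z|))) := by
          gcongr
          · exact (hf.abs_taylorRem_mul_le_growth hk x hr.le z).trans
              (by gcongr; exact one_add_abs_pow_le_exp 2 z)
          · exact abs_exp_hermite_le h1
      _ = _ := by
          -- This is where the exponent `6` of `gaussConst` comes from: `2` for the quadratic growth
          -- of the remainder and `4` for the Hermite error.
          rw [show 6 * |z| = (2 : ℕ) * |z| + 4 * |z| by push_cast; ring, Real.exp_add]; ring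
  · rw [quadCubic_of_one_le_abs h1]
    refine abs_integral_gaussian_le_of_growth (m := 4) (by norm_num) fun z => ?_
    set G := taylorRem f d x (√v * z)
    set B := L * √v ^ k
    have hB : 0 ≤ B := by positivity
    have hz := abs_nonneg z
    have ha2 : |a| ^ 2 = a ^ 2 := sq_abs a
    have hG : |G| ≤ B * (1 + |z|) ^ 2 := hf.abs_taylorRem_mul_le_growth hk x hr.le z
    have hGa := hf.abs_taylorRem_add_le hk x hr.le h1 le_rfl z
    rw [ha2] at hGa
    have hA1 : 1 ≤ a ^ 2 := by rw [← ha2]; nlinarith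
    have hA2 : |a| ≤ a ^ 2 := by rw [← ha2]; nlinarith
    have hq : 1 + |a| * |z| + a ^ 2 / 2 * (z ^ 2 + 1) ≤ a ^ 2 * (2 * (1 + |z|) ^ 2) := by
      rw [← sq_abs z]; nlinarith [mul_le_mul_of_nonneg_right hA2 hz, sq_nonneg a]
    have hu : 1 ≤ (1 + |z|) ^ 2 := by nlinarith
    calc _ ≤ |taylorRem f d x (√v * (a + z))| + |G| + |a * (G * z)| + |a ^ 2 / 2 * (G * (z ^ 2 - 1))| := by
          refine (abs_sub _ _).trans (add_le_add_left ((abs_sub _ _).trans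
            (add_le_add_left (abs_sub _ _) _)) _)
      _ ≤ B * (a ^ 2 * (1 + |z|) ^ 2) + |G| * (1 + |a| * |z| + a ^ 2 / 2 * (z ^ 2 + 1)) := by
          have h5 : |z ^ 2 - 1| ≤ z ^ 2 + 1 := by
            rw [abs_le]; constructor <;> nlinarith [sq_nonneg z]
          rw [abs_mul, abs_mul, abs_mul, abs_mul, abs_of_nonneg (by positivity : 0 ≤ a ^ 2 / 2)]
          have : a ^ 2 / 2 * (|G| * |z ^ 2 - 1|) ≤ a ^ 2 / 2 * (|G| * (z ^ 2 + 1)) := by gcongr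
          linarith
      _ ≤ B * (a ^ 2 * (1 + |z|) ^ 2) + (B * (1 + |z|) ^ 2) * (a ^ 2 * (2 * (1 + |z|) ^ 2)) := by
          gcongr
      _ ≤ _ := by
          have : 0 ≤ B * a ^ 2 * (1 + |z|) ^ 2 := by positivity
          nlinarith [mul_le_mul_of_nonneg_left hu this]

theorem abs_le_growth (hf : IsTest k L f d) (hk : k ≤ 2) :
    ∃ A, 0 ≤ A ∧ ∀ x, |f x| ≤ A * (1 + |x|) ^ 2 := by
  have hL := hf.nonneg
  refine ⟨|f 0| + |d 0| + L, by positivity, fun x => ?_⟩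
  have h := hf.bound 0 x
  have hx := abs_nonneg x
  have e : f x = f 0 + d 0 * x + taylorRem f d 0 x := by simp [taylorRem]
  have h1 : L * |x| ^ k ≤ L * (1 + |x|) ^ 2 := by gcongr; exact pow_le_one_add_sq hk hx
  have h2 : |f x| ≤ |f 0| + |d 0| * |x| + |taylorRem f d 0 x| := by
    rw [← abs_mul]
    conv_lhs => rw [e]
    exact (abs_add_le _ _).trans (add_le_add_left (abs_add_le _ _) _)
  have h3 : |f 0| * 1 ≤ |f 0| * (1 + |x|) ^ 2 := by gcongr; nlinarith
  have h4 : |d 0| * |x| ≤ |d 0| * (1 + |x|) ^ 2 := by gcongr; nlinarith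
  linarith

/-- The bound is uniform in `t ≤ v` because the time is later a random variable. Negative `t` is
harmless since then `√t = 0`. -/
theorem heat_growth (hf : IsTest k L f d) (hk : k ≤ 2) (v : ℝ) :
    ∃ A, 0 ≤ A ∧ ∀ x t, t ≤ v → |heat f t x| ≤ A * (1 + |x|) ^ 2 := by
  obtain ⟨A, hA, h⟩ := hf.abs_le_growth hk
  have hL := hf.nonneg
  have hC := one_le_gaussConst
  refine ⟨A + gaussConst * (L * √v ^ k), by positivity, fun x t ht => ?_⟩
  have h1 := hf.abs_heat_sub_le hk t x
  have h2 : gaussConst * (L * √t ^ k) ≤ gaussConst * (L * √v ^ k) := by gcongr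
  have h3 : 1 ≤ (1 + |x|) ^ 2 := one_le_pow₀ (by linarith [abs_nonneg x])
  have h4 : |heat f t x| ≤ |f x| + |heat f t x - f x| := by
    simpa using abs_add_le (f x) (heat f t x - f x)
  have h5 : 0 ≤ gaussConst * (L * √v ^ k) := by positivity
  nlinarith [h x]

theorem integrable_comp_mul (hf : IsTest k L f d) (hk : k ≤ 2) (x r : ℝ) :
    Integrable (fun z => f (x + r * z)) γ₀ := by
  obtain ⟨A, hA, h⟩ := hf.abs_le_growth hk
  have := hf.measurable
  refine integrable_of_growth (A := A * (1 + |x| + |r|) ^ 2) (m := 2) (by fun_prop)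
    fun z => (h _).trans ?_
  rw [mul_assoc, ← mul_pow]
  gcongr
  have := abs_add_le x (r * z)
  rw [abs_mul] at this
  nlinarith [abs_nonneg x, abs_nonneg r, abs_nonneg z, mul_nonneg (abs_nonneg x) (abs_nonneg z)]

/-- The semigroup property: variances add under convolution of centred Gaussians. -/
theorem heat_add_time (hf : IsTest k L f d) (hk : k ≤ 2) {v τ : ℝ} (hv : 0 ≤ v) (hτ : 0 ≤ τ)
    (x : ℝ) : heat f (v + τ) x = ∫ z, heat f v (x + √τ * z) ∂γ₀ := by
  have hm := hf.measurable
  have key : ∀ t : ℝ, 0 ≤ t → gaussianReal 0 t.toNNReal = Measure.map (√t * ·) γ₀ := by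
    intro t ht
    rw [gaussianReal_map_const_mul]
    congr 1
    · simp
    · ext; simp [Real.sq_sqrt ht, ht]
  have e1 : heat f (v + τ) x = ∫ w, f (x + w) ∂gaussianReal 0 (v + τ).toNNReal := by
    rw [key _ (by positivity), integral_map (by fun_prop)
      (Measurable.aestronglyMeasurable (by fun_prop)), heat]
  have e2 : gaussianReal 0 (v + τ).toNNReal
      = gaussianReal 0 τ.toNNReal ∗ gaussianReal 0 v.toNNReal := by
    rw [gaussianReal_conv_gaussianReal, Real.toNNReal_add hv hτ, add_comm, add_zero]
  have hi : Integrable (fun w => f (x + w))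
      (gaussianReal 0 τ.toNNReal ∗ gaussianReal 0 v.toNNReal) := by
    rw [← e2, key _ (by positivity),
      integrable_map_measure (Measurable.aestronglyMeasurable (by fun_prop)) (by fun_prop)]
    exact hf.integrable_comp_mul hk x _
  have e3 : ∀ w, ∫ y, f (x + (w + y)) ∂gaussianReal 0 v.toNNReal = heat f v (x + w) := by
    intro w
    rw [key v hv, integral_map (by fun_prop) (Measurable.aestronglyMeasurable (by fun_prop)), heat]
    simp only [add_assoc]
  rw [e1, e2, integral_conv hi]
  simp only [e3]
  rw [key τ hτ, integral_map (by fun_prop)]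
  exact (hf.measurable_heat.comp (by fun_prop :
    Measurable fun w : ℝ => (v, x + w))).aestronglyMeasurable

/-- Adding the variance `τ` changes the smoothed function by about `τ / 2` times its second
derivative. -/
theorem abs_heat_time_taylor_le (hf : IsTest k L f d) (hk : k ≤ 2) {v τ : ℝ} (hv : 0 < v)
    (hτ : 0 ≤ τ) (x : ℝ) :
    |heat f (v + τ) x - heat f v x - τ / 2 * heatHess f d v x|
      ≤ gaussConst * (gaussConst * (L * √v ^ k * quadCubic (√τ / √v))) := by
  have hL := hf.nonneg
  have hC := one_le_gaussConst
  have hmh : Measurable fun z => heat f v (x + √τ * z) :=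
    hf.measurable_heat.comp (by fun_prop : Measurable fun z : ℝ => (v, x + √τ * z))
  have i0 : Integrable (fun z => heat f v (x + √τ * z)) γ₀ := by
    obtain ⟨A, hA, h⟩ := hf.heat_growth hk v
    refine integrable_of_growth (A := A * (1 + |x| + |√τ|) ^ 2) (m := 2) hmh
      fun z => (h _ v le_rfl).trans ?_
    rw [mul_assoc, ← mul_pow]
    gcongr
    have := abs_add_le x (√τ * z)
    rw [abs_mul] at this
    nlinarith [abs_nonneg x, abs_nonneg √τ, abs_nonneg z, mul_nonneg (abs_nonneg x) (abs_nonneg z)]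
  have e : heat f (v + τ) x - heat f v x - τ / 2 * heatHess f d v x
      = ∫ z, (heat f v (x + √τ * z) - heat f v x - √τ * heatGrad f d v x * z
        - τ / 2 * heatHess f d v x * z ^ 2) ∂γ₀ := by
    -- By the semigroup property, the change in time is the Gaussian average of the change in space
    -- by `√τ * z`. The spatial expansion is integrated term by term, with first moment `0` and
    -- second moment `1`.
    rw [integral_comb i0 (integrable_const _) integrable_id_gaussian integrable_sq_gaussian,
      integral_id_gaussian, integral_sq_gaussian, hf.heat_add_time hk hv.le hτ]
    simp
  rw [e]
  refine abs_integral_gaussian_le_of_growth (m := 3) (by norm_num) fun z => ?_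
  have h := hf.abs_heat_taylor_le hk hv x (√τ * z)
  rw [mul_pow, Real.sq_sqrt hτ, mul_div_right_comm √τ z] at h
  have h2 := quadCubic_mul_le (√τ / √v) z
  have h3 := quadCubic_nonneg (√τ / √v)
  calc _ = |heat f v (x + √τ * z) - heat f v x - √τ * z * heatGrad f d v x
        - τ * z ^ 2 / 2 * heatHess f d v x| := by congr 1; ring
    _ ≤ gaussConst * (L * √v ^ k * (quadCubic (√τ / √v) * (1 + |z|) ^ 3)) :=
        h.trans (by gcongr)
    _ ≤ gaussConst * (L * √v ^ k * (quadCubic (√τ / √v) * (4 * (1 + |z|) ^ 3))) := by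
        gcongr; linarith [show 0 ≤ (1 + |z|) ^ 3 by positivity]
    _ = _ := by ring

/-- The difference is the smoothing at variance `v` of `heat f τ - f`, and averaging does not
increase a uniform bound. -/
theorem abs_heat_smooth_le (hf : IsTest k L f d) (hk : k ≤ 2) {v τ : ℝ} (hv : 0 ≤ v)
    (hτ : 0 ≤ τ) (x : ℝ) :
    |heat f (v + τ) x - heat f v x| ≤ gaussConst * (L * √τ ^ k) := by
  have hL := hf.nonneg
  have hm : Measurable fun z => heat f τ (x + √v * z) :=
    hf.measurable_heat.comp (by fun_prop : Measurable fun z : ℝ => (τ, x + √v * z))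
  have hi := hf.integrable_comp_mul hk x √v
  have hb : ∀ z, |heat f τ (x + √v * z) - f (x + √v * z)| ≤ gaussConst * (L * √τ ^ k) :=
    fun z => hf.abs_heat_sub_le hk τ _
  have hi2 : Integrable (fun z => heat f τ (x + √v * z) - f (x + √v * z)) γ₀ := by
    have := hf.measurable
    exact Integrable.of_bound (Measurable.aestronglyMeasurable (by fun_prop)) _
      (Eventually.of_forall hb)
  have e : heat f (v + τ) x - heat f v x
      = ∫ z, (heat f τ (x + √v * z) - f (x + √v * z)) ∂γ₀ := by
    have := integral_add hi2 hi
    simp only [sub_add_cancel] at this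
    rw [add_comm v τ, hf.heat_add_time hk hτ hv, this, heat, add_sub_cancel_right]
  rw [e]
  simpa using norm_integral_le_of_norm_le_const (μ := γ₀)
    (f := fun z => heat f τ (x + √v * z) - f (x + √v * z)) (Eventually.of_forall hb)

end IsTest

/-! ### One step of the Lindeberg replacement -/

/-- A lower bound of `quadCubic` that is affine in `a ^ 2`, so that a conditional expectation can be
taken when `τ ^ 2` is the conditional mean of `a ^ 2`. It replaces Jensen's inequality. -/
theorem min_mul_le_quadCubic {τ : ℝ} (hτ : 0 ≤ τ) (a : ℝ) :
    min 1 (τ / 2) * (a ^ 2 - τ ^ 2 / 4) ≤ quadCubic a := by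
  have hm0 : 0 ≤ min 1 (τ / 2) := le_min zero_le_one (by linarith)
  rcases le_total (|a|) (τ / 2) with h | h
  · refine le_trans (mul_nonpos_of_nonneg_of_nonpos hm0 ?_) (quadCubic_nonneg a)
    rw [← sq_abs]; nlinarith [abs_nonneg a]
  · have h1 : min 1 (τ / 2) * (a ^ 2 - τ ^ 2 / 4) ≤ min 1 (τ / 2) * a ^ 2 := by
      gcongr; nlinarith [sq_nonneg τ]
    refine h1.trans (le_min ?_ ?_)
    · nlinarith [min_le_left 1 (τ / 2), sq_nonneg a]
    · have : min 1 (τ / 2) ≤ |a| := (min_le_right _ _).trans h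
      calc min 1 (τ / 2) * a ^ 2 ≤ |a| * a ^ 2 := by gcongr
        _ = |a| ^ 3 := by rw [← sq_abs a]; ring

theorem quadCubic_le_min_mul {τ : ℝ} (hτ : 0 ≤ τ) :
    quadCubic τ ≤ 2 * min 1 (τ / 2) * τ ^ 2 := by
  rw [quadCubic, abs_of_nonneg hτ]
  rcases le_total 1 (τ / 2) with h | h
  · rw [min_eq_left h]; exact (min_le_left _ _).trans (by nlinarith [sq_nonneg τ])
  · rw [min_eq_right h]; exact (min_le_right _ _).trans (by nlinarith [sq_nonneg τ])

section Step

variable {Ω : Type*} {m mΩ : MeasurableSpace Ω} {μ : Measure Ω}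

theorem integral_mul_condExp [IsFiniteMeasure μ] (hm : m ≤ mΩ) {X Z : Ω → ℝ}
    (hZ : StronglyMeasurable[m] Z)
    (hX : Integrable X μ) (hZX : Integrable (fun ω => Z ω * X ω) μ) :
    ∫ ω, Z ω * X ω ∂μ = ∫ ω, Z ω * (μ[X | m]) ω ∂μ := by
  rw [← integral_condExp hm (f := fun ω => Z ω * X ω)]
  exact integral_congr_ae (condExp_mul_of_stronglyMeasurable_left hZ hZX hX)

theorem integrable_bdd_mul' {X Z : Ω → ℝ} {K : ℝ} (hX : Integrable X μ)
    (hZ : AEStronglyMeasurable Z μ) (hK : ∀ᵐ ω ∂μ, |Z ω| ≤ K) :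
    Integrable (fun ω => Z ω * X ω) μ :=
  hX.bdd_mul hZ hK

theorem pow_div_le_of_mem {k : ℕ} {ε B v : ℝ} (hε : 0 < ε) (h1 : ε ^ 2 ≤ v) (h2 : v ≤ B) :
    √v ^ k / v ≤ √B ^ k / ε ^ 2 := by
  gcongr

theorem integrable_pow_mul_quadCubic {k : ℕ} {ε B : ℝ} (hε : 0 < ε) {v Y : Ω → ℝ}
    (hvm : Measurable v) (h1 : ∀ ω, ε ^ 2 ≤ v ω) (h2 : ∀ ω, v ω ≤ B) (hY : MemLp Y 2 μ) :
    Integrable (fun ω => √(v ω) ^ k * quadCubic (Y ω / √(v ω))) μ := by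
  have hYm := hY.aestronglyMeasurable.aemeasurable
  refine (hY.integrable_sq.const_mul (√B ^ k / ε ^ 2)).mono' ?_ (Eventually.of_forall fun ω => ?_)
  · have := measurable_quadCubic
    exact (AEMeasurable.mul (by fun_prop) (this.comp_aemeasurable (by fun_prop))).aestronglyMeasurable
  · have hv : 0 < v ω := lt_of_lt_of_le (by positivity) (h1 ω)
    have hq := quadCubic_nonneg (Y ω / √(v ω))
    rw [Real.norm_eq_abs, abs_of_nonneg (by positivity)]
    calc _ ≤ √(v ω) ^ k * (Y ω / √(v ω)) ^ 2 := by gcongr; exact quadCubic_le_sq _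
      _ = √(v ω) ^ k / v ω * Y ω ^ 2 := by
        rw [div_pow, Real.sq_sqrt hv.le]; ring
      _ ≤ _ := by gcongr; exacts [h2 ω, h1 ω]

variable [IsProbabilityMeasure μ]

/-- The conditional standard deviation does not exceed, on average, the increment. -/
theorem integral_quadCubic_condVariance_le (hm : m ≤ mΩ) {k : ℕ} {ε B : ℝ} (hε : 0 < ε)
    {v Y : Ω → ℝ}
    (hvm : Measurable[m] v) (h1 : ∀ ω, ε ^ 2 ≤ v ω) (h2 : ∀ ω, v ω ≤ B) (hY : MemLp Y 2 μ) :
    ∫ ω, √(v ω) ^ k * quadCubic (√((μ[fun ω => Y ω ^ 2 | m]) ω) / √(v ω)) ∂μ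
      ≤ 8 / 3 * ∫ ω, √(v ω) ^ k * quadCubic (Y ω / √(v ω)) ∂μ := by
  set V := μ[fun ω => Y ω ^ 2 | m] with hV
  have hVm : StronglyMeasurable[m] V := stronglyMeasurable_condExp
  have hV0 : 0 ≤ᵐ[μ] V := condExp_nonneg (Eventually.of_forall fun ω => sq_nonneg _)
  have hVi : Integrable V μ := integrable_condExp
  -- The weight is measurable with respect to `m`, so integrating it against `Y ^ 2` or against `V`
  -- gives the same result. With `τ = √V / √v`, the lower bound `min 1 (τ / 2) * (a ^ 2 - τ ^ 2 /
  -- 4)` averages to `3 / 4` of the `Z * V` integral, and `quadCubic τ` is at most twice the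
  -- corresponding integrand; hence `2 / (3 / 4) = 8 / 3`.
  set Z : Ω → ℝ := fun ω => √(v ω) ^ k * min 1 (√(V ω) / √(v ω) / 2) / v ω with hZ
  have hVm' := hVm.measurable
  have hZm : StronglyMeasurable[m] Z := (Measurable.stronglyMeasurable (by fun_prop))
  have hZ0 : ∀ ω, 0 ≤ Z ω := fun ω => by
    have hv : 0 < v ω := lt_of_lt_of_le (by positivity) (h1 ω)
    have : 0 ≤ min 1 (√(V ω) / √(v ω) / 2) := le_min zero_le_one (by positivity)
    positivity
  have hZb : ∀ ω, |Z ω| ≤ √B ^ k / ε ^ 2 := fun ω => by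
    have hv : 0 < v ω := lt_of_lt_of_le (by positivity) (h1 ω)
    rw [abs_of_nonneg (hZ0 ω)]
    refine le_trans ?_ (pow_div_le_of_mem (k := k) hε (h1 ω) (h2 ω))
    simp only [hZ]
    gcongr
    exact mul_le_of_le_one_right (by positivity) (min_le_left _ _)
  have hZae : AEStronglyMeasurable Z μ := (hZm.mono hm).aestronglyMeasurable
  have iY := integrable_bdd_mul' hY.integrable_sq hZae (Eventually.of_forall hZb)
  have iV := integrable_bdd_mul' hVi hZae (Eventually.of_forall hZb)
  have e1 := integral_mul_condExp hm hZm hY.integrable_sq iY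
  have hvm' : Measurable v := hvm.mono hm le_rfl
  have iR := integrable_pow_mul_quadCubic (k := k) hε hvm' h1 h2 hY
  have l1 : ∫ ω, (Z ω * Y ω ^ 2 - 1 / 4 * (Z ω * V ω)) ∂μ
      ≤ ∫ ω, √(v ω) ^ k * quadCubic (Y ω / √(v ω)) ∂μ := by
    refine integral_mono_ae (iY.sub (iV.const_mul _)) iR ?_
    filter_upwards [hV0] with ω hω
    have hv : 0 < v ω := lt_of_lt_of_le (by positivity) (h1 ω)
    have := min_mul_le_quadCubic (τ := √(V ω) / √(v ω)) (by positivity) (Y ω / √(v ω))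
    calc _ = √(v ω) ^ k * (min 1 (√(V ω) / √(v ω) / 2)
          * ((Y ω / √(v ω)) ^ 2 - (√(V ω) / √(v ω)) ^ 2 / 4)) := by
          simp only [hZ]
          rw [div_pow, div_pow, Real.sq_sqrt hv.le, Real.sq_sqrt hω]
          field_simp
      _ ≤ _ := by gcongr
  rw [integral_sub iY (iV.const_mul _), integral_const_mul, e1] at l1
  have l2 : ∫ ω, √(v ω) ^ k * quadCubic (√(V ω) / √(v ω)) ∂μ ≤ 2 * ∫ ω, Z ω * V ω ∂μ := by
    rw [← integral_const_mul]
    refine integral_mono_of_nonneg (Eventually.of_forall fun ω => ?_) (iV.const_mul _) ?_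
    · have := quadCubic_nonneg (√(V ω) / √(v ω))
      simp only [Pi.zero_apply]; positivity
    · filter_upwards [hV0] with ω hω
      have hv : 0 < v ω := lt_of_lt_of_le (by positivity) (h1 ω)
      have := quadCubic_le_min_mul (τ := √(V ω) / √(v ω)) (by positivity)
      calc _ ≤ √(v ω) ^ k * (2 * min 1 (√(V ω) / √(v ω) / 2) * (√(V ω) / √(v ω)) ^ 2) := by gcongr
        _ = _ := by
          simp only [hZ]
          rw [div_pow, Real.sq_sqrt hv.le, Real.sq_sqrt hω]
          field_simp
  linarith

theorem memLp_one_add_abs {X : Ω → ℝ} (hX : MemLp X 2 μ) :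
    MemLp (fun ω => 1 + |X ω|) 2 μ :=
  (memLp_const (1 : ℝ)).add hX.norm

theorem memLp_two_growth {X W : Ω → ℝ} {A : ℝ} (hX : MemLp X 2 μ)
    (hW : AEStronglyMeasurable W μ) (h : ∀ᵐ ω ∂μ, |W ω| ≤ A * (1 + |X ω|) ^ 2) :
    Integrable W μ := by
  have h1 := memLp_one_add_abs hX
  exact (h1.integrable_sq.const_mul A).mono' hW h

/-- Replacing an increment by a Gaussian one with the same conditional variance. -/
theorem lindeberg_step (hm : m ≤ mΩ) {k : ℕ} (hk : k ≤ 2) {L : ℝ} {f d : ℝ → ℝ}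
    (hf : IsTest k L f d) {ε B : ℝ} (hε : 0 < ε) {v S Y : Ω → ℝ}
    (hvm : Measurable[m] v) (h1 : ∀ ω, ε ^ 2 ≤ v ω) (h2 : ∀ ω, v ω ≤ B)
    (hSm : Measurable[m] S) (hS : MemLp S 2 μ) (hY : MemLp Y 2 μ) (hYm : Measurable Y)
    (hY0 : μ[Y | m] =ᵐ[μ] 0) (h3 : ∀ᵐ ω ∂μ, v ω + (μ[fun ω => Y ω ^ 2 | m]) ω ≤ B) :
    |∫ ω, heat f (v ω) (S ω + Y ω) ∂μ
        - ∫ ω, heat f (v ω + (μ[fun ω => Y ω ^ 2 | m]) ω) (S ω) ∂μ|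
      ≤ 4 * gaussConst ^ 2 * (L * ∫ ω, √(v ω) ^ k * quadCubic (Y ω / √(v ω)) ∂μ) := by
  set V := μ[fun ω => Y ω ^ 2 | m] with hV
  have hC := one_le_gaussConst
  have hL := hf.nonneg
  have hVm : StronglyMeasurable[m] V := stronglyMeasurable_condExp
  have hV0 : 0 ≤ᵐ[μ] V := condExp_nonneg (Eventually.of_forall fun ω => sq_nonneg _)
  have hVi : Integrable V μ := integrable_condExp
  have hvpos : ∀ ω, 0 < v ω := fun ω => lt_of_lt_of_le (by positivity) (h1 ω)
  have hVm1 := hVm.measurable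
  have hVm' : Measurable V := hVm1.mono hm le_rfl
  have hvm' : Measurable v := hvm.mono hm le_rfl
  have hSm' : Measurable S := hSm.mono hm le_rfl
  -- measurability and integrability of all the terms
  obtain ⟨A, hA, hgr⟩ := hf.heat_growth hk B
  have mG : Measurable[m] fun ω => heatGrad f d (v ω) (S ω) :=
    hf.measurable_heatGrad.comp (hvm.prodMk hSm)
  have mH : Measurable[m] fun ω => heatHess f d (v ω) (S ω) :=
    hf.measurable_heatHess.comp (hvm.prodMk hSm)
  have m1 : Measurable fun ω => heat f (v ω) (S ω + Y ω) :=
    hf.measurable_heat.comp (hvm'.prodMk (hSm'.add hYm))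
  have m2 : Measurable fun ω => heat f (v ω) (S ω) := hf.measurable_heat.comp (hvm'.prodMk hSm')
  have m3 : Measurable fun ω => heat f (v ω + V ω) (S ω) :=
    hf.measurable_heat.comp ((hvm'.add hVm').prodMk hSm')
  have i1 : Integrable (fun ω => heat f (v ω) (S ω + Y ω)) μ :=
    memLp_two_growth (hS.add hY) m1.aestronglyMeasurable
      (Eventually.of_forall fun ω => hgr _ _ (h2 ω))
  have i2 : Integrable (fun ω => heat f (v ω) (S ω)) μ :=
    memLp_two_growth hS m2.aestronglyMeasurable (Eventually.of_forall fun ω => hgr _ _ (h2 ω))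
  have i3 : Integrable (fun ω => heat f (v ω + V ω) (S ω)) μ :=
    memLp_two_growth hS m3.aestronglyMeasurable (h3.mono fun ω h => hgr _ _ h)
  have bH : ∀ ω, |heatHess f d (v ω) (S ω)| ≤ gaussConst * (L * (√B ^ k / ε ^ 2)) := fun ω => by
    refine (hf.abs_heatHess_le hk (hvpos ω) _).trans ?_
    rw [mul_div_assoc]
    gcongr
    exacts [h2 ω, h1 ω]
  have aH : AEStronglyMeasurable (fun ω => heatHess f d (v ω) (S ω)) μ :=
    (mH.mono hm le_rfl).aestronglyMeasurable
  have iHY := integrable_bdd_mul' hY.integrable_sq aH (Eventually.of_forall bH)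
  have iHV := integrable_bdd_mul' hVi aH (Eventually.of_forall bH)
  -- The second order coefficient is measurable with respect to `m`, so its product with `Y ^ 2`
  -- integrates like its product with `V`. These are the second order terms of the two expansions,
  -- and they cancel.
  have eH := integral_mul_condExp hm mH.stronglyMeasurable hY.integrable_sq iHY
  have lG : MemLp (fun ω => heatGrad f d (v ω) (S ω)) 2 μ := by
    obtain ⟨D, hD⟩ := hf.growth
    have hg : MemLp (fun ω => D * (1 + |S ω|) + gaussConst * (L * (√B ^ k / ε))) 2 μ :=
      ((memLp_one_add_abs hS).const_mul D).add (memLp_const _)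
    refine hg.mono' (mG.mono hm le_rfl).aestronglyMeasurable (Eventually.of_forall fun ω => ?_)
    have hb := hf.abs_heatGrad_sub_le hk (v ω) (S ω)
    have hε' : ε ≤ √(v ω) := Real.le_sqrt_of_sq_le (h1 ω)
    have hb' : gaussConst * (L * √(v ω) ^ k / √(v ω)) ≤ gaussConst * (L * (√B ^ k / ε)) := by
      rw [mul_div_assoc]
      gcongr
      exact h2 ω
    have := abs_add_le (d (S ω)) (heatGrad f d (v ω) (S ω) - d (S ω))
    rw [add_sub_cancel] at this
    rw [Real.norm_eq_abs]
    linarith [hD (S ω)]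
  have iGY : Integrable (fun ω => heatGrad f d (v ω) (S ω) * Y ω) μ := lG.integrable_mul hY
  have eG := integral_mul_condExp hm mG.stronglyMeasurable (hY.integrable (by norm_num)) iGY
  -- The first order term disappears by the martingale property; the Gaussian side has no such term.
  have eG0 : ∫ ω, heatGrad f d (v ω) (S ω) * Y ω ∂μ = 0 := by
    rw [eG]
    refine integral_eq_zero_of_ae ?_
    filter_upwards [hY0] with ω hω
    simp [hω]
  have iR := integrable_pow_mul_quadCubic (k := k) hε hvm' h1 h2 hY
  -- the two Taylor remainders
  have iD1 : Integrable (fun ω => heat f (v ω) (S ω + Y ω) - heat f (v ω) (S ω)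
      - heatGrad f d (v ω) (S ω) * Y ω - 1 / 2 * (heatHess f d (v ω) (S ω) * Y ω ^ 2)) μ :=
    ((i1.sub i2).sub iGY).sub (iHY.const_mul _)
  have iD2 : Integrable (fun ω => heat f (v ω + V ω) (S ω) - heat f (v ω) (S ω)
      - 1 / 2 * (heatHess f d (v ω) (S ω) * V ω)) μ := (i3.sub i2).sub (iHV.const_mul _)
  have e1 := integral_sub ((i1.sub i2).sub iGY) (iHY.const_mul (1 / 2))
  have e2 := integral_sub (i3.sub i2) (iHV.const_mul (1 / 2))
  rw [integral_sub' (i1.sub i2) iGY, integral_sub' i1 i2, integral_const_mul, eG0] at e1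
  rw [integral_sub' i3 i2, integral_const_mul] at e2
  simp only [Pi.sub_apply] at e1 e2
  have b1 : |∫ ω, (heat f (v ω) (S ω + Y ω) - heat f (v ω) (S ω)
      - heatGrad f d (v ω) (S ω) * Y ω - 1 / 2 * (heatHess f d (v ω) (S ω) * Y ω ^ 2)) ∂μ|
      ≤ gaussConst * (L * ∫ ω, √(v ω) ^ k * quadCubic (Y ω / √(v ω)) ∂μ) := by
    rw [← integral_const_mul, ← integral_const_mul, ← Real.norm_eq_abs]
    refine norm_integral_le_of_norm_le ((iR.const_mul _).const_mul _)
      (Eventually.of_forall fun ω => ?_)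
    have := hf.abs_heat_taylor_le hk (hvpos ω) (S ω) (Y ω)
    rw [Real.norm_eq_abs]
    convert this using 2 <;> ring
  have b2 : |∫ ω, (heat f (v ω + V ω) (S ω) - heat f (v ω) (S ω)
      - 1 / 2 * (heatHess f d (v ω) (S ω) * V ω)) ∂μ|
      ≤ gaussConst * (gaussConst * (L * (8 / 3 * ∫ ω, √(v ω) ^ k * quadCubic (Y ω / √(v ω)) ∂μ))) := by
    have iR2 : Integrable (fun ω => √(v ω) ^ k * quadCubic (√(V ω) / √(v ω))) μ := by
      have hV2 : MemLp (fun ω => √(V ω)) 2 μ := by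
        rw [memLp_two_iff_integrable_sq (by fun_prop)]
        refine hVi.congr ?_
        filter_upwards [hV0] with ω hω
        exact (Real.sq_sqrt hω).symm
      exact integrable_pow_mul_quadCubic (k := k) hε hvm' h1 h2 hV2
    have b3 : |∫ ω, (heat f (v ω + V ω) (S ω) - heat f (v ω) (S ω)
      - 1 / 2 * (heatHess f d (v ω) (S ω) * V ω)) ∂μ|
      ≤ gaussConst * (gaussConst * (L * ∫ ω, √(v ω) ^ k * quadCubic (√(V ω) / √(v ω)) ∂μ)) := by
      rw [← integral_const_mul, ← integral_const_mul, ← integral_const_mul, ← Real.norm_eq_abs]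
      refine norm_integral_le_of_norm_le (((iR2.const_mul _).const_mul _).const_mul _) ?_
      filter_upwards [hV0] with ω hω
      have := hf.abs_heat_time_taylor_le hk (hvpos ω) hω (S ω)
      rw [Real.norm_eq_abs]
      convert this using 2 <;> ring
    refine b3.trans ?_
    gcongr
    exact integral_quadCubic_condVariance_le hm hε hvm h1 h2 hY
  have hR0 : 0 ≤ ∫ ω, √(v ω) ^ k * quadCubic (Y ω / √(v ω)) ∂μ :=
    integral_nonneg fun ω => mul_nonneg (by positivity) (quadCubic_nonneg _)
  rw [e1] at b1
  rw [e2] at b2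
  rw [eH] at b1
  generalize (∫ ω, √(v ω) ^ k * quadCubic (Y ω / √(v ω)) ∂μ) = R at *
  have hLR : 0 ≤ L * R := mul_nonneg hL hR0
  have h5 : gaussConst * (L * R) ≤ gaussConst ^ 2 * (L * R) := by gcongr; nlinarith
  have h6 := abs_le.1 b1
  have h7 := abs_le.1 b2
  rw [← hV] at h6
  rw [abs_le]
  -- The two remainders contribute `1` and `8 / 3`, and `1 + 8 / 3 ≤ 4`.
  constructor <;> nlinarith [mul_nonneg (sq_nonneg gaussConst) hLR]

end Step

/-! ### The Lindeberg telescoping sum -/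

theorem sum_Icc_one {M : Type*} [AddCommMonoid M] (f : ℕ → M) (n : ℕ) :
    ∑ i ∈ Finset.Icc 1 n, f i = ∑ i ∈ Finset.range n, f (i + 1) := by
  induction n with
  | zero => simp
  | succ n ih => rw [Finset.sum_Icc_succ_top (by omega), ih, Finset.sum_range_succ]

section Martingale

variable {Ω : Type*} [mΩ : MeasurableSpace Ω]

/-- The partial sums of the increments. -/
def partialSum (Y : ℕ → Ω → ℝ) (i : ℕ) (ω : Ω) : ℝ := ∑ j ∈ Finset.range i, Y (j + 1) ω

/-- The variance that remains after `i` steps, increased by `ε ^ 2`. -/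
noncomputable def remVar (μ : Measure Ω) (ℱ : Filtration ℕ mΩ) (Y : ℕ → Ω → ℝ) (n : ℕ) (ε : ℝ)
    (i : ℕ) (ω : Ω) : ℝ :=
  ε ^ 2 + max (stdDev μ Y n ^ 2 - ∑ j ∈ Finset.range i, condVariance μ ℱ Y (j + 1) ω) 0

/-- The error of the Lindeberg replacement at scale `ε`. -/
noncomputable def lindebergSum (μ : Measure Ω) (ℱ : Filtration ℕ mΩ) (Y : ℕ → Ω → ℝ) (n k : ℕ)
    (ε : ℝ) : ℝ :=
  ∑ i ∈ Finset.range n, ∫ ω, √(remVar μ ℱ Y n ε (i + 1) ω) ^ k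
    * quadCubic (Y (i + 1) ω / √(remVar μ ℱ Y n ε (i + 1) ω)) ∂μ

variable {μ : Measure Ω} {ℱ : Filtration ℕ mΩ} {Y : ℕ → Ω → ℝ} {n : ℕ}

theorem condVariance_nonneg (i : ℕ) : ∀ᵐ ω ∂μ, 0 ≤ condVariance μ ℱ Y i ω :=
  condExp_nonneg (Eventually.of_forall fun _ => sq_nonneg _)

theorem remVar_zero (ε : ℝ) (ω : Ω) : remVar μ ℱ Y n ε 0 ω = ε ^ 2 + stdDev μ Y n ^ 2 := by
  simp [remVar, sq_nonneg]

/-- The `max` in `remVar` makes this hold at every `ω`. Almost surely it has no effect for `i ≤ n`,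
since the partial sums of the conditional variances then do not exceed `s_n²`. -/
theorem sq_le_remVar (ε : ℝ) (i : ℕ) (ω : Ω) : ε ^ 2 ≤ remVar μ ℱ Y n ε i ω :=
  le_add_of_nonneg_right (le_max_right _ _)

theorem measurable_condVariance (i : ℕ) : Measurable[ℱ (i - 1)] (condVariance μ ℱ Y i) :=
  stronglyMeasurable_condExp.measurable

/-- Predictability: the variance left after step `i + 1` involves conditional variances up to index
`i + 1` only, and these are known at time `i`. That the total is deterministic is essential here. -/
theorem measurable_remVar (ε : ℝ) (i : ℕ) : Measurable[ℱ i] (remVar μ ℱ Y n ε (i + 1)) := by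
  have h : Measurable[ℱ i] fun ω =>
      ∑ j ∈ Finset.range (i + 1), condVariance μ ℱ Y (j + 1) ω := by
    refine Finset.measurable_fun_sum _ fun j hj => ?_
    have := measurable_condVariance (μ := μ) (ℱ := ℱ) (Y := Y) (j + 1)
    exact this.mono (ℱ.mono (by have := Finset.mem_range.1 hj; omega)) le_rfl
  unfold remVar
  fun_prop

theorem IsMDS.measurable_partialSum (h : IsMDS μ ℱ Y n) {i : ℕ} (hi : i ≤ n) :
    Measurable[ℱ i] (partialSum Y i) := by
  refine Finset.measurable_fun_sum _ fun j hj => ?_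
  have hj' := Finset.mem_range.1 hj
  exact (h.measurable (j + 1) (Finset.mem_Icc.2 ⟨by omega, by omega⟩)).mono
    (ℱ.mono (by omega)) le_rfl

theorem IsMDS.memLp_partialSum (h : IsMDS μ ℱ Y n) {i : ℕ} (hi : i ≤ n) :
    MemLp (partialSum Y i) 2 μ := by
  refine memLp_finsetSum _ fun j hj => ?_
  have hj' := Finset.mem_range.1 hj
  exact h.memLp (j + 1) (Finset.mem_Icc.2 ⟨by omega, by omega⟩)

variable [IsProbabilityMeasure μ]

theorem stdDev_pos (hV : ∀ᵐ ω ∂μ, normalizedVariance μ ℱ Y n ω = 1) : 0 < stdDev μ Y n := by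
  obtain ⟨ω, hω⟩ := hV.exists
  refine lt_of_le_of_ne (Real.sqrt_nonneg _) fun h => ?_
  rw [normalizedVariance, ← h] at hω
  norm_num at hω

theorem sum_condVariance (hV : ∀ᵐ ω ∂μ, normalizedVariance μ ℱ Y n ω = 1) :
    ∀ᵐ ω ∂μ, ∑ i ∈ Finset.range n, condVariance μ ℱ Y (i + 1) ω = stdDev μ Y n ^ 2 := by
  have hs := stdDev_pos hV
  filter_upwards [hV] with ω hω
  rw [normalizedVariance, div_eq_one_iff_eq (by positivity), sum_Icc_one] at hω
  exact hω

/-- For almost all `ω`, the conditional variances are nonnegative and sum up to `s_n²`. -/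
theorem ae_remVar (hV : ∀ᵐ ω ∂μ, normalizedVariance μ ℱ Y n ω = 1) (ε : ℝ) :
    ∀ᵐ ω ∂μ, (∀ i, 0 ≤ condVariance μ ℱ Y i ω) ∧
      (∀ i < n, remVar μ ℱ Y n ε i ω
        = remVar μ ℱ Y n ε (i + 1) ω + condVariance μ ℱ Y (i + 1) ω) ∧
      remVar μ ℱ Y n ε n ω = ε ^ 2 := by
  filter_upwards [ae_all_iff.2 (condVariance_nonneg (μ := μ) (ℱ := ℱ) (Y := Y)),
    sum_condVariance hV] with ω h0 h1
  have hle : ∀ i ≤ n, ∑ j ∈ Finset.range i, condVariance μ ℱ Y (j + 1) ω ≤ stdDev μ Y n ^ 2 := by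
    intro i hi
    rw [← h1]
    exact Finset.sum_le_sum_of_subset_of_nonneg (Finset.range_subset_range.2 hi)
      fun j _ _ => h0 _
  refine ⟨h0, fun i hi => ?_, ?_⟩
  · rw [remVar, remVar, max_eq_left (sub_nonneg.2 (hle i hi.le)),
      max_eq_left (sub_nonneg.2 (hle (i + 1) hi)), Finset.sum_range_succ]
    ring
  · rw [remVar, h1]; simp

/-- A bound of the remaining variance that holds everywhere is obtained by truncation. -/
theorem ae_remVar_le (hV : ∀ᵐ ω ∂μ, normalizedVariance μ ℱ Y n ω = 1) (ε : ℝ) :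
    ∀ᵐ ω ∂μ, ∀ i, remVar μ ℱ Y n ε i ω ≤ ε ^ 2 + stdDev μ Y n ^ 2 := by
  filter_upwards [ae_remVar hV ε] with ω ⟨h0, _⟩ i
  have : 0 ≤ ∑ j ∈ Finset.range i, condVariance μ ℱ Y (j + 1) ω :=
    Finset.sum_nonneg fun j _ => h0 _
  rw [remVar]
  gcongr
  exact max_le (by linarith) (sq_nonneg _)

/-- The difference between a martingale and a Gaussian variable, seen by a test function. -/
theorem IsMDS.abs_integral_sub_le (h : IsMDS μ ℱ Y n)
    (hV : ∀ᵐ ω ∂μ, normalizedVariance μ ℱ Y n ω = 1) {k : ℕ} (hk : k ≤ 2) {L : ℝ} {f d : ℝ → ℝ}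
    (hf : IsTest k L f d) {ε : ℝ} (hε : 0 < ε) :
    |∫ ω, f (partialSum Y n ω) ∂μ - ∫ z, f (stdDev μ Y n * z) ∂γ₀|
      ≤ 4 * gaussConst ^ 2 * (L * (ε ^ k + lindebergSum μ ℱ Y n k ε)) := by
  have hC := one_le_gaussConst
  have hL := hf.nonneg
  have hs := stdDev_pos hV
  set s := stdDev μ Y n with hs'
  set B := ε ^ 2 + s ^ 2 with hB
  -- The interpolation: `i` increments of the martingale are in place and the remaining variance is
  -- Gaussian.
  set a : ℕ → ℝ := fun i => ∫ ω, heat f (remVar μ ℱ Y n ε i ω) (partialSum Y i ω) ∂μ with ha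
  have step : ∀ i ∈ Finset.range n, |a (i + 1) - a i| ≤ 4 * gaussConst ^ 2 * (L *
      ∫ ω, √(remVar μ ℱ Y n ε (i + 1) ω) ^ k
        * quadCubic (Y (i + 1) ω / √(remVar μ ℱ Y n ε (i + 1) ω)) ∂μ) := by
    intro i hi
    have hi' := Finset.mem_range.1 hi
    have hmem : i + 1 ∈ Finset.Icc 1 n := Finset.mem_Icc.2 ⟨by omega, by omega⟩
    -- The one-step lemma asks for an upper bound at every `ω`; the truncation changes `remVar` on a
    -- null set only and preserves measurability.
    set v : Ω → ℝ := fun ω => min (remVar μ ℱ Y n ε (i + 1) ω) B with hv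
    have hv1 : ∀ ω, ε ^ 2 ≤ v ω := fun ω =>
      le_min (sq_le_remVar _ _ _) (by rw [hB]; nlinarith [sq_nonneg s])
    have hvae : ∀ᵐ ω ∂μ, v ω = remVar μ ℱ Y n ε (i + 1) ω := by
      filter_upwards [ae_remVar_le hV ε] with ω hω
      exact min_eq_left (hω _)
    have hvm : Measurable[ℱ i] v := (measurable_remVar ε i).min measurable_const
    have hstep : ∀ᵐ ω ∂μ, remVar μ ℱ Y n ε i ω
        = v ω + (μ[fun ω => Y (i + 1) ω ^ 2 | ℱ i]) ω := by
      filter_upwards [ae_remVar hV ε, hvae] with ω hω hω2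
      rw [hω2, hω.2.1 i hi']; rfl
    have := lindeberg_step (ℱ.le i) hk hf hε hvm hv1 (fun ω => min_le_right _ _)
      (h.measurable_partialSum hi'.le) (h.memLp_partialSum hi'.le) (h.memLp _ hmem)
      ((h.measurable _ hmem).mono (ℱ.le _) le_rfl) (h.condExp_eq_zero _ hmem)
      (by
        filter_upwards [hstep, ae_remVar_le hV ε] with ω h1 h2
        rw [← h1]; exact h2 i)
    have e1 : a (i + 1) = ∫ ω, heat f (v ω) (partialSum Y i ω + Y (i + 1) ω) ∂μ := by
      refine integral_congr_ae ?_
      filter_upwards [hvae] with ω hω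
      rw [hω, partialSum, partialSum, Finset.sum_range_succ]
    have e2 : a i = ∫ ω, heat f (v ω + (μ[fun ω => Y (i + 1) ω ^ 2 | ℱ i]) ω)
        (partialSum Y i ω) ∂μ := by
      refine integral_congr_ae ?_
      filter_upwards [hstep] with ω hω
      rw [hω]
    rw [e1, e2]
    refine this.trans_eq ?_
    congr 2
    refine integral_congr_ae ?_
    filter_upwards [hvae] with ω hω
    rw [hω]
  have tele : |a n - a 0| ≤ 4 * gaussConst ^ 2 * (L * lindebergSum μ ℱ Y n k ε) := by
    rw [← Finset.sum_range_sub, lindebergSum, Finset.mul_sum, Finset.mul_sum]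
    exact (Finset.abs_sum_le_sum_abs _ _).trans (Finset.sum_le_sum step)
  have ea0 : a 0 = heat f (s ^ 2 + ε ^ 2) 0 := by
    simp only [ha, remVar_zero, partialSum, Finset.range_zero, Finset.sum_empty, integral_const]
    simp [hs', add_comm]
  have ean : a n = ∫ ω, heat f (ε ^ 2) (partialSum Y n ω) ∂μ := by
    refine integral_congr_ae ?_
    filter_upwards [ae_remVar hV ε] with ω hω
    rw [hω.2.2]
  have hSm := (h.measurable_partialSum le_rfl).mono (ℱ.le _) le_rfl
  have hS := h.memLp_partialSum le_rfl
  have hfm := hf.measurable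
  have h1 : |a n - ∫ ω, f (partialSum Y n ω) ∂μ| ≤ gaussConst * (L * ε ^ k) := by
    obtain ⟨A, hA, hgr⟩ := hf.heat_growth hk (ε ^ 2)
    obtain ⟨A', hA', hgr'⟩ := hf.abs_le_growth hk
    have i1 : Integrable (fun ω => heat f (ε ^ 2) (partialSum Y n ω)) μ :=
      memLp_two_growth hS (hf.measurable_heat.comp
        (measurable_const.prodMk hSm)).aestronglyMeasurable
        (Eventually.of_forall fun ω => hgr _ _ le_rfl)
    have i2 : Integrable (fun ω => f (partialSum Y n ω)) μ :=
      memLp_two_growth hS (hfm.comp hSm).aestronglyMeasurable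
        (Eventually.of_forall fun ω => hgr' _)
    rw [ean, ← integral_sub i1 i2]
    have hb : ∀ ω, ‖heat f (ε ^ 2) (partialSum Y n ω) - f (partialSum Y n ω)‖
        ≤ gaussConst * (L * ε ^ k) := fun ω => by
      have := hf.abs_heat_sub_le hk (ε ^ 2) (partialSum Y n ω)
      rwa [Real.sqrt_sq hε.le] at this
    simpa using norm_integral_le_of_norm_le_const (μ := μ) (Eventually.of_forall hb)
  have h2 : |a 0 - ∫ z, f (s * z) ∂γ₀| ≤ gaussConst * (L * ε ^ k) := by
    have := hf.abs_heat_smooth_le hk (sq_nonneg s) (sq_nonneg ε) 0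
    rw [Real.sqrt_sq hε.le, ← ea0] at this
    simpa [heat, Real.sqrt_sq hs.le] using this
  have h3 : gaussConst * (L * ε ^ k) ≤ gaussConst ^ 2 * (L * ε ^ k) := by
    gcongr; nlinarith
  have h4 : 0 ≤ gaussConst ^ 2 * (L * ε ^ k) := by positivity
  have := abs_le.1 h1; have := abs_le.1 h2; have := abs_le.1 tele
  rw [abs_le]
  constructor <;> linarith

end Martingale

/-! ### The monotone coupling -/

/-- The quantile function of a measure on `ℝ`. -/
noncomputable def quantile (μ : Measure ℝ) (t : ℝ) : ℝ := sInf {x | t ≤ cdf μ x}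

section Quantile

variable {μ : Measure ℝ}

theorem quantile_set_nonempty {t : ℝ} (ht : t < 1) : {x | t ≤ cdf μ x}.Nonempty := by
  obtain ⟨x, hx⟩ := ((tendsto_cdf_atTop μ).eventually (lt_mem_nhds ht)).exists
  exact ⟨x, hx.le⟩

theorem quantile_set_bddBelow {t : ℝ} (ht : 0 < t) : BddBelow {x | t ≤ cdf μ x} := by
  obtain ⟨x, hx⟩ := ((tendsto_cdf_atBot μ).eventually (gt_mem_nhds ht)).exists
  refine ⟨x, fun y hy => ?_⟩
  by_contra! hlt
  exact absurd (hy.trans (monotone_cdf μ hlt.le)) (not_le.2 hx)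

/-- The Galois connection between quantile and distribution function. The infimum is attained
because the distribution function is right-continuous. -/
theorem quantile_le_iff {t : ℝ} (ht : t ∈ Ioo (0 : ℝ) 1) (x : ℝ) :
    quantile μ t ≤ x ↔ t ≤ cdf μ x := by
  refine ⟨fun h => ?_, fun h => csInf_le (quantile_set_bddBelow ht.1) h⟩
  have hgt : ∀ y > x, t ≤ cdf μ y := fun y hy => by
    obtain ⟨z, hz, hzy⟩ := exists_lt_of_csInf_lt (quantile_set_nonempty ht.2) (h.trans_lt hy)
    exact le_trans hz (monotone_cdf μ hzy.le)
  have hc : Tendsto (cdf μ) (𝓝[>] x) (𝓝 (cdf μ x)) :=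
    ((cdf μ).right_continuous x).mono_left (nhdsWithin_mono _ Ioi_subset_Ici_self)
  exact ge_of_tendsto hc (eventually_nhdsWithin_of_forall hgt)

theorem monotoneOn_quantile : MonotoneOn (quantile μ) (Ioo 0 1) := by
  intro a ha b hb hab
  rw [quantile_le_iff ha]
  exact hab.trans ((quantile_le_iff hb _).1 le_rfl)

theorem aemeasurable_quantile : AEMeasurable (quantile μ) (volume.restrict (Ioo 0 1)) :=
  aemeasurable_restrict_of_monotoneOn measurableSet_Ioo monotoneOn_quantile

instance : IsProbabilityMeasure (volume.restrict (Ioo (0 : ℝ) 1)) := ⟨by simp⟩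

theorem map_quantile [IsProbabilityMeasure μ] :
    (volume.restrict (Ioo 0 1)).map (quantile μ) = μ := by
  have : IsProbabilityMeasure ((volume.restrict (Ioo 0 1)).map (quantile μ)) :=
    Measure.isProbabilityMeasure_map aemeasurable_quantile
  refine Measure.ext_of_Iic _ _ fun x => ?_
  rw [Measure.map_apply_of_aemeasurable aemeasurable_quantile measurableSet_Iic,
    ← ofReal_cdf, Measure.restrict_apply₀' measurableSet_Ioo.nullMeasurableSet]
  have e : quantile μ ⁻¹' Iic x ∩ Ioo 0 1 = Iic (cdf μ x) ∩ Ioo 0 1 := by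
    ext t
    simp only [mem_inter_iff, mem_preimage, mem_Iic, and_congr_left_iff]
    exact fun ht => quantile_le_iff ht x
  rw [e]
  have h0 := cdf_nonneg μ x
  have h1 := cdf_le_one μ x
  apply le_antisymm
  · refine (measure_mono (t := Ioc 0 (cdf μ x)) fun t ht => ⟨ht.2.1, ht.1⟩).trans ?_
    simp
  · refine le_trans ?_ (measure_mono (s := Ioo 0 (cdf μ x))
      fun t ht => ⟨ht.2.le, ht.1, ht.2.trans_le h1⟩)
    simp

end Quantile

/-! ### Potentials of monotone sets -/

theorem primitive_bound {d : ℝ → ℝ} (hd : ∀ a b, IntervalIntegrable d volume a b) {x y c B : ℝ}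
    (hB : ∀ z ∈ uIoc x (x + y), |d z - c| ≤ B) :
    |(∫ z in (0 : ℝ)..(x + y), d z) - (∫ z in (0 : ℝ)..x, d z) - c * y| ≤ B * |y| := by
  have h1 := intervalIntegral.integral_interval_sub_left (hd 0 (x + y)) (hd 0 x)
  have h2 : ∫ z in x..(x + y), (d z - c) = (∫ z in x..(x + y), d z) - c * y := by
    rw [intervalIntegral.integral_sub (hd _ _) intervalIntegrable_const]
    simp [mul_comm]
  rw [h1, ← h2]
  have := intervalIntegral.norm_integral_le_of_norm_le_const (f := fun z => d z - c) hB
  simpa using this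

/-- A test function of order one that turns the transport along a monotone set into its cost. -/
theorem exists_potential_one {ι : Type*} {T : Set ι} {p q : ι → ℝ}
    (hpq : ∀ s ∈ T, ∀ t ∈ T, (p s ≤ p t ∧ q s ≤ q t) ∨ (p t ≤ p s ∧ q t ≤ q s)) :
    ∃ f d : ℝ → ℝ, IsTest 1 1 f d ∧ ∀ t ∈ T, |p t - q t| ≤ 2 * (f (p t) - f (q t)) := by
  -- The potential has slope `1` where mass is transported to the left, from `p t` to a smaller `q
  -- t`, and slope `-1` elsewhere.
  set U : Set ℝ := ⋃ t ∈ T, Ioo (q t) (p t) with hU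
  have hUo : IsOpen U := isOpen_biUnion fun t _ => isOpen_Ioo
  set e : ℝ → ℝ := U.indicator 1 + Uᶜ.indicator (-1) with he
  have he1 : ∀ z ∈ U, e z = 1 := fun z hz => by simp [he, hz]
  have he2 : ∀ z ∉ U, e z = -1 := fun z hz => by simp [he, hz]
  have hem : Measurable e := (measurable_one.indicator hUo.measurableSet).add
    ((measurable_const (a := (-1 : ℝ))).indicator hUo.measurableSet.compl)
  have heb : ∀ z, |e z| ≤ 1 := fun z => by
    by_cases hz : z ∈ U
    · simp [he1 z hz]
    · simp [he2 z hz]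
  have hei : ∀ a b, IntervalIntegrable e volume a b := fun a b =>
    (intervalIntegrable_const (c := (1 : ℝ))).mono_fun' hem.aestronglyMeasurable
      (Eventually.of_forall heb)
  have hcont : Continuous fun x => ∫ z in (0 : ℝ)..x, e z :=
    intervalIntegral.continuous_primitive hei 0
  refine ⟨fun x => ∫ z in (0 : ℝ)..x, e z, 0, ⟨hcont.measurable, measurable_zero, fun x y => ?_,
    0, by simp⟩, fun t ht => ?_⟩
  · have := primitive_bound hei (x := x) (y := y) (c := 0) (B := 1) fun z _ => by simpa using heb z
    simpa [taylorRem] using this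
  · have h1 := intervalIntegral.integral_interval_sub_left (hei 0 (p t)) (hei 0 (q t))
    simp only [h1]
    rcases le_total (q t) (p t) with hle | hle
    · have h2 : ∫ z in (q t)..(p t), e z = ∫ z in (q t)..(p t), (1 : ℝ) := by
        rw [intervalIntegral.integral_of_le hle, intervalIntegral.integral_of_le hle,
          integral_Ioc_eq_integral_Ioo, integral_Ioc_eq_integral_Ioo]
        exact setIntegral_congr_fun measurableSet_Ioo fun z hz => he1 z (mem_biUnion ht hz)
      rw [h2, abs_of_nonneg (by linarith)]; simp; linarith
    · have h2 : ∫ z in (p t)..(q t), e z = ∫ z in (p t)..(q t), (-1 : ℝ) := by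
        rw [intervalIntegral.integral_of_le hle, intervalIntegral.integral_of_le hle,
          integral_Ioc_eq_integral_Ioo, integral_Ioc_eq_integral_Ioo]
        -- A point covered by transport in both directions would lie in `(q s, p s)` and in `(p t, q
        -- t)`, which contradicts the monotone order of the two pairs.
        refine setIntegral_congr_fun measurableSet_Ioo fun z hz => he2 z fun hzU => ?_
        obtain ⟨s, hs, hzs⟩ := mem_iUnion₂.1 hzU
        rcases hpq s hs t ht with h | h <;> linarith [hz.1, hz.2, hzs.1, hzs.2]
      rw [intervalIntegral.integral_symm, h2, abs_of_nonpos (by linarith)]; simp; linarith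

/-- A test function of order two that turns the transport along a monotone set into its quadratic
cost. -/
theorem exists_potential_two {ι : Type*} {T : Set ι} {p q : ι → ℝ}
    (hpq : ∀ s ∈ T, ∀ t ∈ T, (p s ≤ p t ∧ q s ≤ q t) ∨ (p t ≤ p s ∧ q t ≤ q s)) :
    ∃ f d : ℝ → ℝ, IsTest 2 2 f d ∧ ∀ t ∈ T, |p t - q t| ^ 2 ≤ 2 * (f (p t) - f (q t)) := by
  -- Along a monotone set the two coordinates change in the same direction, so the change of their
  -- difference is at most the absolute change of their sum. Thus the displacement is a 2-Lipschitz
  -- function of the midpoint. It is extended to the whole line and integrated.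
  have key : ∀ s ∈ T, ∀ t ∈ T,
      |(p s - q s) - (p t - q t)| ≤ 2 * |(p s + q s) / 2 - (p t + q t) / 2| := by
    intro s hs t ht
    rcases hpq s hs t ht with h | h
    · rw [abs_of_nonpos (a := (p s + q s) / 2 - (p t + q t) / 2) (by linarith), abs_le]
      constructor <;> linarith
    · rw [abs_of_nonneg (a := (p s + q s) / 2 - (p t + q t) / 2) (by linarith), abs_le]
      constructor <;> linarith
  have hex : ∃ d0 : ℝ → ℝ, ∀ t ∈ T, d0 ((p t + q t) / 2) = p t - q t := by
    classical
    refine ⟨fun m => if h : ∃ t ∈ T, (p t + q t) / 2 = m then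
      p h.choose - q h.choose else 0, fun t ht => ?_⟩
    have h : ∃ s ∈ T, (p s + q s) / 2 = (p t + q t) / 2 := ⟨t, ht, rfl⟩
    simp only [dif_pos h]
    have := key _ h.choose_spec.1 t ht
    rw [h.choose_spec.2, sub_self, abs_zero, mul_zero] at this
    linarith [abs_nonpos_iff.1 this]
  obtain ⟨d0, hd0⟩ := hex
  have hlip : LipschitzOnWith 2 d0 ((fun t => (p t + q t) / 2) '' T) := by
    refine LipschitzOnWith.of_dist_le_mul ?_
    rintro _ ⟨s, hs, rfl⟩ _ ⟨t, ht, rfl⟩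
    simp only [hd0 s hs, hd0 t ht, Real.dist_eq]
    exact key s hs t ht
  obtain ⟨d, hd, hdeq⟩ := hlip.extend_real
  have hdt : ∀ t ∈ T, d ((p t + q t) / 2) = p t - q t := fun t ht => by
    rw [← hdeq (mem_image_of_mem _ ht), hd0 t ht]
  have hdl : ∀ x y, |d x - d y| ≤ 2 * |x - y| := fun x y => by
    simpa [Real.dist_eq] using hd.dist_le_mul x y
  have hdi : ∀ a b, IntervalIntegrable d volume a b := fun a b => hd.continuous.intervalIntegrable a b
  have hcont : Continuous fun x => ∫ z in (0 : ℝ)..x, d z :=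
    intervalIntegral.continuous_primitive hdi 0
  have hz : ∀ x y z : ℝ, z ∈ uIoc x (x + y) → |z - x| ≤ |y| := by
    intro x y z hz
    have := abs_sub_left_of_mem_uIcc (uIoc_subset_uIcc hz)
    simpa using this
  refine ⟨fun x => ∫ z in (0 : ℝ)..x, d z, d, ⟨hcont.measurable, hd.continuous.measurable,
    fun x y => ?_, |d 0| + 2, fun x => ?_⟩, fun t ht => ?_⟩
  · have := primitive_bound hdi (x := x) (y := y) (c := d x) (B := 2 * |y|) fun z h => by
      have := hdl z x; have := hz x y z h; linarith
    rw [taylorRem, sq, ← mul_assoc]; exact this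
  · have := hdl x 0
    have h2 := abs_add_le (d 0) (d x - d 0)
    rw [add_sub_cancel] at h2
    rw [sub_zero] at this
    nlinarith [abs_nonneg (d 0), abs_nonneg x, mul_nonneg (abs_nonneg (d 0)) (abs_nonneg x)]
  · have h1 := intervalIntegral.integral_interval_sub_left (hdi 0 (p t)) (hdi 0 (q t))
    set m := (p t + q t) / 2 with hm
    set ℓ := p t - q t with hℓ
    have hdm : d m = ℓ := hdt t ht
    simp only [h1]
    -- Integrated over the interval between `q t` and `p t`, which is centred at `m`, the deviation
    -- of `d` from `ℓ` costs at most `2 * (ℓ / 2) ^ 2 = ℓ ^ 2 / 2` out of `ℓ ^ 2`. Half of the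
    -- quadratic cost is left.
    have hlow : ∀ z, d z - ℓ ≤ 2 * |z - m| ∧ -(2 * |z - m|) ≤ d z - ℓ := fun z => by
      have := abs_le.1 (hdl z m); rw [hdm] at this; exact ⟨this.2, this.1⟩
    have hI : ∀ a b, IntervalIntegrable (fun z => 2 * |z - m|) volume a b := fun a b =>
      (by fun_prop : Continuous fun z => 2 * |z - m|).intervalIntegrable a b
    have hJ : ∀ h : ℝ, 0 ≤ h → ∫ z in (m - h)..(m + h), 2 * |z - m| = 2 * h ^ 2 := by
      intro h hh
      rw [← intervalIntegral.integral_add_adjacent_intervals (hI (m - h) m) (hI m (m + h))]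
      have e1 : ∫ z in (m - h)..m, 2 * |z - m| = ∫ z in (m - h)..m, (2 * m - 2 * z) := by
        refine intervalIntegral.integral_congr fun z hz => ?_
        rw [uIcc_of_le (by linarith)] at hz
        simp only [abs_of_nonpos (sub_nonpos.2 hz.2)]; ring
      have e2 : ∫ z in m..(m + h), 2 * |z - m| = ∫ z in m..(m + h), (2 * z - 2 * m) := by
        refine intervalIntegral.integral_congr fun z hz => ?_
        rw [uIcc_of_le (by linarith)] at hz
        simp only [abs_of_nonneg (sub_nonneg.2 hz.1)]; ring
      rw [e1, e2, intervalIntegral.integral_sub (by simp) (Continuous.intervalIntegrable (by fun_prop) _ _),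
        intervalIntegral.integral_sub (Continuous.intervalIntegrable (by fun_prop) _ _) (by simp)]
      have e3 : ∀ a b : ℝ, ∫ z in a..b, 2 * z = b ^ 2 - a ^ 2 := fun a b => by
        rw [intervalIntegral.integral_const_mul, _root_.integral_id]; ring
      simp only [e3, intervalIntegral.integral_const, smul_eq_mul]
      ring
    rcases le_total (q t) (p t) with hle | hle
    · have e := hJ (ℓ / 2) (by linarith)
      rw [show m - ℓ / 2 = q t by rw [hm, hℓ]; ring, show m + ℓ / 2 = p t by rw [hm, hℓ]; ring] at e
      have := intervalIntegral.integral_mono_on hle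
        ((intervalIntegrable_const (c := ℓ)).sub (hI _ _)) (hdi _ _)
        fun z _ => by have := (hlow z).2; linarith
      rw [intervalIntegral.integral_sub intervalIntegrable_const (hI _ _), e] at this
      simp only [intervalIntegral.integral_const, smul_eq_mul, ← hℓ] at this
      rw [sq_abs]; nlinarith
    · have e := hJ (-ℓ / 2) (by linarith)
      rw [show m - -ℓ / 2 = p t by rw [hm, hℓ]; ring, show m + -ℓ / 2 = q t by rw [hm, hℓ]; ring] at e
      have := intervalIntegral.integral_mono_on hle (hdi _ _)
        ((intervalIntegrable_const (c := ℓ)).add (hI _ _))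
        fun z _ => by have := (hlow z).1; linarith
      rw [intervalIntegral.integral_add intervalIntegrable_const (hI _ _), e] at this
      simp only [intervalIntegral.integral_const, smul_eq_mul] at this
      rw [intervalIntegral.integral_symm, sq_abs]
      have hq : q t - p t = -ℓ := by rw [hℓ]; ring
      rw [hq] at this
      nlinarith

/-- The Wasserstein distance of order `k ∈ {1, 2}` is controlled by test functions of order `k`. -/
theorem wasserstein_le_of_test {μ ν : Measure ℝ} [IsProbabilityMeasure μ] [IsProbabilityMeasure ν]
    {k : ℕ} (hk : k = 1 ∨ k = 2) (hμ : MemLp id 2 μ) (hν : MemLp id 2 ν) {B : ℝ} (hB : 0 ≤ B)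
    (h : ∀ f d, IsTest k 2 f d → 2 * (∫ x, f x ∂μ - ∫ x, f x ∂ν) ≤ B ^ k) :
    wasserstein k μ ν ≤ ENNReal.ofReal B := by
  set lam := volume.restrict (Ioo (0 : ℝ) 1) with hlam
  have hp : AEMeasurable (quantile μ) lam := aemeasurable_quantile
  have hq : AEMeasurable (quantile ν) lam := aemeasurable_quantile
  have hpq := hp.prodMk hq
  have hmono : ∀ s ∈ Ioo (0 : ℝ) 1, ∀ t ∈ Ioo (0 : ℝ) 1,
      (quantile μ s ≤ quantile μ t ∧ quantile ν s ≤ quantile ν t) ∨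
      (quantile μ t ≤ quantile μ s ∧ quantile ν t ≤ quantile ν s) := by
    intro s hs t ht
    rcases le_total s t with hst | hst
    · exact Or.inl ⟨monotoneOn_quantile hs ht hst, monotoneOn_quantile hs ht hst⟩
    · exact Or.inr ⟨monotoneOn_quantile ht hs hst, monotoneOn_quantile ht hs hst⟩
  have hex : ∃ f d : ℝ → ℝ, IsTest k 2 f d ∧ ∀ t ∈ Ioo (0 : ℝ) 1,
      |quantile μ t - quantile ν t| ^ k ≤ 2 * (f (quantile μ t) - f (quantile ν t)) := by
    rcases hk with rfl | rfl
    · obtain ⟨f, d, hf, h⟩ := exists_potential_one hmono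
      refine ⟨f, d, ⟨hf.measurable, hf.measurable_slope, fun x y => (hf.bound x y).trans ?_,
        hf.growth⟩, by simpa using h⟩
      gcongr; norm_num
    · exact exists_potential_two hmono
  obtain ⟨f, d, hf, hfb⟩ := hex
  have hk2 : k ≤ 2 := by omega
  have hk0 : k ≠ 0 := by omega
  obtain ⟨A, hA, hgr⟩ := hf.abs_le_growth hk2
  have hint : ∀ {ρ : Measure ℝ} [IsProbabilityMeasure ρ], MemLp id 2 ρ → Integrable f ρ := by
    intro ρ _ hρ
    have h1 : MemLp (fun x : ℝ => 1 + |x|) 2 ρ := (memLp_const (1 : ℝ)).add hρ.norm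
    exact (h1.integrable_sq.const_mul A).mono' hf.measurable.aestronglyMeasurable
      (Eventually.of_forall hgr)
  have ip : Integrable (fun t => f (quantile μ t)) lam := by
    have := hint hμ
    rw [← map_quantile (μ := μ)] at this
    exact this.comp_aemeasurable hp
  have iq : Integrable (fun t => f (quantile ν t)) lam := by
    have := hint hν
    rw [← map_quantile (μ := ν)] at this
    exact this.comp_aemeasurable hq
  have ep : ∫ t, f (quantile μ t) ∂lam = ∫ x, f x ∂μ := by
    rw [← integral_map hp hf.measurable.aestronglyMeasurable, map_quantile]
  have eq : ∫ t, f (quantile ν t) ∂lam = ∫ x, f x ∂ν := by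
    rw [← integral_map hq hf.measurable.aestronglyMeasurable, map_quantile]
  have hcost : ∫⁻ t, ENNReal.ofReal (|quantile μ t - quantile ν t| ^ k) ∂lam
      ≤ ENNReal.ofReal B ^ k := by
    calc _ ≤ ∫⁻ t, ENNReal.ofReal (2 * (f (quantile μ t) - f (quantile ν t))) ∂lam := by
          refine setLIntegral_mono_ae' measurableSet_Ioo (Eventually.of_forall fun t ht => ?_)
          exact ENNReal.ofReal_le_ofReal (hfb t ht)
      _ = ENNReal.ofReal (∫ t, 2 * (f (quantile μ t) - f (quantile ν t)) ∂lam) := by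
          refine (ofReal_integral_eq_lintegral_ofReal ((ip.sub iq).const_mul 2) ?_).symm
          refine (ae_restrict_iff' measurableSet_Ioo).2 (Eventually.of_forall fun t ht => ?_)
          exact le_trans (by positivity) (hfb t ht)
      _ ≤ ENNReal.ofReal (B ^ k) := by
          refine ENNReal.ofReal_le_ofReal ?_
          rw [integral_const_mul, integral_sub ip iq, ep, eq]
          exact h f d hf
      _ = _ := ENNReal.ofReal_pow hB k
  refine iInf_le_of_le (lam.map fun t => (quantile μ t, quantile ν t)) <|
    iInf_le_of_le ?_ <| iInf_le_of_le ?_ ?_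
  · rw [AEMeasurable.map_map_of_aemeasurable measurable_fst.aemeasurable hpq]
    exact map_quantile
  · rw [AEMeasurable.map_map_of_aemeasurable measurable_snd.aemeasurable hpq]
    exact map_quantile
  · rw [eLpNorm_map_measure (by fun_prop) hpq,
      eLpNorm_eq_lintegral_rpow_enorm_toReal (by exact_mod_cast hk0) (by simp)]
    simp only [Function.comp_apply, ENNReal.toReal_natCast, ENNReal.rpow_natCast]
    rw [one_div, ENNReal.rpow_inv_le_iff (by positivity), ENNReal.rpow_natCast]
    refine le_trans (le_of_eq ?_) hcost
    refine lintegral_congr fun t => ?_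
    rw [Real.enorm_eq_ofReal_abs, ENNReal.ofReal_pow (abs_nonneg _)]

/-! ### Wasserstein distance and Lindeberg sums -/

/-- The universal constant of the Lindeberg bound. -/
noncomputable def distConst : ℝ := 16 * gaussConst ^ 2

theorem one_le_distConst : 1 ≤ distConst := by
  unfold distConst; nlinarith [one_le_gaussConst]

theorem wasserstein_mono {μ ν : Measure ℝ} [IsProbabilityMeasure μ] {p q : ℝ≥0∞} (hpq : p ≤ q) :
    wasserstein p μ ν ≤ wasserstein q μ ν := by
  refine le_iInf fun π => le_iInf fun h1 => le_iInf fun h2 => ?_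
  refine iInf_le_of_le π <| iInf_le_of_le h1 <| iInf_le_of_le h2 ?_
  have : IsProbabilityMeasure π := by
    refine ⟨?_⟩
    rw [← preimage_univ (f := Prod.fst (α := ℝ) (β := ℝ)),
      ← Measure.map_apply measurable_fst .univ, h1, measure_univ]
  exact eLpNorm_le_eLpNorm_of_exponent_le hpq (by fun_prop)

/-- Rescaling the test function instead of the martingale allows the replacement argument to run on
unnormalized sums. -/
theorem IsTest.comp_div {k : ℕ} {L : ℝ} {f d : ℝ → ℝ} (hf : IsTest k L f d) {s : ℝ} (hs : 0 < s) :
    IsTest k (L / s ^ k) (fun x => f (x / s)) (fun x => d (x / s) / s) := by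
  have h1 := hf.measurable
  have h2 := hf.measurable_slope
  obtain ⟨A, hA⟩ := hf.growth
  have hA0 : 0 ≤ A := by simpa using (abs_nonneg _).trans (hA 0)
  refine ⟨by fun_prop, by fun_prop, fun x y => ?_, A * (1 + 1 / s) / s, fun x => ?_⟩
  · have := hf.bound (x / s) (y / s)
    rw [abs_div, abs_of_pos hs, div_pow] at this
    have e : taylorRem (fun x => f (x / s)) (fun x => d (x / s) / s) x y
        = taylorRem f d (x / s) (y / s) := by
      simp only [taylorRem, add_div]; ring
    rw [e]; refine this.trans_eq (by ring)
  · rw [abs_div, abs_of_pos hs, div_mul_eq_mul_div]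
    gcongr
    refine (hA _).trans ?_
    rw [mul_assoc, abs_div, abs_of_pos hs]
    gcongr
    have h3 : 0 ≤ 1 / s := by positivity
    have h4 : |x| / s = 1 / s * |x| := by ring
    nlinarith [abs_nonneg x]

section Martingale

variable {Ω : Type*} [mΩ : MeasurableSpace Ω] {μ : Measure Ω}
  {ℱ : Filtration ℕ mΩ} {Y : ℕ → Ω → ℝ} {n : ℕ}

theorem normalizedSum_eq (μ : Measure Ω) (Y : ℕ → Ω → ℝ) (n : ℕ) :
    normalizedSum μ Y n = fun ω => partialSum Y n ω / stdDev μ Y n := by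
  ext ω
  rw [normalizedSum, sum_Icc_one, partialSum]

theorem IsMDS.measurable_normalizedSum (h : IsMDS μ ℱ Y n) :
    Measurable (normalizedSum μ Y n) := by
  have := (h.measurable_partialSum le_rfl).mono (ℱ.le _) le_rfl
  rw [normalizedSum_eq]
  fun_prop

variable [IsProbabilityMeasure μ]

theorem IsMDS.distNormal_le (h : IsMDS μ ℱ Y n)
    (hV : ∀ᵐ ω ∂μ, normalizedVariance μ ℱ Y n ω = 1) {k : ℕ} (hk : k = 1 ∨ k = 2) {ε B : ℝ}
    (hε : 0 < ε) (hB : 0 ≤ B)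
    (hle : distConst * (ε ^ k + lindebergSum μ ℱ Y n k ε) ≤ (stdDev μ Y n * B) ^ k) :
    distNormal k μ Y n ≤ ENNReal.ofReal B := by
  have hs := stdDev_pos hV
  have hXm := h.measurable_normalizedSum
  have : IsProbabilityMeasure (μ.map (normalizedSum μ Y n)) :=
    Measure.isProbabilityMeasure_map hXm.aemeasurable
  have hX : MemLp (normalizedSum μ Y n) 2 μ := by
    rw [normalizedSum_eq]
    simp only [div_eq_mul_inv]
    exact (h.memLp_partialSum le_rfl).mul_const _
  refine wasserstein_le_of_test hk ?_ (memLp_id_gaussianReal' 2 (by simp)) hB fun f d hf => ?_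
  · rw [memLp_map_measure_iff (by fun_prop) hXm.aemeasurable]; exact hX
  · have key := h.abs_integral_sub_le hV (by omega) (hf.comp_div hs) hε
    rw [integral_map hXm.aemeasurable hf.measurable.aestronglyMeasurable, normalizedSum_eq]
    have e : ∀ z, f (stdDev μ Y n * z / stdDev μ Y n) = f z := fun z => by
      rw [mul_div_cancel_left₀ _ hs.ne']
    simp only [e] at key
    have h1 := (abs_le.1 key).2
    -- The `16` in `distConst` is `2 * 4 * 2`: the factor in the potential inequality, the constant
    -- of the replacement, and the constant `2` of the test functions.
    calc _ ≤ 2 * (4 * gaussConst ^ 2 * (2 / stdDev μ Y n ^ k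
          * (ε ^ k + lindebergSum μ ℱ Y n k ε))) := by linarith
      _ = distConst * (ε ^ k + lindebergSum μ ℱ Y n k ε) / stdDev μ Y n ^ k := by
          rw [distConst]; ring
      _ ≤ (stdDev μ Y n * B) ^ k / stdDev μ Y n ^ k := by gcongr
      _ = B ^ k := by rw [mul_pow]; field_simp

theorem IsMDS.distNormal_one_le (h : IsMDS μ ℱ Y n)
    (hV : ∀ᵐ ω ∂μ, normalizedVariance μ ℱ Y n ω = 1) {ε B : ℝ} (hε : 0 < ε) (hB : 0 ≤ B)
    (hle : distConst * (ε + lindebergSum μ ℱ Y n 1 ε) ≤ stdDev μ Y n * B) :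
    distNormal 1 μ Y n ≤ ENNReal.ofReal B := by
  simpa using h.distNormal_le hV (Or.inl rfl) hε hB (by simpa using hle)

theorem IsMDS.distNormal_two_le (h : IsMDS μ ℱ Y n)
    (hV : ∀ᵐ ω ∂μ, normalizedVariance μ ℱ Y n ω = 1) {ε B : ℝ} (hε : 0 < ε) (hB : 0 ≤ B)
    (hle : distConst * (ε ^ 2 + lindebergSum μ ℱ Y n 2 ε) ≤ (stdDev μ Y n * B) ^ 2) :
    distNormal 2 μ Y n ≤ ENNReal.ofReal B := by
  simpa using h.distNormal_le hV (Or.inr rfl) hε hB hle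

theorem IsMDS.distNormal_one_le_two (h : IsMDS μ ℱ Y n) :
    distNormal 1 μ Y n ≤ distNormal 2 μ Y n := by
  have : IsProbabilityMeasure (μ.map (normalizedSum μ Y n)) :=
    Measure.isProbabilityMeasure_map h.measurable_normalizedSum.aemeasurable
  exact wasserstein_mono (by norm_num)

end Martingale

/-! ### Functions between the square and the cube -/

/-- Positive functions `ψ` on `(0, ∞)` such that `x² ≼ ψ ≼ x³`. -/
structure IsQuadCubic (ψ : ℝ → ℝ) : Prop where
  pos : ∀ x, 0 < x → 0 < ψ x
  zero_nonneg : 0 ≤ ψ 0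
  sq_le : ∀ x y, 0 < x → x ≤ y → ψ x * y ^ 2 ≤ ψ y * x ^ 2
  cube_le : ∀ x y, 0 < x → x ≤ y → ψ y * x ^ 3 ≤ ψ x * y ^ 3

theorem isQuadCubic_cube : IsQuadCubic fun x => x ^ 3 where
  pos x hx := by positivity
  zero_nonneg := by simp
  sq_le x y hx hxy := by
    have : 0 ≤ x ^ 2 * y ^ 2 := by positivity
    nlinarith
  cube_le x y hx hxy := by rw [mul_comm]

theorem IsNFunction.isQuadCubic {ψ : ℝ → ℝ} (h : IsNFunction ψ) (h3 : Prec ψ fun x => x ^ 3)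
    (hc : ConvexOn ℝ (Ici 0) fun x => ψ (√x)) : IsQuadCubic ψ where
  pos := h.pos
  zero_nonneg := h.nonneg 0 le_rfl
  cube_le x y hx hxy := by
    have hy := hx.trans_le hxy
    have := h3 (mem_Ioi.2 hx) (mem_Ioi.2 hy) hxy
    simp only at this
    rw [div_le_div_iff₀ (h.pos x hx) (h.pos y hy)] at this
    linarith
  sq_le x y hx hxy := by
    have hy := hx.trans_le hxy
    rcases hxy.eq_or_lt with rfl | hlt
    · exact le_rfl
    -- A convex function vanishing at `0` has a non-decreasing quotient by the identity; this is
    -- applied to `u ↦ ψ (√u)`. The hypotheses fix the right limit of `ψ` at `0` but not the value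
    -- `ψ 0`, so convexity is used on `[t², y²]` and then `t` tends to `0`.
    have hψ0 : Tendsto ψ (𝓝[>] 0) (𝓝 0) := by
      have h1 : Tendsto (fun x : ℝ => ψ x / x * x) (𝓝[>] 0) (𝓝 (0 * 0)) :=
        h.tendsto_zero.mul (tendsto_nhdsWithin_of_tendsto_nhds tendsto_id)
      rw [mul_zero] at h1
      refine h1.congr' ?_
      filter_upwards [self_mem_nhdsWithin] with t ht
      exact div_mul_cancel₀ _ (ne_of_gt ht)
    have ht2 : Tendsto (fun t : ℝ => t ^ 2) (𝓝[>] 0) (𝓝 0) := by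
      refine tendsto_nhdsWithin_of_tendsto_nhds ?_
      simpa using (continuous_pow 2).tendsto (0 : ℝ)
    have hl : Tendsto (fun t : ℝ => ψ x * (y ^ 2 - t ^ 2)) (𝓝[>] 0) (𝓝 (ψ x * (y ^ 2 - 0))) :=
      (ht2.const_sub _).const_mul _
    have hr : Tendsto (fun t : ℝ => ψ t * (y ^ 2 - x ^ 2) + ψ y * (x ^ 2 - t ^ 2)) (𝓝[>] 0)
        (𝓝 (0 * (y ^ 2 - x ^ 2) + ψ y * (x ^ 2 - 0))) :=
      (hψ0.mul_const _).add ((ht2.const_sub _).const_mul _)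
    have := le_of_tendsto_of_tendsto hl hr ?_
    · simpa using this
    · filter_upwards [Ioo_mem_nhdsGT hx] with t ht
      have h1 : t ^ 2 < x ^ 2 := pow_lt_pow_left₀ ht.2 ht.1.le (by norm_num)
      have h2 : x ^ 2 < y ^ 2 := pow_lt_pow_left₀ hlt hx.le (by norm_num)
      have hD : 0 < y ^ 2 - t ^ 2 := by linarith
      have ha : 0 ≤ (y ^ 2 - x ^ 2) / (y ^ 2 - t ^ 2) := div_nonneg (by linarith) hD.le
      have hb : 0 ≤ (x ^ 2 - t ^ 2) / (y ^ 2 - t ^ 2) := div_nonneg (by linarith) hD.le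
      have := hc.2 (mem_Ici.2 (sq_nonneg t)) (mem_Ici.2 (sq_nonneg y)) ha hb
        (by field_simp; ring)
      have e : (y ^ 2 - x ^ 2) / (y ^ 2 - t ^ 2) * t ^ 2 + (x ^ 2 - t ^ 2) / (y ^ 2 - t ^ 2) * y ^ 2
          = x ^ 2 := by field_simp; ring
      simp only [smul_eq_mul, e, Real.sqrt_sq hx.le, Real.sqrt_sq ht.1.le, Real.sqrt_sq hy.le] at this
      calc ψ x * (y ^ 2 - t ^ 2) ≤ _ * (y ^ 2 - t ^ 2) := mul_le_mul_of_nonneg_right this hD.le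
        _ = _ := by field_simp

namespace IsQuadCubic

variable {ψ : ℝ → ℝ}

theorem nonneg (h : IsQuadCubic ψ) {x : ℝ} (hx : 0 ≤ x) : 0 ≤ ψ x := by
  rcases hx.eq_or_lt with rfl | hx
  · exact h.zero_nonneg
  · exact (h.pos x hx).le

theorem comp_div (h : IsQuadCubic ψ) {c : ℝ} (hc : 0 < c) : IsQuadCubic fun x => ψ (x / c) where
  pos x hx := h.pos _ (by positivity)
  zero_nonneg := by simpa using h.zero_nonneg
  sq_le x y hx hxy := by
    have := h.sq_le (x / c) (y / c) (by positivity) (by gcongr)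
    rw [div_pow, div_pow, ← mul_div_assoc, ← mul_div_assoc] at this
    exact (div_le_div_iff_of_pos_right (by positivity)).1 this
  cube_le x y hx hxy := by
    have := h.cube_le (x / c) (y / c) (by positivity) (by gcongr)
    rw [div_pow, div_pow, ← mul_div_assoc, ← mul_div_assoc] at this
    exact (div_le_div_iff_of_pos_right (by positivity)).1 this

/-- For `|y| ≥ r` use the quadratic bound and `x² ≼ ψ`; for `|y| ≤ r` use the cubic bound and `ψ ≼
x³`. This is where Lindeberg remainders become `ψ`-moments. -/
theorem quadCubic_le (h : IsQuadCubic ψ) {r : ℝ} (hr : 0 < r) (y : ℝ) :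
    quadCubic (y / r) ≤ ψ |y| / ψ r := by
  have hψ := h.pos r hr
  rcases (abs_nonneg y).eq_or_lt with hy | hy
  · rw [← hy, abs_eq_zero.1 hy.symm]
    simp only [zero_div, quadCubic, abs_zero]
    exact (min_le_left _ _).trans (by simpa using div_nonneg h.zero_nonneg hψ.le)
  rw [le_div_iff₀ hψ]
  rcases le_total r |y| with hle | hle
  · calc _ ≤ (y / r) ^ 2 * ψ r := by gcongr; exact min_le_left _ _
      _ = ψ r * |y| ^ 2 / r ^ 2 := by rw [sq_abs, div_pow]; ring
      _ ≤ ψ |y| * r ^ 2 / r ^ 2 := by gcongr ?_ / _; exact h.sq_le _ _ hr hle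
      _ = _ := by field_simp
  · calc _ ≤ |y / r| ^ 3 * ψ r := by gcongr; exact min_le_right _ _
      _ = ψ r * |y| ^ 3 / r ^ 3 := by rw [abs_div, abs_of_pos hr, div_pow]; ring
      _ ≤ ψ |y| * r ^ 3 / r ^ 3 := by gcongr ?_ / _; exact h.cube_le _ _ hy hle
      _ = _ := by field_simp

/-- For `k ≤ 2` the function `x ^ k / ψ x` is non-increasing. -/
theorem pow_div_le (h : IsQuadCubic ψ) {k : ℕ} (hk : k ≤ 2) {x y : ℝ} (hx : 0 < x) (hxy : x ≤ y) :
    y ^ k / ψ y ≤ x ^ k / ψ x := by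
  have hy := hx.trans_le hxy
  have hψx := h.pos x hx
  have hψy := h.pos y hy
  have h2 := h.sq_le x y hx hxy
  rw [div_le_div_iff₀ hψy hψx]
  obtain ⟨j, hkj⟩ := Nat.exists_eq_add_of_le hk
  have hj : x ^ j ≤ y ^ j := pow_le_pow_left₀ hx.le hxy j
  have e : ∀ z : ℝ, z ^ 2 = z ^ k * z ^ j := fun z => by rw [hkj, pow_add]
  rw [e x, e y] at h2
  have hyj : 0 < y ^ j := by positivity
  refine le_of_mul_le_mul_right ?_ hyj
  calc y ^ k * ψ x * y ^ j = ψ x * (y ^ k * y ^ j) := by ring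
    _ ≤ ψ y * (x ^ k * x ^ j) := h2
    _ ≤ ψ y * (x ^ k * y ^ j) := by gcongr
    _ = _ := by ring

/-- A lower bound of `ψ |y|` affine in `y ^ 2`: taking (conditional) expectations compares
`ψ`-moments with variances. -/
theorem mul_sq_sub_le (h : IsQuadCubic ψ) {q : ℝ} (hq : 0 < q) (y : ℝ) :
    ψ q / q ^ 2 * (y ^ 2 - q ^ 2) ≤ ψ |y| := by
  have hψ := h.pos q hq
  rcases le_total q |y| with hle | hle
  · have h1 := h.sq_le q |y| hq hle
    rw [sq_abs] at h1
    rw [div_mul_eq_mul_div, div_le_iff₀ (by positivity)]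
    nlinarith [sq_nonneg q]
  · have : y ^ 2 ≤ q ^ 2 := by rw [← sq_abs]; gcongr
    exact (mul_nonpos_of_nonneg_of_nonpos (by positivity) (by linarith)).trans
      (h.nonneg (abs_nonneg y))

end IsQuadCubic

section Martingale

variable {Ω : Type*} [mΩ : MeasurableSpace Ω] {μ : Measure Ω}
  {ℱ : Filtration ℕ mΩ} {Y : ℕ → Ω → ℝ} {n : ℕ} {ψ : ℝ → ℝ}

/-! ### Bounds of Lindeberg sums by moments -/

theorem ofReal_integral_le_lintegral {F : Ω → ℝ} (hF : ∀ ω, 0 ≤ F ω) :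
    ENNReal.ofReal (∫ ω, F ω ∂μ) ≤ ∫⁻ ω, ENNReal.ofReal (F ω) ∂μ := by
  rw [← Real.enorm_of_nonneg (integral_nonneg hF)]
  refine (enorm_integral_le_lintegral_enorm _).trans_eq (lintegral_congr fun ω => ?_)
  rw [Real.enorm_of_nonneg (hF ω)]

/-- Stated in `[0, ∞]` so that infinite moments need no separate treatment. -/
theorem ofReal_lindebergSum_le {k : ℕ} {ε : ℝ} {b : ℕ → ℝ} (hb : ∀ i < n, 0 ≤ b i)
    (h : ∀ᵐ ω ∂μ, ∀ i < n, √(remVar μ ℱ Y n ε (i + 1) ω) ^ k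
      * quadCubic (Y (i + 1) ω / √(remVar μ ℱ Y n ε (i + 1) ω)) ≤ b i * ψ |Y (i + 1) ω|) :
    ENNReal.ofReal (lindebergSum μ ℱ Y n k ε)
      ≤ ∑ i ∈ Finset.range n, ENNReal.ofReal (b i) * orliczMoment μ ψ (Y (i + 1)) := by
  have h0 : ∀ i ω, 0 ≤ √(remVar μ ℱ Y n ε (i + 1) ω) ^ k
      * quadCubic (Y (i + 1) ω / √(remVar μ ℱ Y n ε (i + 1) ω)) := fun i ω =>
    mul_nonneg (by positivity) (quadCubic_nonneg _)
  rw [lindebergSum, ENNReal.ofReal_sum_of_nonneg fun i _ => integral_nonneg (h0 i)]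
  refine Finset.sum_le_sum fun i hi => (ofReal_integral_le_lintegral (h0 i)).trans ?_
  rw [orliczMoment, ← lintegral_const_mul' _ _ ENNReal.ofReal_ne_top]
  refine lintegral_mono_ae ?_
  filter_upwards [h] with ω hω
  rw [← ENNReal.ofReal_mul (hb i (Finset.mem_range.1 hi))]
  exact ENNReal.ofReal_le_ofReal (hω i (Finset.mem_range.1 hi))

theorem pow_mul_quadCubic_le (hψ : IsQuadCubic ψ) {k : ℕ} (hk : k ≤ 2) {r v : ℝ} (hr : 0 < r)
    (hv : r ^ 2 ≤ v) (y : ℝ) :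
    √v ^ k * quadCubic (y / √v) ≤ r ^ k / ψ r * ψ |y| := by
  have hrv : r ≤ √v := Real.le_sqrt_of_sq_le hv
  have h0 : 0 < √v := hr.trans_le hrv
  have hψv := hψ.pos _ h0
  have := hψ.nonneg (abs_nonneg y)
  calc _ ≤ √v ^ k * (ψ |y| / ψ √v) := by gcongr; exact hψ.quadCubic_le h0 y
    _ = √v ^ k / ψ √v * ψ |y| := by ring
    _ ≤ _ := mul_le_mul_of_nonneg_right (hψ.pow_div_le hk hr hrv) this

/-! ### The bound in terms of the Lyapunov quantity -/

theorem inverse_pos (hψ : IsNFunction ψ) {y : ℝ} (hy : 0 < y) :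
    0 < inverse ψ y ∧ ∀ x, inverse ψ y < x → y < ψ x := by
  have hbdd : BddAbove {x : ℝ | 0 ≤ x ∧ ψ x ≤ y} := by
    obtain ⟨b, hb⟩ := (hψ.tendsto_atTop.eventually (eventually_ge_atTop (y + 1))).exists_forall_of_atTop
    refine ⟨max b 1, fun x hx => ?_⟩
    by_contra! hlt
    have h1 := hb x (le_of_lt (lt_of_le_of_lt (le_max_left _ _) hlt))
    have h2 : 1 < x := lt_of_le_of_lt (le_max_right _ _) hlt
    rw [le_div_iff₀ (by linarith)] at h1
    nlinarith [hx.2]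
  have hex : ∃ x, 0 < x ∧ ψ x ≤ y := by
    have h1 := hψ.tendsto_zero.eventually (gt_mem_nhds hy)
    obtain ⟨x, hx, hx'⟩ := (h1.and (Ioc_mem_nhdsGT one_pos)).exists
    refine ⟨x, hx'.1, ?_⟩
    rw [div_lt_iff₀ hx'.1] at hx
    nlinarith [hx'.2]
  obtain ⟨x, hx, hxy⟩ := hex
  have hpos : 0 < inverse ψ y := hx.trans_le (le_csSup hbdd ⟨hx.le, hxy⟩)
  refine ⟨hpos, fun z hz => ?_⟩
  by_contra! hlt
  exact absurd (le_csSup hbdd (⟨(hpos.trans hz).le, hlt⟩ : z ∈ {x : ℝ | 0 ≤ x ∧ ψ x ≤ y}))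
    (not_le.2 hz)

variable [IsProbabilityMeasure μ]

theorem pos_of_normalizedVariance (hV : ∀ᵐ ω ∂μ, normalizedVariance μ ℱ Y n ω = 1) : 0 < n := by
  rcases Nat.eq_zero_or_pos n with rfl | hn
  · exact absurd (stdDev_pos hV) (by simp [stdDev])
  · exact hn

/-- Every `c` admissible in the Orlicz norm yields a bound; the infimum over `c` is taken last. For
order two, the crude estimate `v ≥ ε²` suffices, and order one follows because `W_1 ≤ W_2`. -/
theorem IsMDS.distNormal_le_lyapunov (h : IsMDS μ ℱ Y n)
    (hV : ∀ᵐ ω ∂μ, normalizedVariance μ ℱ Y n ω = 1) (hN : IsNFunction ψ) (hψ : IsQuadCubic ψ) :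
    distNormal 2 μ Y n ≤ ENNReal.ofReal (4 * distConst) * lyapunov μ ψ Y n := by
  have hs := stdDev_pos hV
  have hn := pos_of_normalizedVariance hV
  have hC := one_le_distConst
  have hn' : (0 : ℝ) < n := by exact_mod_cast hn
  obtain ⟨hx0, hx1⟩ := inverse_pos hN hn'
  set x₀ := inverse ψ n
  rw [lyapunov, ← mul_assoc, ← ENNReal.ofReal_mul (by positivity), orliczNorm]
  have hA0 : ENNReal.ofReal (4 * distConst * (x₀ / stdDev μ Y n)) ≠ 0 := by
    rw [Ne, ENNReal.ofReal_eq_zero, not_le]; positivity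
  rw [ENNReal.mul_iInf_of_ne hA0 ENNReal.ofReal_ne_top]
  refine le_iInf fun c => ?_
  rw [ENNReal.mul_iInf_of_ne hA0 ENNReal.ofReal_ne_top]
  refine le_iInf fun hc => ?_
  rw [ENNReal.mul_iInf_of_ne hA0 ENNReal.ofReal_ne_top]
  refine le_iInf fun hle => ?_
  rw [← ENNReal.ofReal_mul (by positivity)]
  rw [ENNReal.div_le_iff_le_mul (by simp [hn.ne']) (by simp), one_mul, sum_Icc_one] at hle
  -- The scale at which the Lindeberg sum is at most `ε ^ 2`: each weight is `ε ^ 2 / ψ (ε / c) ≤ ε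
  -- ^ 2 / n`, and the moments sum to at most `n`. The factor `2` puts `ε / c` strictly above
  -- `ψ⁻¹(n)`, where `ψ` exceeds `n`.
  set ε := 2 * (c * x₀) with hε
  have hε0 : 0 < ε := by positivity
  have hψε : (n : ℝ) ≤ ψ (ε / c) := by
    refine (hx1 _ ?_).le
    rw [hε, show 2 * (c * x₀) / c = 2 * x₀ by field_simp]
    linarith
  have key : ENNReal.ofReal (lindebergSum μ ℱ Y n 2 ε) ≤ ENNReal.ofReal (ε ^ 2) := by
    have h1 := ofReal_lindebergSum_le (μ := μ) (ℱ := ℱ) (Y := Y) (n := n) (k := 2) (ε := ε)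
      (ψ := fun x => ψ (x / c)) (b := fun _ => ε ^ 2 / n) (fun _ _ => by positivity)
      (Eventually.of_forall fun ω i _ => by
        refine (pow_mul_quadCubic_le (hψ.comp_div hc) le_rfl hε0 (sq_le_remVar ε (i + 1) ω) _).trans ?_
        have := (hψ.comp_div hc).nonneg (abs_nonneg (Y (i + 1) ω))
        gcongr)
    refine h1.trans ?_
    rw [← Finset.mul_sum]
    have h2 : ∀ i, orliczMoment μ (fun x => ψ (x / c)) (Y (i + 1))
        = orliczMoment μ ψ (fun ω => Y (i + 1) ω / c) := fun i => by
      simp only [orliczMoment, abs_div, abs_of_pos hc]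
    simp only [h2]
    calc _ ≤ ENNReal.ofReal (ε ^ 2 / n) * (n : ℝ≥0∞) := by gcongr
      _ = ENNReal.ofReal (ε ^ 2) := by
        rw [← ENNReal.ofReal_natCast, ← ENNReal.ofReal_mul (by positivity)]
        congr 1; field_simp
  rw [ENNReal.ofReal_le_ofReal_iff (by positivity)] at key
  refine h.distNormal_two_le hV hε0 (by positivity) ?_
  have e : stdDev μ Y n * (4 * distConst * (x₀ / stdDev μ Y n) * c) = 2 * distConst * ε := by
    rw [hε]; field_simp; ring
  rw [e]
  nlinarith [sq_nonneg ε, mul_nonneg (sub_nonneg.2 hC) (sq_nonneg ε)]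

/-! ### Sums of powers -/

/-- Bernoulli's inequality. The tangent is taken at the right endpoint `b`, so that `a = 0` is
allowed and a Riemann sum of `x ^ (q - 1)` telescopes. -/
theorem rpow_concave_step {q a b : ℝ} (hq : 0 < q) (hq1 : q ≤ 1) (ha : 0 ≤ a) (hb : 0 < b) :
    (b - a) * b ^ (q - 1) ≤ b ^ q / q - a ^ q / q := by
  have h1 := rpow_one_add_le_one_add_mul_self (s := a / b - 1)
    (by have : 0 ≤ a / b := by positivity
        linarith) hq.le hq1
  rw [add_sub_cancel, Real.div_rpow ha hb.le] at h1
  have hbq : 0 < b ^ q := Real.rpow_pos_of_pos hb q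
  rw [div_le_iff₀ hbq] at h1
  rw [Real.rpow_sub_one hb.ne', ← sub_div, le_div_iff₀ hq]
  have e : (b - a) * (b ^ q / b) * q = b ^ q - (1 + q * (a / b - 1)) * b ^ q := by
    field_simp; ring
  rw [e]; linarith

theorem log_concave_step {a b : ℝ} (ha : 0 < a) (hb : 0 < b) :
    (b - a) * b ^ (-1 : ℝ) ≤ Real.log b - Real.log a := by
  have := Real.log_le_sub_one_of_pos (show 0 < a / b by positivity)
  rw [Real.log_div ha.ne' hb.ne'] at this
  rw [Real.rpow_neg_one, sub_mul, mul_inv_cancel₀ hb.ne']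
  rw [div_eq_mul_inv] at this
  linarith

end Martingale

theorem rpow_mul_sq_rpow {x p q : ℝ} (hx : 0 < x) {k : ℕ} (h : p + 2 * q = k) :
    x ^ p * (x ^ 2) ^ q = x ^ k := by
  rw [← Real.rpow_natCast x 2, ← Real.rpow_mul hx.le, ← Real.rpow_add hx]
  push_cast
  rw [h, Real.rpow_natCast]

/-- Below the level `R`, `ψ ≼ x ^ p` reduces the weight to a pure power of the variance `x ^ 2`. The
relation `p + 2 * q = k + 2` makes its primitive the `q`-th power, which accounts for the factor `1
/ q`, hence `1 / (3 - p)` for `k = 1`. -/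
theorem pow_div_le_rpow {ψ : ℝ → ℝ} {x R p q : ℝ} {k : ℕ} (hx : 0 < x) (hψx : 0 < ψ x)
    (hψR : 0 < ψ R) (hR : ψ R * x ^ p ≤ ψ x * R ^ p) (hq : p + 2 * q = k + 2) :
    x ^ k / ψ x ≤ R ^ p / ψ R * (x ^ 2) ^ (q - 1) := by
  have e : x ^ k = x ^ p * (x ^ 2) ^ (q - 1) := (rpow_mul_sq_rpow hx (by linarith)).symm
  have h0 : 0 < (x ^ 2) ^ (q - 1) := Real.rpow_pos_of_pos (by positivity) _
  rw [e, mul_div_right_comm]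
  gcongr ?_ * _
  rw [div_le_div_iff₀ hψx hψR]
  linarith

theorem IsQuadCubic.rpow_three_le {ψ : ℝ → ℝ} (h : IsQuadCubic ψ) {x R : ℝ} (hx : 0 < x)
    (hxR : x ≤ R) : ψ R * x ^ (3 : ℝ) ≤ ψ x * R ^ (3 : ℝ) := by
  have := h.cube_le x R hx hxR
  rwa [← Real.rpow_natCast, ← Real.rpow_natCast] at this

theorem Prec.rpow_le {ψ : ℝ → ℝ} (hψ : IsQuadCubic ψ) {p : ℝ} (h : Prec ψ fun x => x ^ p)
    {x R : ℝ} (hx : 0 < x) (hxR : x ≤ R) : ψ R * x ^ p ≤ ψ x * R ^ p := by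
  have hR := hx.trans_le hxR
  have := h (mem_Ioi.2 hx) (mem_Ioi.2 hR) hxR
  simp only at this
  rw [div_le_div_iff₀ (hψ.pos x hx) (hψ.pos R hR)] at this
  linarith

section Martingale

variable {Ω : Type*} [mΩ : MeasurableSpace Ω] {μ : Measure Ω} [IsProbabilityMeasure μ]
  {ℱ : Filtration ℕ mΩ} {Y : ℕ → Ω → ℝ} {n : ℕ} {ψ : ℝ → ℝ}

/-! ### Conditional variances bounded from below -/

/-- The sum that bounds the Lindeberg sum if `σ` is a lower bound of the conditional standard
deviations. -/
noncomputable def lowerSum (ψ : ℝ → ℝ) (σ : ℝ) (n k : ℕ) : ℝ :=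
  ∑ j ∈ Finset.range n, (σ * √((j : ℝ) + 1)) ^ k / ψ (σ * √((j : ℝ) + 1))

theorem ae_le_remVar (hV : ∀ᵐ ω ∂μ, normalizedVariance μ ℱ Y n ω = 1) {σ : ℝ} (hσ : 0 < σ)
    (h : ∀ᵐ ω ∂μ, ∀ i ∈ Finset.Icc 1 n, σ ≤ √(condVariance μ ℱ Y i ω)) (ε : ℝ) :
    ∀ᵐ ω ∂μ, ∀ j ≤ n, ε ^ 2 + j * σ ^ 2 ≤ remVar μ ℱ Y n ε (n - j) ω := by
  filter_upwards [ae_remVar hV ε, h] with ω h1 h2 j hj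
  induction j with
  | zero => simp [h1.2.2]
  | succ j ih =>
    have h3 := h1.2.1 (n - (j + 1)) (by omega)
    have h4 := h2 (n - (j + 1) + 1) (Finset.mem_Icc.2 ⟨by omega, by omega⟩)
    rw [Real.le_sqrt' hσ] at h4
    have h5 := ih (by omega)
    rw [show n - (j + 1) + 1 = n - j by omega] at h3 h4
    push_cast
    linarith

theorem mul_sqrt_le_stdDev (hV : ∀ᵐ ω ∂μ, normalizedVariance μ ℱ Y n ω = 1) {σ : ℝ} (hσ : 0 < σ)
    (h : ∀ᵐ ω ∂μ, ∀ i ∈ Finset.Icc 1 n, σ ≤ √(condVariance μ ℱ Y i ω)) :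
    n * σ ^ 2 ≤ stdDev μ Y n ^ 2 := by
  obtain ⟨ω, hω⟩ := (ae_le_remVar hV hσ h 0).exists
  simpa [remVar_zero] using hω n le_rfl

theorem integral_condVariance (i : ℕ) :
    ∫ ω, condVariance μ ℱ Y i ω ∂μ = ∫ ω, Y i ω ^ 2 ∂μ :=
  integral_condExp (ℱ.le _)

/-- The affine bound at level `σ / 2` gives `E[ψ(|Y_1|)] ≥ 3 * ψ (σ / 2)`, and `ψ ≼ x³` gives `ψ (σ
/ 2) ≥ ψ σ / 8`. This serves to absorb the smoothing error `σ ^ k`. -/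
theorem IsMDS.ofReal_le_maxMoment (h : IsMDS μ ℱ Y n)
    (hn : 0 < n) (hψ : IsQuadCubic ψ) {σ : ℝ} (hσ : 0 < σ)
    (hl : ∀ᵐ ω ∂μ, ∀ i ∈ Finset.Icc 1 n, σ ≤ √(condVariance μ ℱ Y i ω)) :
    ENNReal.ofReal (3 / 8 * ψ σ) ≤ maxMoment μ ψ Y n := by
  have hmem : 1 ∈ Finset.Icc 1 n := Finset.mem_Icc.2 ⟨le_rfl, hn⟩
  refine le_trans ?_ (Finset.le_sup (f := fun i => orliczMoment μ ψ (Y i)) hmem)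
  have hi : Integrable (fun ω => Y 1 ω ^ 2) μ := (h.memLp 1 hmem).integrable_sq
  have hq : 0 < σ / 2 := by positivity
  have hψq := hψ.pos _ hq
  have hY : σ ^ 2 ≤ ∫ ω, Y 1 ω ^ 2 ∂μ := by
    rw [← integral_condVariance (ℱ := ℱ)]
    have := integral_mono_ae (μ := μ) (integrable_const (σ ^ 2))
      (integrable_condExp (m := ℱ (1 - 1)) (f := fun ω => Y 1 ω ^ 2)) (by
        filter_upwards [hl] with ω hω
        exact (Real.le_sqrt' hσ).1 (hω 1 hmem))
    rw [integral_const, probReal_univ, one_smul] at this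
    exact this
  calc ENNReal.ofReal (3 / 8 * ψ σ)
      ≤ ENNReal.ofReal (∫ ω, ψ (σ / 2) / (σ / 2) ^ 2 * (Y 1 ω ^ 2 - (σ / 2) ^ 2) ∂μ) := by
        refine ENNReal.ofReal_le_ofReal ?_
        rw [integral_const_mul, integral_sub hi (integrable_const _)]
        have h8 := hψ.cube_le (σ / 2) σ hq (by linarith)
        have h9 : ψ σ / 8 ≤ ψ (σ / 2) := by
          have : 0 < σ ^ 3 := by positivity
          rw [div_pow] at h8
          refine le_of_mul_le_mul_right ?_ this
          linarith
        calc 3 / 8 * ψ σ ≤ ψ (σ / 2) / (σ / 2) ^ 2 * (σ ^ 2 - (σ / 2) ^ 2) := by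
              have : ψ (σ / 2) / (σ / 2) ^ 2 * (σ ^ 2 - (σ / 2) ^ 2) = 3 * ψ (σ / 2) := by
                field_simp; ring
              linarith
          _ ≤ _ := by gcongr; simp
    _ ≤ ENNReal.ofReal (∫ ω, max (ψ (σ / 2) / (σ / 2) ^ 2 * (Y 1 ω ^ 2 - (σ / 2) ^ 2)) 0 ∂μ) := by
        have hI := (hi.sub (integrable_const ((σ / 2) ^ 2))).const_mul (ψ (σ / 2) / (σ / 2) ^ 2)
        exact ENNReal.ofReal_le_ofReal (integral_mono hI hI.pos_part fun ω => le_max_left _ _)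
    _ ≤ ∫⁻ ω, ENNReal.ofReal (max (ψ (σ / 2) / (σ / 2) ^ 2 * (Y 1 ω ^ 2 - (σ / 2) ^ 2)) 0) ∂μ :=
        ofReal_integral_le_lintegral fun ω => le_max_right _ _
    _ ≤ _ := by
        refine lintegral_mono fun ω => ENNReal.ofReal_le_ofReal ?_
        exact max_le (hψ.mul_sq_sub_le hq _) (hψ.nonneg (abs_nonneg _))

/-- Smoothing at scale `σ` adds one more `σ²` to the variance that remains. The smoothing error is
comparable to the first term of `lowerSum` times the maximal moment, so it costs only a constant
factor. -/
theorem IsMDS.lindeberg_le_lowerSum (h : IsMDS μ ℱ Y n)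
    (hV : ∀ᵐ ω ∂μ, normalizedVariance μ ℱ Y n ω = 1) (hψ : IsQuadCubic ψ) {σ : ℝ} (hσ : 0 < σ)
    (hl : ∀ᵐ ω ∂μ, ∀ i ∈ Finset.Icc 1 n, σ ≤ √(condVariance μ ℱ Y i ω)) {k : ℕ} (hk : k ≤ 2)
    (hM : maxMoment μ ψ Y n ≠ ∞) :
    σ ^ k + lindebergSum μ ℱ Y n k σ ≤ 4 * lowerSum ψ σ n k * (maxMoment μ ψ Y n).toReal := by
  have hn := pos_of_normalizedVariance hV
  have hr : ∀ j : ℕ, 0 < σ * √((j : ℝ) + 1) := fun j => by positivity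
  have ht : ∀ j : ℕ, 0 ≤ (σ * √((j : ℝ) + 1)) ^ k / ψ (σ * √((j : ℝ) + 1)) := fun j =>
    div_nonneg (pow_nonneg (hr j).le k) (hψ.pos _ (hr j)).le
  have hT0 : 0 ≤ lowerSum ψ σ n k := Finset.sum_nonneg fun j _ => ht j
  set M := maxMoment μ ψ Y n with hMdef
  have h1 : lindebergSum μ ℱ Y n k σ ≤ lowerSum ψ σ n k * M.toReal := by
    -- After step `i + 1` there remain `n - 1 - i` increments and the smoothing, hence variance at
    -- least `(n - i) * σ ^ 2`. The order of summation is reversed below.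
    have h2 := ofReal_lindebergSum_le (μ := μ) (ℱ := ℱ) (Y := Y) (n := n) (k := k) (ε := σ)
      (ψ := ψ) (b := fun i => (σ * √(((n - 1 - i : ℕ) : ℝ) + 1)) ^ k
        / ψ (σ * √(((n - 1 - i : ℕ) : ℝ) + 1))) (fun i _ => ht _) (by
        filter_upwards [ae_le_remVar hV hσ hl σ] with ω hω i hi
        refine pow_mul_quadCubic_le hψ hk (hr _) ?_ _
        have := hω (n - 1 - i) (by omega)
        rw [show n - (n - 1 - i) = i + 1 by omega] at this
        rw [mul_pow, Real.sq_sqrt (by positivity)]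
        linarith)
    have h3 : ENNReal.ofReal (lindebergSum μ ℱ Y n k σ)
        ≤ ENNReal.ofReal (lowerSum ψ σ n k * M.toReal) := by
      refine h2.trans ?_
      rw [ENNReal.ofReal_mul hT0, ENNReal.ofReal_toReal hM, lowerSum,
        ← Finset.sum_range_reflect (fun j : ℕ => (σ * √((j : ℝ) + 1)) ^ k
          / ψ (σ * √((j : ℝ) + 1))), ENNReal.ofReal_sum_of_nonneg fun i _ => ht _, Finset.sum_mul]
      refine Finset.sum_le_sum fun i hi => mul_le_mul_right ?_ _
      exact Finset.le_sup (f := fun i => orliczMoment μ ψ (Y i))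
        (show i + 1 ∈ Finset.Icc 1 n from
          Finset.mem_Icc.2 ⟨by omega, by have := Finset.mem_range.1 hi; omega⟩)
    exact (ENNReal.ofReal_le_ofReal_iff (by positivity)).1 h3
  have h4 : σ ^ k / ψ σ ≤ lowerSum ψ σ n k := by
    have := Finset.single_le_sum (f := fun j : ℕ =>
      (σ * √((j : ℝ) + 1)) ^ k / ψ (σ * √((j : ℝ) + 1))) (fun j _ => ht j) (Finset.mem_range.2 hn)
    simpa [lowerSum] using this
  have h5 : 3 / 8 * ψ σ ≤ M.toReal := by
    have := h.ofReal_le_maxMoment hn hψ hσ hl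
    exact (ENNReal.ofReal_le_iff_le_toReal hM).1 this
  have hψσ := hψ.pos σ hσ
  have h6 : σ ^ k ≤ 3 * (lowerSum ψ σ n k * M.toReal) := by
    have h7 : σ ^ k / ψ σ * (3 / 8 * ψ σ) ≤ lowerSum ψ σ n k * M.toReal := by gcongr
    have h8 : σ ^ k / ψ σ * (3 / 8 * ψ σ) = 3 / 8 * σ ^ k := by field_simp
    have : 0 < σ ^ k := by positivity
    linarith
  linarith

/-- Times `σ ^ 2`, the sum is a Riemann sum of mesh `σ ^ 2` for a decreasing power on `[0, n σ²]`,
an interval contained in `[0, R²]`. -/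
theorem lowerSum_mul_sq_le (hψ : IsQuadCubic ψ) {σ R p q : ℝ} (hσ : 0 < σ) (hR : 0 < R)
    (hn : n * σ ^ 2 ≤ R ^ 2) {k : ℕ} (hq0 : 0 < q) (hq1 : q ≤ 1) (hq : p + 2 * q = k + 2)
    (hp : ∀ x, 0 < x → x ≤ R → ψ R * x ^ p ≤ ψ x * R ^ p) :
    lowerSum ψ σ n k * σ ^ 2 ≤ q⁻¹ * (R ^ (k + 2) / ψ R) := by
  have hψR := hψ.pos R hR
  have hW : 0 ≤ R ^ p / ψ R := div_nonneg (Real.rpow_nonneg hR.le _) hψR.le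
  set F : ℕ → ℝ := fun j => (j * σ ^ 2) ^ q / q with hF
  have step : ∀ j ∈ Finset.range n, (σ * √((j : ℝ) + 1)) ^ k / ψ (σ * √((j : ℝ) + 1)) * σ ^ 2
      ≤ R ^ p / ψ R * (F (j + 1) - F j) := by
    intro j hj
    have hr : 0 < σ * √((j : ℝ) + 1) := by positivity
    have hr2 : (σ * √((j : ℝ) + 1)) ^ 2 = ((j + 1 : ℕ) : ℝ) * σ ^ 2 := by
      rw [mul_pow, Real.sq_sqrt (by positivity)]; push_cast; ring
    have hrR : σ * √((j : ℝ) + 1) ≤ R := by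
      refine le_of_sq_le_sq ?_ hR.le
      rw [hr2]
      refine le_trans ?_ hn
      gcongr
      have := Finset.mem_range.1 hj; omega
    have h1 := pow_div_le_rpow hr (hψ.pos _ hr) hψR (hp _ hr hrR) hq
    rw [hr2] at h1
    have h2 := rpow_concave_step hq0 hq1 (a := (j : ℝ) * σ ^ 2) (b := ((j + 1 : ℕ) : ℝ) * σ ^ 2)
      (by positivity) (by positivity)
    have h3 : ((j + 1 : ℕ) : ℝ) * σ ^ 2 - (j : ℝ) * σ ^ 2 = σ ^ 2 := by push_cast; ring
    rw [h3] at h2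
    calc _ ≤ (R ^ p / ψ R * (((j + 1 : ℕ) : ℝ) * σ ^ 2) ^ (q - 1)) * σ ^ 2 := by gcongr
      _ = R ^ p / ψ R * (σ ^ 2 * (((j + 1 : ℕ) : ℝ) * σ ^ 2) ^ (q - 1)) := by ring
      _ ≤ _ := by gcongr
  rw [lowerSum, Finset.sum_mul]
  refine (Finset.sum_le_sum step).trans ?_
  rw [← Finset.mul_sum, Finset.sum_range_sub]
  have e : q⁻¹ * (R ^ (k + 2) / ψ R) = R ^ p / ψ R * ((R ^ 2) ^ q / q) := by
    rw [← rpow_mul_sq_rpow hR (p := p) (q := q) (k := k + 2) (by push_cast; exact hq)]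
    field_simp
  rw [e]
  gcongr
  have h0 : F 0 = 0 := by simp [hF, Real.zero_rpow hq0.ne']
  rw [h0, sub_zero]
  simp only [hF]
  gcongr

end Martingale

section Martingale

variable {Ω : Type*} [mΩ : MeasurableSpace Ω] {μ : Measure Ω} [IsProbabilityMeasure μ]
  {ℱ : Filtration ℕ mΩ} {Y : ℕ → Ω → ℝ} {n : ℕ} {ψ : ℝ → ℝ} {θ : ℝ}

theorem sum_inv_le_log (hn : 2 ≤ n) :
    ∑ j ∈ Finset.range n, (1 : ℝ) / ((j : ℝ) + 1) ≤ 3 * Real.log n := by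
  have h1 := harmonic_le_one_add_log n
  have h2 : ((harmonic n : ℚ) : ℝ) = ∑ j ∈ Finset.range n, (1 : ℝ) / ((j : ℝ) + 1) := by
    simp [harmonic]
  rw [h2] at h1
  have h3 : Real.log 2 ≤ Real.log n := Real.log_le_log (by norm_num) (by exact_mod_cast hn)
  linarith [Real.log_two_gt_d9]

theorem IsMDS.distNormal_one_le_cube (h : IsMDS μ ℱ Y n)
    (hV : ∀ᵐ ω ∂μ, normalizedVariance μ ℱ Y n ω = 1) (hψ : IsQuadCubic ψ) {σ : ℝ} (hσ : 0 < σ)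
    (hl : ∀ᵐ ω ∂μ, ∀ i ∈ Finset.Icc 1 n, σ ≤ √(condVariance μ ℱ Y i ω))
    (hψ3 : ∀ x, 0 ≤ x → ψ x = x ^ 3) (hn : 2 ≤ n) :
    distNormal 1 μ Y n ≤ ENNReal.ofReal
      (14 * distConst * (Real.log n / (σ ^ 2 * stdDev μ Y n))) * maxMoment μ ψ Y n := by
  have hs := stdDev_pos hV
  have hC := one_le_distConst
  have hlog : 0 < Real.log n := Real.log_pos (by exact_mod_cast hn)
  by_cases hM : maxMoment μ ψ Y n = ∞
  · rw [hM, ENNReal.mul_top]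
    · exact le_top
    · rw [Ne, ENNReal.ofReal_eq_zero, not_le]; positivity
  rw [← ENNReal.ofReal_toReal hM, ← ENNReal.ofReal_mul (by positivity)]
  refine h.distNormal_one_le hV hσ (by positivity) ?_
  have h1 := h.lindeberg_le_lowerSum hV hψ hσ hl (k := 1) (by norm_num) hM
  rw [pow_one] at h1
  have h2 : lowerSum ψ σ n 1 ≤ 3 * Real.log n / σ ^ 2 := by
    calc lowerSum ψ σ n 1 = (∑ j ∈ Finset.range n, (1 : ℝ) / ((j : ℝ) + 1)) / σ ^ 2 := by
          rw [lowerSum, Finset.sum_div]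
          refine Finset.sum_congr rfl fun j _ => ?_
          have hr : 0 < √((j : ℝ) + 1) := by positivity
          have hr2 : √((j : ℝ) + 1) ^ 2 = (j : ℝ) + 1 := Real.sq_sqrt (by positivity)
          rw [hψ3 _ (by positivity)]
          generalize √((j : ℝ) + 1) = r at hr hr2 ⊢
          rw [← hr2]
          field_simp
      _ ≤ _ := by gcongr; exact sum_inv_le_log hn
  have hM0 : 0 ≤ (maxMoment μ ψ Y n).toReal := ENNReal.toReal_nonneg
  set m := (maxMoment μ ψ Y n).toReal
  calc _ ≤ distConst * (4 * (3 * Real.log n / σ ^ 2) * m) := by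
        gcongr; exact h1.trans (by gcongr)
    _ = 12 * (distConst * Real.log n * m / σ ^ 2) := by ring
    _ ≤ 14 * (distConst * Real.log n * m / σ ^ 2) := by gcongr; norm_num
    _ = _ := by field_simp

theorem IsMDS.distNormal_one_le_maxMoment (h : IsMDS μ ℱ Y n)
    (hV : ∀ᵐ ω ∂μ, normalizedVariance μ ℱ Y n ω = 1) (hψ : IsQuadCubic ψ) {σ : ℝ} (hσ : 0 < σ)
    (hl : ∀ᵐ ω ∂μ, ∀ i ∈ Finset.Icc 1 n, σ ≤ √(condVariance μ ℱ Y i ω))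
    {p : ℝ} (hp2 : 2 < p) (hp3 : p < 3) (hp : Prec ψ fun x => x ^ p) :
    distNormal 1 μ Y n ≤ ENNReal.ofReal (14 * distConst *
      ((3 - p)⁻¹ * (stdDev μ Y n ^ 2 / (σ ^ 2 * ψ (stdDev μ Y n))))) * maxMoment μ ψ Y n := by
  have hs := stdDev_pos hV
  have hC := one_le_distConst
  have hψs := hψ.pos _ hs
  have hp' : 0 < 3 - p := by linarith
  by_cases hM : maxMoment μ ψ Y n = ∞
  · rw [hM, ENNReal.mul_top]
    · exact le_top
    · rw [Ne, ENNReal.ofReal_eq_zero, not_le]; positivity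
  rw [← ENNReal.ofReal_toReal hM, ← ENNReal.ofReal_mul (by positivity)]
  refine h.distNormal_one_le hV hσ (by positivity) ?_
  have h1 := h.lindeberg_le_lowerSum hV hψ hσ hl (k := 1) (by norm_num) hM
  rw [pow_one] at h1
  have h2 := lowerSum_mul_sq_le hψ hσ hs (mul_sqrt_le_stdDev hV hσ hl) (k := 1) (p := p)
    (q := (3 - p) / 2) (by linarith) (by linarith) (by push_cast; ring)
    fun x hx hxs => hp.rpow_le hψ hx hxs
  rw [← le_div_iff₀ (by positivity), inv_div] at h2
  have hM0 : 0 ≤ (maxMoment μ ψ Y n).toReal := ENNReal.toReal_nonneg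
  set m := (maxMoment μ ψ Y n).toReal
  set s := stdDev μ Y n
  calc _ ≤ distConst * (4 * (2 / (3 - p) * (s ^ (1 + 2) / ψ s) / σ ^ 2) * m) := by
        gcongr; exact h1.trans (by gcongr)
    _ = 8 * (distConst * m * (s ^ 3 / (ψ s * σ ^ 2 * (3 - p)))) := by field_simp; ring
    _ ≤ 14 * (distConst * m * (s ^ 3 / (ψ s * σ ^ 2 * (3 - p)))) := by gcongr; norm_num
    _ = _ := by field_simp

theorem IsMDS.distNormal_two_le_maxMoment (h : IsMDS μ ℱ Y n)
    (hV : ∀ᵐ ω ∂μ, normalizedVariance μ ℱ Y n ω = 1) (hψ : IsQuadCubic ψ) {σ : ℝ} (hσ : 0 < σ)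
    (hl : ∀ᵐ ω ∂μ, ∀ i ∈ Finset.Icc 1 n, σ ≤ √(condVariance μ ℱ Y i ω)) :
    distNormal 2 μ Y n ≤ ENNReal.ofReal (14 * distConst *
      (stdDev μ Y n / (σ * √(ψ (stdDev μ Y n))))) * maxMoment μ ψ Y n ^ (1 / 2 : ℝ) := by
  have hs := stdDev_pos hV
  have hC := one_le_distConst
  have hψs := hψ.pos _ hs
  by_cases hM : maxMoment μ ψ Y n = ∞
  · rw [hM, ENNReal.top_rpow_of_pos (by norm_num), ENNReal.mul_top]
    · exact le_top
    · rw [Ne, ENNReal.ofReal_eq_zero, not_le]; positivity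
  have hM0 : 0 ≤ (maxMoment μ ψ Y n).toReal := ENNReal.toReal_nonneg
  have h1 := h.lindeberg_le_lowerSum hV hψ hσ hl (k := 2) le_rfl hM
  rw [← ENNReal.ofReal_toReal hM, ENNReal.ofReal_rpow_of_nonneg hM0 (by norm_num),
    ← ENNReal.ofReal_mul (by positivity), ← Real.sqrt_eq_rpow]
  refine h.distNormal_two_le hV hσ (by positivity) ?_
  have h2 := lowerSum_mul_sq_le hψ hσ hs (mul_sqrt_le_stdDev hV hσ hl) (k := 2) (p := 3)
    (q := 1 / 2) (by norm_num) (by norm_num) (by norm_num) fun x hx hxs => hψ.rpow_three_le hx hxs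
  rw [← le_div_iff₀ (by positivity)] at h2
  set m := (maxMoment μ ψ Y n).toReal
  set s := stdDev μ Y n
  calc _ ≤ distConst * (4 * ((1 / 2)⁻¹ * (s ^ (2 + 2) / ψ s) / σ ^ 2) * m) := by
        gcongr; exact h1.trans (by gcongr)
    _ = (8 * distConst) * (m * s ^ 4 / (ψ s * σ ^ 2)) := by field_simp; ring
    _ ≤ (14 * distConst) ^ 2 * (m * s ^ 4 / (ψ s * σ ^ 2)) := by gcongr; nlinarith
    _ = _ := by
      simp only [mul_pow, div_pow, Real.sq_sqrt hψs.le, Real.sq_sqrt hM0]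
      field_simp

/-! ### Conditional moment bounds -/

/-- A conditional Jensen inequality up to a constant: take conditional expectations in
`mul_sq_sub_le`. The level must depend on `ω`, so the bound is first proved for all rational levels
outside one null set. -/
theorem CondMomentBound.ae_le (hb : CondMomentBound μ ℱ ψ Y n θ) (h : IsMDS μ ℱ Y n)
    (hψ : IsQuadCubic ψ) : ∀ᵐ ω ∂μ, ∀ i ∈ Finset.Icc 1 n, 0 < condVariance μ ℱ Y i ω →
      ψ √(condVariance μ ℱ Y i ω) ≤ 6 * θ * condVariance μ ℱ Y i ω := by
  rw [eventually_all_finset]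
  intro i hi
  obtain ⟨hint, hle⟩ := hb i hi
  have hY2 : Integrable (fun ω => Y i ω ^ 2) μ := (h.memLp i hi).integrable_sq
  have key : ∀ᵐ ω ∂μ, ∀ q : ℚ, 0 < (q : ℝ) →
      ψ q / (q : ℝ) ^ 2 * (condVariance μ ℱ Y i ω - (q : ℝ) ^ 2)
        ≤ θ * condVariance μ ℱ Y i ω := by
    rw [ae_all_iff]
    intro q
    by_cases hq : 0 < (q : ℝ)
    · have hI := (hY2.sub (integrable_const ((q : ℝ) ^ 2))).const_mul (ψ q / (q : ℝ) ^ 2)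
      have h1 := condExp_mono (m := ℱ (i - 1)) hI hint
        (Eventually.of_forall fun ω => hψ.mul_sq_sub_le hq (Y i ω))
      have h2 := condExp_smul (μ := μ) (ψ q / (q : ℝ) ^ 2)
        ((fun ω => Y i ω ^ 2) - fun _ => (q : ℝ) ^ 2) (ℱ (i - 1))
      have h3 := condExp_sub hY2 (integrable_const ((q : ℝ) ^ 2)) (ℱ (i - 1))
      filter_upwards [h1, h2, h3, hle] with ω e1 e2 e3 e4 _
      rw [condExp_const (ℱ.le _)] at e3
      refine le_trans (le_of_eq ?_) (e1.trans e4)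
      refine Eq.trans ?_ e2.symm
      rw [Pi.smul_apply, e3]
      rfl
    · exact Eventually.of_forall fun ω hq' => absurd hq' hq
  filter_upwards [key] with ω hω hpos
  set V := condVariance μ ℱ Y i ω
  set x := √V with hx
  have hx0 : 0 < x := Real.sqrt_pos.2 hpos
  have hxV : V = x ^ 2 := (Real.sq_sqrt hpos.le).symm
  -- The bound `q < x / 2` keeps `3 / 4` of `x ^ 2`, and `q > x / 4` with `ψ ≼ x³` loses a factor
  -- `4`; together `ψ x ≤ 16 / 3 * θ * x ^ 2`, and `16 / 3 ≤ 6`.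
  obtain ⟨q, hq1, hq2⟩ := exists_rat_btwn (show x / 4 < x / 2 by linarith)
  have hq0 : 0 < (q : ℝ) := by linarith
  have h1 := hω q hq0
  have hψq := hψ.pos q hq0
  have hψx := hψ.pos x hx0
  have h2 := hψ.cube_le q x hq0 (by linarith)
  rw [hxV] at h1 ⊢
  have h3 : ψ x / (4 * x ^ 2) ≤ ψ q / (q : ℝ) ^ 2 := by
    rw [div_le_div_iff₀ (by positivity) (by positivity)]
    have hx3 : x * (ψ x * (q : ℝ) ^ 2) ≤ x * (ψ q * (4 * x ^ 2)) := by
      calc x * (ψ x * (q : ℝ) ^ 2) ≤ (4 * q) * (ψ x * (q : ℝ) ^ 2) := by gcongr; linarith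
        _ = 4 * (ψ x * (q : ℝ) ^ 3) := by ring
        _ ≤ 4 * (ψ q * x ^ 3) := by gcongr
        _ = _ := by ring
    exact le_of_mul_le_mul_left hx3 hx0
  have h4 : 3 / 4 * x ^ 2 ≤ x ^ 2 - (q : ℝ) ^ 2 := by nlinarith
  have h5 : ψ x / (4 * x ^ 2) * (3 / 4 * x ^ 2) ≤ θ * x ^ 2 := by
    refine le_trans ?_ h1
    gcongr
  have h6 : ψ x / (4 * x ^ 2) * (3 / 4 * x ^ 2) = 3 / 16 * ψ x := by field_simp; norm_num
  linarith [h6 ▸ h5]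

theorem ae_sqrt_condVariance_le_stdDev (hV : ∀ᵐ ω ∂μ, normalizedVariance μ ℱ Y n ω = 1) :
    ∀ᵐ ω ∂μ, ∀ i < n, √(condVariance μ ℱ Y (i + 1) ω) ≤ stdDev μ Y n := by
  have hs := stdDev_pos hV
  filter_upwards [sum_condVariance hV, ae_all_iff.2 (condVariance_nonneg (μ := μ) (ℱ := ℱ) (Y := Y))]
    with ω h1 h2 i hi
  rw [Real.sqrt_le_left hs.le, ← h1]
  exact Finset.single_le_sum (f := fun i => condVariance μ ℱ Y (i + 1) ω) (fun j _ => h2 _)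
    (Finset.mem_range.2 hi)

/-- Since `ψ ≼ x³` and the conditional deviation `x` is at most `s_n`, `ψ x` is at least `ψ(s_n) *
x³ / s_n³`; together with `ψ x ≤ 6 θ x²` this bounds `x`. The minimum is the smoothing scale used in
(iii). -/
theorem CondMomentBound.ae_sqrt_le (hb : CondMomentBound μ ℱ ψ Y n θ) (h : IsMDS μ ℱ Y n)
    (hV : ∀ᵐ ω ∂μ, normalizedVariance μ ℱ Y n ω = 1) (hθ : 0 < θ)
    (hψ : IsQuadCubic ψ) : ∀ᵐ ω ∂μ, ∀ i < n, √(condVariance μ ℱ Y (i + 1) ω)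
      ≤ min (6 * θ * (stdDev μ Y n ^ 3 / ψ (stdDev μ Y n))) (stdDev μ Y n) := by
  have hs := stdDev_pos hV
  have hψs := hψ.pos _ hs
  filter_upwards [hb.ae_le h hψ, ae_sqrt_condVariance_le_stdDev hV] with ω h1 h2 i hi
  refine le_min ?_ (h2 i hi)
  have h3 := h1 (i + 1) (Finset.mem_Icc.2 ⟨by omega, by omega⟩)
  have h4 := h2 i hi
  rcases le_or_gt (condVariance μ ℱ Y (i + 1) ω) 0 with hle | hpos
  · rw [Real.sqrt_eq_zero_of_nonpos hle]; positivity
  have h5 := h3 hpos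
  set V := condVariance μ ℱ Y (i + 1) ω
  set s := stdDev μ Y n
  have hx0 : 0 < √V := Real.sqrt_pos.2 hpos
  have hxV : V = √V ^ 2 := (Real.sq_sqrt hpos.le).symm
  set x := √V
  have h6 := hψ.cube_le x s hx0 h4
  rw [hxV] at h5
  rw [← mul_div_assoc, le_div_iff₀ hψs]
  have h7 : x ^ 2 * (x * ψ s) ≤ x ^ 2 * (6 * θ * s ^ 3) := by
    calc x ^ 2 * (x * ψ s) = ψ s * x ^ 3 := by ring
      _ ≤ ψ x * s ^ 3 := h6
      _ ≤ (6 * θ * x ^ 2) * s ^ 3 := by gcongr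
      _ = _ := by ring
  exact le_of_mul_le_mul_left h7 (by positivity)

/-- The weight `v ^ e` is predictable, so conditioning replaces `ψ(|Y|)` by `θ` times the decrement
of the remaining variance. The sum is then telescoped through `F`, which plays the role of a
primitive of `v ^ e`: a power for `e > -1`, the logarithm for `e = -1`. -/
theorem CondMomentBound.lindebergSum_le (hb : CondMomentBound μ ℱ ψ Y n θ)
    (hV : ∀ᵐ ω ∂μ, normalizedVariance μ ℱ Y n ω = 1) (hθ : 0 < θ)
    (hψ : IsQuadCubic ψ) {ε : ℝ} (hε : 0 < ε)
    (hσ : ∀ᵐ ω ∂μ, ∀ i < n, √(condVariance μ ℱ Y (i + 1) ω) ≤ ε) {k : ℕ} {W e : ℝ} (hW : 0 ≤ W)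
    (he0 : e ≤ 0) (he1 : -1 ≤ e) {F : ℝ → ℝ}
    (hF : ∀ a b, 0 < a → 0 < b → (b - a) * b ^ e ≤ F b - F a)
    (hw : ∀ x, 0 < x → x ^ 2 ≤ ε ^ 2 + stdDev μ Y n ^ 2 → x ^ k / ψ x ≤ W * (x ^ 2) ^ e) :
    lindebergSum μ ℱ Y n k ε
      ≤ 2 * θ * W * (F (ε ^ 2 + stdDev μ Y n ^ 2) - F (ε ^ 2)) := by
  have hε2 : 0 < ε ^ 2 := by positivity
  set v : ℕ → Ω → ℝ := remVar μ ℱ Y n ε with hv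
  have hvpos : ∀ i ω, 0 < v i ω := fun i ω => hε2.trans_le (sq_le_remVar ε i ω)
  have hve0 : ∀ i ω, 0 ≤ v i ω ^ e := fun i ω => Real.rpow_nonneg (hvpos i ω).le e
  have hvb : ∀ i, ∀ᵐ ω ∂μ, |v i ω ^ e| ≤ (ε ^ 2) ^ e := fun i => Eventually.of_forall fun ω => by
    rw [abs_of_nonneg (hve0 i ω)]
    exact Real.rpow_le_rpow_of_nonpos hε2 (sq_le_remVar ε i ω) he0
  have hvm : ∀ i, Measurable[ℱ i] fun ω => v (i + 1) ω ^ e := fun i =>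
    (measurable_remVar ε i).pow_const e
  have hvae : ∀ i, AEStronglyMeasurable (fun ω => v (i + 1) ω ^ e) μ := fun i =>
    ((hvm i).mono (ℱ.le i) le_rfl).aestronglyMeasurable
  have iV : ∀ i, Integrable (fun ω => v (i + 1) ω ^ e * condVariance μ ℱ Y (i + 1) ω) μ :=
    fun i => integrable_bdd_mul' integrable_condExp (hvae i) (hvb _)
  have step : ∀ i ∈ Finset.range n, ∫ ω, √(v (i + 1) ω) ^ k * quadCubic (Y (i + 1) ω / √(v (i + 1) ω)) ∂μ
      ≤ W * (θ * ∫ ω, v (i + 1) ω ^ e * condVariance μ ℱ Y (i + 1) ω ∂μ) := by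
    intro i hi
    obtain ⟨hint, hle⟩ := hb (i + 1) (Finset.mem_Icc.2 ⟨by omega, by
      have := Finset.mem_range.1 hi; omega⟩)
    have i1 := integrable_bdd_mul' hint (hvae i) (hvb _)
    have e1 := integral_mul_condExp (ℱ.le i) (hvm i).stronglyMeasurable hint i1
    calc _ ≤ ∫ ω, W * (v (i + 1) ω ^ e * ψ |Y (i + 1) ω|) ∂μ := by
          refine integral_mono_of_nonneg (Eventually.of_forall fun ω =>
            mul_nonneg (by positivity) (quadCubic_nonneg _)) (i1.const_mul W) ?_
          filter_upwards [ae_remVar_le hV ε] with ω hω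
          have hx : 0 < √(v (i + 1) ω) := Real.sqrt_pos.2 (hvpos _ ω)
          have hx2 : √(v (i + 1) ω) ^ 2 = v (i + 1) ω := Real.sq_sqrt (hvpos _ ω).le
          have h1 := hw _ hx (by rw [hx2]; exact hω _)
          rw [hx2] at h1
          have h2 := hψ.nonneg (abs_nonneg (Y (i + 1) ω))
          calc _ ≤ √(v (i + 1) ω) ^ k * (ψ |Y (i + 1) ω| / ψ √(v (i + 1) ω)) := by
                gcongr; exact hψ.quadCubic_le hx _
            _ = √(v (i + 1) ω) ^ k / ψ √(v (i + 1) ω) * ψ |Y (i + 1) ω| := by ring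
            _ ≤ (W * v (i + 1) ω ^ e) * ψ |Y (i + 1) ω| := by gcongr
            _ = _ := by ring
      _ ≤ _ := by
          rw [integral_const_mul, e1, ← integral_const_mul θ]
          refine mul_le_mul_of_nonneg_left (integral_mono_ae ?_ ((iV i).const_mul θ) ?_) hW
          · exact integrable_bdd_mul' integrable_condExp (hvae i) (hvb _)
          · filter_upwards [hle] with ω hω
            calc _ ≤ v (i + 1) ω ^ e * (θ * condVariance μ ℱ Y (i + 1) ω) :=
                  mul_le_mul_of_nonneg_left hω (hve0 _ _)
              _ = _ := by ring
  have hsum : ∑ i ∈ Finset.range n, ∫ ω, v (i + 1) ω ^ e * condVariance μ ℱ Y (i + 1) ω ∂μ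
      ≤ 2 * (F (ε ^ 2 + stdDev μ Y n ^ 2) - F (ε ^ 2)) := by
    rw [← integral_finsetSum _ fun i _ => iV i]
    have : ∫ _, 2 * (F (ε ^ 2 + stdDev μ Y n ^ 2) - F (ε ^ 2)) ∂μ
        = 2 * (F (ε ^ 2 + stdDev μ Y n ^ 2) - F (ε ^ 2)) := by simp
    rw [← this]
    refine integral_mono_ae (integrable_finsetSum _ fun i _ => iV i) (integrable_const _) ?_
    filter_upwards [ae_remVar hV ε, hσ] with ω h1 h2
    have hst : ∀ i ∈ Finset.range n, v (i + 1) ω ^ e * condVariance μ ℱ Y (i + 1) ω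
        ≤ 2 * (F (v i ω) - F (v (i + 1) ω)) := by
      intro i hi
      have hi' := Finset.mem_range.1 hi
      have h3 : v i ω = v (i + 1) ω + condVariance μ ℱ Y (i + 1) ω := h1.2.1 i hi'
      have h4 := h1.1 (i + 1)
      have h5 := (Real.sqrt_le_left hε.le).1 (h2 i hi')
      have h6 : v i ω ≤ 2 * v (i + 1) ω := by
        have := sq_le_remVar (μ := μ) (ℱ := ℱ) (Y := Y) (n := n) ε (i + 1) ω
        change ε ^ 2 ≤ v (i + 1) ω at this
        linarith
      have h7 := Real.rpow_le_rpow_of_nonpos (hvpos i ω) h6 he0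
      rw [Real.mul_rpow (by norm_num) (hvpos _ ω).le] at h7
      have h8 : (1 / 2 : ℝ) ≤ 2 ^ e := by
        calc (1 / 2 : ℝ) = 2 ^ (-1 : ℝ) := by rw [Real.rpow_neg_one]; norm_num
          _ ≤ 2 ^ e := Real.rpow_le_rpow_of_exponent_le (by norm_num) he1
      have h9 : v (i + 1) ω ^ e ≤ 2 * v i ω ^ e := by nlinarith [hve0 (i + 1) ω]
      have h10 := hF _ _ (hvpos (i + 1) ω) (hvpos i ω)
      have h11 : v i ω - v (i + 1) ω = condVariance μ ℱ Y (i + 1) ω := by linarith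
      rw [h11] at h10
      calc _ ≤ (2 * v i ω ^ e) * condVariance μ ℱ Y (i + 1) ω := by gcongr
        _ = 2 * (condVariance μ ℱ Y (i + 1) ω * v i ω ^ e) := by ring
        _ ≤ _ := by linarith
    refine (Finset.sum_le_sum hst).trans_eq ?_
    rw [← Finset.mul_sum, Finset.sum_range_sub', hv, remVar_zero, h1.2.2]
  rw [lindebergSum]
  refine (Finset.sum_le_sum step).trans ?_
  rw [← Finset.mul_sum, ← Finset.mul_sum]
  calc _ ≤ W * (θ * (2 * (F (ε ^ 2 + stdDev μ Y n ^ 2) - F (ε ^ 2)))) := by gcongr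
    _ = _ := by ring

end Martingale

/-- Returns from the smoothed scale `R = √(ε² + s_n²)` to `s_n`. -/
theorem IsQuadCubic.pow_div_sqrt_le {ψ : ℝ → ℝ} (hψ : IsQuadCubic ψ) {s R : ℝ} (hs : 0 < s)
    (hsR : s ≤ R) (hR : R ^ 2 ≤ 2 * s ^ 2) {k : ℕ} (hk : k ≤ 2) :
    R ^ (k + 2) / ψ R ≤ 2 * (s ^ (k + 2) / ψ s) := by
  have hR0 := hs.trans_le hsR
  have hψs := hψ.pos s hs
  have hψR := hψ.pos R hR0
  have h1 := hψ.pow_div_le le_rfl hs hsR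
  have h2 : R ^ k ≤ 2 * s ^ k := by
    interval_cases k
    · norm_num
    · rw [pow_one, pow_one]; nlinarith
    · exact hR
  calc R ^ (k + 2) / ψ R = R ^ k * (R ^ 2 / ψ R) := by ring
    _ ≤ (2 * s ^ k) * (s ^ 2 / ψ s) := by gcongr
    _ = _ := by ring

section Martingale

variable {Ω : Type*} [mΩ : MeasurableSpace Ω] {μ : Measure Ω}
  {ℱ : Filtration ℕ mΩ} {Y : ℕ → Ω → ℝ} {n : ℕ} {ψ : ℝ → ℝ} {θ : ℝ}

theorem condMomentBound_of_maxNorm (h : IsMDS μ ℱ Y n)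
    (hθ : 0 < θ) (hmax : maxNorm μ Y n = ENNReal.ofReal θ) :
    CondMomentBound μ ℱ (fun x => x ^ 3) Y n θ := by
  intro i hi
  have hY := h.memLp i hi
  have hY2 : Integrable (fun ω => Y i ω ^ 2) μ := hY.integrable_sq
  have hle : ∀ᵐ ω ∂μ, |Y i ω| ≤ θ := by
    have h1 : eLpNorm (Y i) ∞ μ ≤ ENNReal.ofReal θ :=
      hmax ▸ Finset.le_sup (f := fun i => eLpNorm (Y i) ∞ μ) hi
    rw [eLpNorm_exponent_top] at h1
    filter_upwards [ae_le_eLpNormEssSup (f := Y i) (μ := μ)] with ω hω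
    have h2 := hω.trans h1
    rw [Real.enorm_eq_ofReal_abs] at h2
    exact (ENNReal.ofReal_le_ofReal_iff hθ.le).1 h2
  have hle3 : ∀ᵐ ω ∂μ, |Y i ω| ^ 3 ≤ θ * Y i ω ^ 2 := by
    filter_upwards [hle] with ω hω
    rw [← sq_abs (Y i ω)]
    nlinarith [sq_nonneg |Y i ω|]
  have hYm := hY.aestronglyMeasurable.aemeasurable
  have hI : Integrable (fun ω => |Y i ω| ^ 3) μ := by
    refine (hY2.const_mul θ).mono' (AEMeasurable.aestronglyMeasurable (by fun_prop)) ?_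
    filter_upwards [hle3] with ω hω
    rwa [Real.norm_eq_abs, abs_of_nonneg (by positivity)]
  refine ⟨hI, ?_⟩
  filter_upwards [condExp_mono (m := ℱ (i - 1)) hI (hY2.const_mul θ) hle3,
    condExp_smul (μ := μ) θ (fun ω => Y i ω ^ 2) (ℱ (i - 1))] with ω h1 h2
  exact h1.trans_eq h2

variable [IsProbabilityMeasure μ]

theorem CondMomentBound.lindebergSum_le_pow (hb : CondMomentBound μ ℱ ψ Y n θ)
    (hV : ∀ᵐ ω ∂μ, normalizedVariance μ ℱ Y n ω = 1) (hθ : 0 < θ)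
    (hψ : IsQuadCubic ψ) {ε : ℝ} (hε : 0 < ε) (hεs : ε ≤ stdDev μ Y n)
    (hσ : ∀ᵐ ω ∂μ, ∀ i < n, √(condVariance μ ℱ Y (i + 1) ω) ≤ ε) {k : ℕ} (hk : k ≤ 2) {p q : ℝ}
    (hq0 : 0 < q) (hq1 : q ≤ 1) (hq : p + 2 * q = k + 2)
    (hp : ∀ x R, 0 < x → x ≤ R → ψ R * x ^ p ≤ ψ x * R ^ p) :
    lindebergSum μ ℱ Y n k ε ≤ 4 * θ * q⁻¹ * (stdDev μ Y n ^ (k + 2) / ψ (stdDev μ Y n)) := by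
  have hs := stdDev_pos hV
  set s := stdDev μ Y n with hsdef
  set R := √(ε ^ 2 + s ^ 2) with hRdef
  have hR2 : R ^ 2 = ε ^ 2 + s ^ 2 := Real.sq_sqrt (by positivity)
  have hR0 : 0 < R := Real.sqrt_pos.2 (by positivity)
  have hψR := hψ.pos R hR0
  have hψs := hψ.pos s hs
  have hsR : s ≤ R := Real.le_sqrt_of_sq_le (by nlinarith [sq_nonneg ε])
  have hRs : R ^ 2 ≤ 2 * s ^ 2 := by rw [hR2]; nlinarith
  have hW : 0 ≤ R ^ p / ψ R := div_nonneg (Real.rpow_nonneg hR0.le _) hψR.le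
  have h1 := hb.lindebergSum_le hV hθ hψ hε hσ (k := k) hW (e := q - 1) (by linarith)
    (by linarith) (F := fun v => v ^ q / q)
    (fun a b ha hb => rpow_concave_step hq0 hq1 ha.le hb) fun x hx hxR => by
      refine pow_div_le_rpow hx (hψ.pos x hx) hψR (hp x R hx ?_) hq
      exact le_of_sq_le_sq (by rw [hR2]; exact hxR) hR0.le
  refine h1.trans ?_
  rw [← hR2]
  have h2 : 0 ≤ (ε ^ 2) ^ q / q := by positivity
  calc _ ≤ 2 * θ * (R ^ p / ψ R) * ((R ^ 2) ^ q / q) := by gcongr; linarith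
    _ = 2 * θ * q⁻¹ * (R ^ (k + 2) / ψ R) := by
      rw [← rpow_mul_sq_rpow hR0 (p := p) (q := q) (k := k + 2) (by push_cast; exact hq)]
      ring
    _ ≤ 2 * θ * q⁻¹ * (2 * (s ^ (k + 2) / ψ s)) := by
      gcongr; exact hψ.pow_div_sqrt_le hs hsR hRs hk
    _ = _ := by ring

theorem CondMomentBound.distNormal_one_le (hb : CondMomentBound μ ℱ ψ Y n θ) (h : IsMDS μ ℱ Y n)
    (hV : ∀ᵐ ω ∂μ, normalizedVariance μ ℱ Y n ω = 1) (hθ : 0 < θ) (hψ : IsQuadCubic ψ)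
    {p : ℝ} (hp2 : 2 < p) (hp3 : p < 3) (hp : Prec ψ fun x => x ^ p) :
    distNormal 1 μ Y n ≤ ENNReal.ofReal (14 * distConst * θ *
      ((3 - p)⁻¹ * (stdDev μ Y n ^ 2 / ψ (stdDev μ Y n)))) := by
  have hs := stdDev_pos hV
  have hC := one_le_distConst
  have hψs := hψ.pos _ hs
  have hp' : 0 < 3 - p := by linarith
  set s := stdDev μ Y n with hsdef
  have hε : 0 < min (6 * θ * (s ^ 3 / ψ s)) s := lt_min (by positivity) hs
  refine h.distNormal_one_le hV hε (by positivity) ?_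
  have h1 := hb.lindebergSum_le_pow hV hθ hψ hε (min_le_right _ _) (hb.ae_sqrt_le h hV hθ hψ)
    (k := 1) (p := p) (q := (3 - p) / 2) (by norm_num) (by linarith) (by linarith)
    (by push_cast; ring) fun x R hx hxR => hp.rpow_le hψ hx hxR
  rw [← hsdef, inv_div] at h1
  have h2 : min (6 * θ * (s ^ 3 / ψ s)) s ≤ 6 * θ * (s ^ 3 / ψ s) := min_le_left _ _
  have h3 : 1 ≤ (3 - p)⁻¹ := (one_le_inv₀ hp').2 (by linarith)
  have h4 : 0 ≤ 6 * θ * (s ^ 3 / ψ s) := by positivity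
  -- The constant `14` is `6 + 8`: the smoothing error and `4 / q` with `q = (3 - p) / 2`.
  calc _ ≤ distConst * (6 * θ * (s ^ 3 / ψ s) * (3 - p)⁻¹
        + 4 * θ * (2 / (3 - p)) * (s ^ (1 + 2) / ψ s)) := by
        gcongr
        exact h2.trans (le_mul_of_one_le_right h4 h3)
    _ = _ := by field_simp; ring

theorem CondMomentBound.distNormal_two_le (hb : CondMomentBound μ ℱ ψ Y n θ) (h : IsMDS μ ℱ Y n)
    (hV : ∀ᵐ ω ∂μ, normalizedVariance μ ℱ Y n ω = 1) (hθ : 0 < θ) (hψ : IsQuadCubic ψ) :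
    distNormal 2 μ Y n ≤ ENNReal.ofReal (√(14 * distConst * θ) *
      (stdDev μ Y n / √(ψ (stdDev μ Y n)))) := by
  have hs := stdDev_pos hV
  have hC := one_le_distConst
  have hψs := hψ.pos _ hs
  set s := stdDev μ Y n with hsdef
  have hκ : 0 < 6 * θ * (s ^ 3 / ψ s) := by positivity
  have hε : 0 < min (6 * θ * (s ^ 3 / ψ s)) s := lt_min hκ hs
  refine h.distNormal_two_le hV hε (by positivity) ?_
  have h1 := hb.lindebergSum_le_pow hV hθ hψ hε (min_le_right _ _) (hb.ae_sqrt_le h hV hθ hψ)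
    (k := 2) (p := 3) (q := 1 / 2) le_rfl (by norm_num) (by norm_num)
    (by norm_num) fun x R hx hxR => hψ.rpow_three_le hx hxR
  rw [← hsdef] at h1
  -- One factor of `ε ^ 2` is bounded by each entry of the minimum, which makes the smoothing error
  -- of the same order `s ^ 4 / ψ s` as the Lindeberg sum.
  have h2 : min (6 * θ * (s ^ 3 / ψ s)) s ^ 2 ≤ 6 * θ * (s ^ 3 / ψ s) * s := by
    rw [sq]
    exact mul_le_mul (min_le_left _ _) (min_le_right _ _) hε.le hκ.le
  calc _ ≤ distConst * (6 * θ * (s ^ 3 / ψ s) * s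
        + 4 * θ * (1 / 2)⁻¹ * (s ^ (2 + 2) / ψ s)) := by gcongr
    _ = _ := by
      rw [mul_pow, mul_pow, div_pow, Real.sq_sqrt hψs.le, Real.sq_sqrt (by positivity)]
      field_simp; ring

theorem CondMomentBound.distNormal_one_le_cube (hb : CondMomentBound μ ℱ ψ Y n θ)
    (h : IsMDS μ ℱ Y n) (hV : ∀ᵐ ω ∂μ, normalizedVariance μ ℱ Y n ω = 1) (hθ : 0 < θ)
    (hψ : IsQuadCubic ψ) (hψ3 : ∀ x, 0 ≤ x → ψ x = x ^ 3) :
    distNormal 1 μ Y n ≤ ENNReal.ofReal (14 * distConst *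
      (θ / stdDev μ Y n * Real.log (Real.exp 1 + stdDev μ Y n / θ))) := by
  have hs := stdDev_pos hV
  have hC := one_le_distConst
  have hσ := hb.ae_sqrt_le h hV hθ hψ
  set s := stdDev μ Y n with hsdef
  have e1 : 6 * θ * (s ^ 3 / ψ s) = 6 * θ := by
    rw [hψ3 s hs.le, div_self (by positivity), mul_one]
  rw [e1] at hσ
  set ε := min (6 * θ) s with hεdef
  have hε : 0 < ε := lt_min (by positivity) hs
  have hexp : 2 ≤ Real.exp 1 := by linarith [Real.add_one_le_exp (1 : ℝ)]
  set ℓ := Real.log (Real.exp 1 + s / θ) with hℓ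
  have hsθ : 0 < s / θ := by positivity
  have hℓ1 : 1 ≤ ℓ := by
    rw [hℓ, Real.le_log_iff_exp_le (by positivity)]; linarith
  refine h.distNormal_one_le hV hε (by positivity) ?_
  have h1 := hb.lindebergSum_le hV hθ hψ hε hσ (k := 1) zero_le_one (e := -1) (by norm_num)
    le_rfl (F := Real.log) (fun a b ha hb => log_concave_step ha hb) fun x hx _ => by
      rw [hψ3 x hx.le, Real.rpow_neg_one]
      refine le_of_eq ?_
      field_simp
  rw [← hsdef, ← Real.log_div (by positivity) (by positivity)] at h1
  have h2 : Real.log ((ε ^ 2 + s ^ 2) / ε ^ 2) ≤ 2 * ℓ := by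
    have : (ε ^ 2 + s ^ 2) / ε ^ 2 ≤ (Real.exp 1 + s / θ) ^ 2 := by
      rcases le_total (6 * θ) s with hle | hle
      · have e2 : ε = 6 * θ := min_eq_left hle
        have e3 : (ε ^ 2 + s ^ 2) / ε ^ 2 = 1 + (s / θ) ^ 2 / 36 := by
          rw [e2]; field_simp; ring
        rw [e3]; nlinarith [sq_nonneg (s / θ)]
      · have e2 : ε = s := min_eq_right hle
        have e3 : (ε ^ 2 + s ^ 2) / ε ^ 2 = 2 := by rw [e2]; field_simp; norm_num
        rw [e3]; nlinarith
    calc _ ≤ Real.log ((Real.exp 1 + s / θ) ^ 2) := Real.log_le_log (by positivity) this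
      _ = 2 * ℓ := by rw [Real.log_pow]; norm_num [hℓ]
  have h3 : ε ≤ 6 * θ * ℓ := (min_le_left _ _).trans (le_mul_of_one_le_right (by positivity) hℓ1)
  calc _ ≤ distConst * (6 * θ * ℓ + 2 * θ * 1 * (2 * ℓ)) := by
        gcongr; exact h1.trans (by gcongr)
    _ = 10 * (distConst * θ * ℓ) := by ring
    _ ≤ 14 * (distConst * θ * ℓ) := by gcongr; norm_num
    _ = _ := by rw [← hsdef]; field_simp

end Martingale

/-! ### Constants and conclusion -/

theorem log_exp_add_div_le {s θ : ℝ} (hs : 0 < s) (hθ : 0 < θ) :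
    Real.log (Real.exp 1 + s / θ) ≤ (1 + |Real.log θ|) * Real.log (Real.exp 1 + s) := by
  have he := Real.exp_pos 1
  have hl : 1 ≤ Real.log (Real.exp 1 + s) := by
    rw [Real.le_log_iff_exp_le (by positivity)]; linarith
  rcases le_total 1 θ with h1 | h1
  · have : s / θ ≤ s := div_le_self hs.le h1
    have h2 : Real.log (Real.exp 1 + s / θ) ≤ Real.log (Real.exp 1 + s) := by gcongr
    nlinarith [abs_nonneg (Real.log θ)]
  · have h2 : Real.exp 1 + s / θ ≤ (Real.exp 1 + s) / θ := by
      rw [add_div]; gcongr; exact le_div_self he.le hθ h1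
    have h3 := Real.log_le_log (by positivity) h2
    rw [Real.log_div (by positivity) hθ.ne'] at h3
    nlinarith [abs_nonneg (Real.log θ), neg_le_abs (Real.log θ)]

/-- A constant that depends on the bound `θ` of the conditional moments only. -/
noncomputable def boundConst (θ : ℝ) : ℝ :=
  14 * distConst * (1 + θ) * (1 + |Real.log θ|) + √(14 * distConst * θ)

end MartingaleCLT

open MartingaleCLT

/-- `C` is a universal constant, and `K θ` depends on `θ` only. -/
theorem mainTheorem5 :
    ∃ (C : ℝ) (K : ℝ → ℝ), ∀ (Ω : Type*) [mΩ : MeasurableSpace Ω] (μ : Measure Ω)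
      [IsProbabilityMeasure μ] (ℱ : Filtration ℕ mΩ) (Y : ℕ → Ω → ℝ) (n : ℕ) (ψ : ℝ → ℝ),
      IsMDS μ ℱ Y n →
      (∀ᵐ ω ∂μ, normalizedVariance μ ℱ Y n ω = 1) →
      IsNFunction ψ →
      Prec ψ (fun x => x ^ 3) →
      ConvexOn ℝ (Ici 0) (fun x => ψ (√x)) →
      -- (i)
      (distNormal 1 μ Y n ≤ ENNReal.ofReal C * lyapunov μ ψ Y n ∧
        distNormal 2 μ Y n ≤ ENNReal.ofReal C * lyapunov μ ψ Y n) ∧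
      -- (ii)
      (∀ σ : ℝ, 0 < σ →
        (∀ᵐ ω ∂μ, ∀ i ∈ Finset.Icc 1 n, σ ≤ √(condVariance μ ℱ Y i ω)) →
        ((∀ x, 0 ≤ x → ψ x = x ^ 3) → 2 ≤ n →
          distNormal 1 μ Y n ≤
            ENNReal.ofReal (C * (Real.log n / (σ ^ 2 * stdDev μ Y n))) * maxMoment μ ψ Y n) ∧
        (∀ p : ℝ, 2 < p → p < 3 → Prec ψ (fun x => x ^ p) →
          distNormal 1 μ Y n ≤
            ENNReal.ofReal
              (C * ((3 - p)⁻¹ * (stdDev μ Y n ^ 2 / (σ ^ 2 * ψ (stdDev μ Y n))))) *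
              maxMoment μ ψ Y n) ∧
        distNormal 2 μ Y n ≤
          ENNReal.ofReal (C * (stdDev μ Y n / (σ * √(ψ (stdDev μ Y n))))) *
            maxMoment μ ψ Y n ^ (1 / 2 : ℝ)) ∧
      -- (iii)
      (∀ θ : ℝ, 0 < θ → CondMomentBound μ ℱ ψ Y n θ →
        ((∀ x, 0 ≤ x → ψ x = x ^ 3) →
          distNormal 1 μ Y n ≤
            ENNReal.ofReal
              (K θ * (1 / stdDev μ Y n * Real.log (Real.exp 1 + stdDev μ Y n)))) ∧
        (∀ p : ℝ, 2 < p → p < 3 → Prec ψ (fun x => x ^ p) →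
          distNormal 1 μ Y n ≤
            ENNReal.ofReal
              (K θ * ((3 - p)⁻¹ * (stdDev μ Y n ^ 2 / ψ (stdDev μ Y n))))) ∧
        distNormal 2 μ Y n ≤
          ENNReal.ofReal (K θ * (stdDev μ Y n / √(ψ (stdDev μ Y n))))) ∧
      -- bounded increments
      (∀ θ : ℝ, 0 < θ → maxNorm μ Y n = ENNReal.ofReal θ →
        distNormal 1 μ Y n ≤
          ENNReal.ofReal
            (C * (θ / stdDev μ Y n * Real.log (Real.exp 1 + stdDev μ Y n / θ))) ∧
        (1 ≤ θ →
          distNormal 1 μ Y n ≤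
            ENNReal.ofReal
              (C * (θ / stdDev μ Y n * Real.log (Real.exp 1 + stdDev μ Y n)))) ∧
        distNormal 1 μ Y n ≤
          ENNReal.ofReal
            (K θ * (θ / stdDev μ Y n * Real.log (Real.exp 1 + stdDev μ Y n))) ∧
        distNormal 2 μ Y n ≤ ENNReal.ofReal (C * √(θ / stdDev μ Y n))) := by
  have hC := one_le_distConst
  have hK : ∀ θ : ℝ, 0 < θ → 14 * distConst * θ ≤ boundConst θ ∧
      14 * distConst * (θ * (1 + |Real.log θ|)) ≤ boundConst θ ∧
      14 * distConst * (1 + |Real.log θ|) ≤ boundConst θ ∧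
      √(14 * distConst * θ) ≤ boundConst θ := by
    intro θ hθ
    have h1 : 0 ≤ |Real.log θ| := abs_nonneg _
    have h2 : 0 ≤ √(14 * distConst * θ) := Real.sqrt_nonneg _
    have h3 : 0 ≤ 14 * distConst := by positivity
    have h4 : 0 ≤ 14 * distConst * θ := by positivity
    have h5 : 0 ≤ 14 * distConst * |Real.log θ| := by positivity
    have h6 : 0 ≤ 14 * distConst * θ * |Real.log θ| := by positivity
    unfold boundConst
    refine ⟨?_, ?_, ?_, ?_⟩ <;> linarith
  refine ⟨14 * distConst, boundConst, ?_⟩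
  intro Ω mΩ μ _ ℱ Y n ψ h hV hN hP hc
  have hψ := hN.isQuadCubic hP hc
  have hs := stdDev_pos hV
  have hψs := hψ.pos _ hs
  have hn := pos_of_normalizedVariance hV
  have hexp := Real.exp_pos 1
  have hlog : 0 ≤ Real.log (Real.exp 1 + stdDev μ Y n) :=
    Real.log_nonneg (by linarith [Real.add_one_le_exp (1 : ℝ)])
  have hi : distNormal 2 μ Y n ≤ ENNReal.ofReal (14 * distConst) * lyapunov μ ψ Y n :=
    (h.distNormal_le_lyapunov hV hN hψ).trans (by gcongr; norm_num)
  refine ⟨⟨h.distNormal_one_le_two.trans hi, hi⟩, fun σ hσ hl => ⟨fun hψ3 hn2 => ?_,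
    fun p hp2 hp3 hp => ?_, ?_⟩, fun θ hθ hb => ⟨fun hψ3 => ?_, fun p hp2 hp3 hp => ?_, ?_⟩,
    fun θ hθ hmax => ?_⟩
  · exact h.distNormal_one_le_cube hV hψ hσ hl hψ3 hn2
  · exact h.distNormal_one_le_maxMoment hV hψ hσ hl hp2 hp3 hp
  · exact h.distNormal_two_le_maxMoment hV hψ hσ hl
  · refine (hb.distNormal_one_le_cube h hV hθ hψ hψ3).trans (ENNReal.ofReal_le_ofReal ?_)
    calc _ ≤ 14 * distConst * (θ / stdDev μ Y n *
          ((1 + |Real.log θ|) * Real.log (Real.exp 1 + stdDev μ Y n))) := by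
          gcongr; exact log_exp_add_div_le hs hθ
      _ = 14 * distConst * (θ * (1 + |Real.log θ|)) *
          (1 / stdDev μ Y n * Real.log (Real.exp 1 + stdDev μ Y n)) := by ring
      _ ≤ _ := by gcongr; exact (hK θ hθ).2.1
  · refine (hb.distNormal_one_le h hV hθ hψ hp2 hp3 hp).trans (ENNReal.ofReal_le_ofReal ?_)
    have : 0 < 3 - p := by linarith
    gcongr
    exact (hK θ hθ).1
  · refine (hb.distNormal_two_le h hV hθ hψ).trans (ENNReal.ofReal_le_ofReal ?_)
    gcongr
    exact (hK θ hθ).2.2.2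
  · have hb := condMomentBound_of_maxNorm h hθ hmax
    -- For bounded increments the given `ψ` plays no role: `E[|Y|³ | ℱ] ≤ θ σ²`, so (iii) applies
    -- with the cube.
    have h1 := hb.distNormal_one_le_cube h hV hθ isQuadCubic_cube fun _ _ => rfl
    refine ⟨h1, fun hθ1 => h1.trans (ENNReal.ofReal_le_ofReal ?_),
      h1.trans (ENNReal.ofReal_le_ofReal ?_),
      (hb.distNormal_two_le h hV hθ isQuadCubic_cube).trans (ENNReal.ofReal_le_ofReal ?_)⟩
    · gcongr
      exact div_le_self hs.le hθ1
    · calc _ ≤ 14 * distConst * (θ / stdDev μ Y n *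
            ((1 + |Real.log θ|) * Real.log (Real.exp 1 + stdDev μ Y n))) := by
            gcongr; exact log_exp_add_div_le hs hθ
        _ = 14 * distConst * (1 + |Real.log θ|) *
            (θ / stdDev μ Y n * Real.log (Real.exp 1 + stdDev μ Y n)) := by ring
        _ ≤ _ := by gcongr; exact (hK θ hθ).2.2.1
    · refine le_of_sq_le_sq ?_ (by positivity)
      rw [mul_pow, div_pow, mul_pow, Real.sq_sqrt (by positivity), Real.sq_sqrt (by positivity),
        Real.sq_sqrt (by positivity)]
      calc _ = 14 * distConst * (θ / stdDev μ Y n) := by field_simp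
        _ ≤ _ := by gcongr; nlinarith
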